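/- Fix a finite gate set $\mathcal C$ (finitely many unitaries, each on a fixed number of qubits) over which NOT, CNOT and Toffoli can be implemented exactly. Circuits may use gates of $\mathcal C$ on any qubits. A $\mathsf{QMA}^\infty$ circuit may in addition use a counter register $B$ with orthonormal basis $|d\rangle$, $d\in\mathbb N$, and two kinds of operations on it: the controlled increment $|0\rangle\langle 0|_i\otimes I_B+|1\rangle\langle 1|_i\otimes[+1]_B$ with $[+1]|d\rangle=|d+1\rangle$, and the Pauli $X$ on a qubit $i$ conditioned on $|0\rangle_B$. A circuit has an ancilla register $A$, initialised to $|0\rangle$, a witness register $W$ (for $\mathsf{QMA}^\infty$ the witness is a state on $BW$), and a designated output qubit; it accepts if that qubit is measured to be $1$. A family $x\mapsto V(x)$ of circuits is a $\mathsf{QMA}^\infty(c,s)$ verifier for the promise problem $L=(L_{\rm yes},L_{\rm no})$ if a polynomial-time Turing machine outputs a description of $V(x)$ on input $x$, some witness state is accepted by $V(x)$ with probability at least $c$ for each $x\in L_{\rm yes}$, and every witness state is accepted with probability at most $s$ for each $x\in L_{\rm no}$; a $\mathsf{QMA}(c,s)$ verifier is the same without counter. The numbers $c,s$ may depend on $x$.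 Lemma. There is a universal constant $K$ such that the following holds. Let $V$ be a $\mathsf{QMA}^\infty(c,s)$ verifier for $L$ with witness register $BW$ and ancilla register $A$, and let $\ell=\ell(x)$ be the number of controlled increments in $V(x)$. Let $m=m(x)\ge 1$ be an integer, computable (in unary) in time polynomial in $|x|$, with $m>\log_2\ell+3$ (that is, $2^m>8\ell$). Let $D$ be the smallest power of two greater than $2^m+\ell$, and let $\tilde V_D$ be the $D$-level truncation of $V$: the counter $B$ is replaced by a register $\tilde B$ with basis $|0\rangle,\dots,|D-1\rangle$, the increment by the increment modulo $D$, and the conditioning on $|0\rangle_B$ by conditioning on $|0\rangle_{\tilde B}$. Store $\tilde B$ in binary in $\log_2 D$ qubits; let the ancilla register $A'$ consist of $A$ and the $\log_2 D-m$ most significant qubits of $\tilde B$, and let the witness register $W'$ consist of $W$ and the $m$ least significant qubits of $\tilde B$. Then $\tilde V_D$ is a $\mathsf{QMA}(c',s)$ verifier for $L$ with $$c'=c-K\sqrt{2^{-m}\,\ell}.$$ Precisely: there is a family of counter-free circuits over $\mathcal C$, whose description is output by a polynomial-time Turing machine on input $x$, with witness register $W'$ and with ancilla register $A'$ together with work qubits,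 that acts exactly as $\tilde V_D(x)$ when the work qubits are in the state $|0\rangle$ and leaves them in that state; and this family is a $\mathsf{QMA}(c',s)$ verifier for $L$. -/

import Mathlib

open scoped ENNReal

noncomputable section

/-! ### Hilbert spaces with a distinguished basis, and basic isometries on them -/

/-- The Hilbert space `ℓ²(ι)` with orthonormal basis `|i⟩`, `i : ι`. -/
abbrev Hilb (ι : Type) : Type := lp (fun _ : ι => ℂ) 2

namespace Hilb

variable {ι ι' : Type}

theorem summable_norm_sq (ψ : Hilb ι) : Summable fun i => ‖ψ i‖ ^ 2 := by
  have h := (lp.memℓp ψ).summable (by norm_num)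
  simpa using h

theorem norm_sq (ψ : Hilb ι) : ‖ψ‖ ^ 2 = ∑' i, ‖ψ i‖ ^ 2 := by
  have h := lp.norm_rpow_eq_tsum (p := 2) (by norm_num) ψ
  simpa using h

theorem mem_of_summable {f : ι → ℂ} (h : Summable fun i => ‖f i‖ ^ 2) :
    Memℓp f 2 :=
  memℓp_gen (by simpa using h)

/-- Build a linear isometry from a linear map on amplitude functions preserving `∑ |ψ i|²`. -/
def isometryOf (T : (ι → ℂ) →ₗ[ℂ] (ι' → ℂ))
    (hT : ∀ ψ : Hilb ι, HasSum (fun j => ‖T ψ j‖ ^ 2) (∑' i, ‖ψ i‖ ^ 2)) :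
    Hilb ι →ₗᵢ[ℂ] Hilb ι' where
  toFun ψ := ⟨T ψ, mem_of_summable (hT ψ).summable⟩
  map_add' ψ φ := by
    apply lp.ext
    exact map_add T ⇑ψ ⇑φ
  map_smul' a ψ := by
    apply lp.ext
    exact map_smul T a ⇑ψ
  norm_map' ψ := by
    have h : ‖(⟨T ψ, mem_of_summable (hT ψ).summable⟩ : Hilb ι')‖ ^ 2 = ‖ψ‖ ^ 2 := by
      rw [norm_sq, norm_sq]
      exact (hT ψ).tsum_eq
    exact (sq_eq_sq₀ (norm_nonneg _) (norm_nonneg _)).1 h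

@[simp] theorem isometryOf_apply (T : (ι → ℂ) →ₗ[ℂ] (ι' → ℂ)) (hT) (ψ : Hilb ι) (j : ι') :
    isometryOf T hT ψ j = T ψ j := rfl

/-- The isometry `|i⟩ ↦ |f i⟩` given by an injective map `f` of basis labels. -/
def basisMap (f : ι ↪ ι') : Hilb ι →ₗᵢ[ℂ] Hilb ι' :=
  isometryOf
    { toFun := fun ψ => Function.extend f ψ 0
      map_add' := fun ψ φ => by
        funext j
        by_cases h : ∃ i, f i = j
        · obtain ⟨i, rfl⟩ := h
          simp [f.injective.extend_apply]
        · simp [Function.extend_apply' _ _ _ h]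
      map_smul' := fun a ψ => by
        funext j
        by_cases h : ∃ i, f i = j
        · obtain ⟨i, rfl⟩ := h
          simp [f.injective.extend_apply]
        · simp [Function.extend_apply' _ _ _ h] }
    (fun ψ => by
      have h0 : ∀ j, j ∉ Set.range f →
          ‖Function.extend f (⇑ψ) (0 : ι' → ℂ) j‖ ^ 2 = 0 := fun j hj => by
        rw [Function.extend_apply' _ _ _ (by simpa using hj)]; simp
      refine (f.injective.hasSum_iff h0).1 ?_
      have : ((fun j => ‖Function.extend f (⇑ψ) (0 : ι' → ℂ) j‖ ^ 2) ∘ f)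
          = fun i => ‖ψ i‖ ^ 2 := by
        funext i
        simp [f.injective.extend_apply]
      simpa [this] using (summable_norm_sq ψ).hasSum)

@[simp] theorem basisMap_apply (f : ι ↪ ι') (ψ : Hilb ι) (i : ι) :
    basisMap f ψ (f i) = ψ i :=
  f.injective.extend_apply _ _ _

/-- The orthogonal projection onto the closed span of the `|i⟩` with `i ∈ S`. -/
def project (S : Set ι) (ψ : Hilb ι) : Hilb ι :=
  ⟨S.indicator ψ, mem_of_summable <| by
    refine (summable_norm_sq ψ).of_nonneg_of_le (fun i => by positivity) (fun i => ?_)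
    by_cases h : i ∈ S <;> simp [h]⟩

end Hilb

/-! ### Gate sets and gates placed on qubits -/

/-- A finite gate set: finitely many gates, each a unitary on a fixed number of qubits. -/
structure GateSet where
  num : ℕ
  arity : Fin num → ℕ
  unitary : (g : Fin num) → Matrix.unitaryGroup (Fin (arity g) → Bool) ℂ

/-- Splitting off the qubits at the positions `e 0, …, e (k-1)`. -/
def splitQubits {κ : Type} {n k : ℕ} (e : Fin k ↪ Fin n) :
    κ × (Fin n → Bool) ≃
      (Fin k → Bool) × (κ × ({i : Fin n // ¬ ∃ j, e j = i} → Bool)) where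
  toFun p := (p.2 ∘ e, (p.1, fun i => p.2 i))
  invFun q := (q.2.1, Function.extend e q.1
    (fun i => if h : ∃ j, e j = i then false else q.2.2 ⟨i, h⟩))
  left_inv p := by
    refine Prod.ext rfl (funext fun i => ?_)
    by_cases h : ∃ j, e j = i
    · obtain ⟨j, rfl⟩ := h
      simp [e.injective.extend_apply]
    · simp [Function.extend_apply' _ _ _ h]
      simp at h
      simp [h]
  right_inv q := by
    refine Prod.ext (funext fun j => ?_) (Prod.ext rfl (funext fun i => ?_))
    · simp [e.injective.extend_apply]
    · have h := i.2
      simp only [Function.extend_apply' _ _ _ h, dif_neg h]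

theorem splitQubits_symm_comp {κ : Type} {n k : ℕ} (e : Fin k ↪ Fin n) (b : Fin k → Bool)
    (r : κ × ({i : Fin n // ¬ ∃ j, e j = i} → Bool)) :
    ((splitQubits e).symm (b, r)).2 ∘ e = b := by
  have h := (splitQubits (κ := κ) e).apply_symm_apply (b, r)
  exact congrArg Prod.fst h

theorem splitQubits_symm_extend {κ : Type} {n k : ℕ} (e : Fin k ↪ Fin n)
    (b b' : Fin k → Bool) (r : κ × ({i : Fin n // ¬ ∃ j, e j = i} → Bool)) :
    (((splitQubits e).symm (b, r)).1, Function.extend e b' ((splitQubits e).symm (b, r)).2)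
      = (splitQubits e).symm (b', r) := by
  refine Prod.ext rfl (funext fun i => ?_)
  by_cases h : ∃ j, e j = i
  · obtain ⟨j, rfl⟩ := h
    simp [splitQubits, e.injective.extend_apply]
  · simp [splitQubits, Function.extend_apply' _ _ _ h]

theorem sum_norm_sq_mulVec {β : Type} [Fintype β] [DecidableEq β]
    (U : Matrix.unitaryGroup β ℂ) (v : β → ℂ) :
    ∑ b, ‖((U : Matrix β β ℂ).mulVec v) b‖ ^ 2 = ∑ b, ‖v b‖ ^ 2 := by
  have key : ∀ w : β → ℂ, ((∑ b, ‖w b‖ ^ 2 : ℝ) : ℂ) = dotProduct (star w) w := fun w => by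
    simp [dotProduct, Complex.conj_mul']
  have h : dotProduct (star ((U : Matrix β β ℂ).mulVec v)) ((U : Matrix β β ℂ).mulVec v)
      = dotProduct (star v) v := by
    rw [Matrix.star_mulVec, Matrix.dotProduct_mulVec, Matrix.vecMul_vecMul,
      ← Matrix.star_eq_conjTranspose, Matrix.UnitaryGroup.star_mul_self U, Matrix.vecMul_one]
  rw [← key, ← key] at h
  exact_mod_cast h

theorem hasSum_of_fiber_sums {ι β ρ : Type} [Fintype β] (φ : ι ≃ β × ρ) {F G : ι → ℝ} {a : ℝ}
    (hG : ∀ p, 0 ≤ G p)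
    (hFG : ∀ r, ∑ b, G (φ.symm (b, r)) = ∑ b, F (φ.symm (b, r))) (hF : HasSum F a) :
    HasSum G a := by
  let φ' : ρ × β ≃ ι := (Equiv.prodComm ρ β).trans φ.symm
  have h1 : HasSum (F ∘ φ') a := φ'.hasSum_iff.2 hF
  have h2 : HasSum (fun r => ∑ b, F (φ.symm (b, r))) a :=
    h1.prod_fiberwise fun r => hasSum_fintype fun b => F (φ.symm (b, r))
  have h3 : HasSum (fun r => ∑ b, G (φ.symm (b, r))) a := by simpa [hFG] using h2
  have hs : Summable (G ∘ φ') := by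
    refine (summable_prod_of_nonneg fun p => hG _).2 ⟨fun r => (hasSum_fintype _).summable, ?_⟩
    simpa [tsum_fintype, φ'] using h3.summable
  have h4 : HasSum (fun r => ∑ b, G (φ.symm (b, r))) (∑' p, (G ∘ φ') p) :=
    hs.hasSum.prod_fiberwise fun r => hasSum_fintype fun b => G (φ.symm (b, r))
  have h5 := hs.hasSum
  rw [h4.unique h3] at h5
  exact φ'.hasSum_iff.1 h5

/-- The isometry on `κ ⊗ (n qubits)` that applies the `k`-qubit unitary `U` to the qubits
`e 0, …, e (k-1)`. Here `Function.extend e b y` is `y` with the bits at these positions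
replaced by `b`. -/
def applyGate {κ : Type} {n k : ℕ} (e : Fin k ↪ Fin n)
    (U : Matrix.unitaryGroup (Fin k → Bool) ℂ) :
    Hilb (κ × (Fin n → Bool)) →ₗᵢ[ℂ] Hilb (κ × (Fin n → Bool)) :=
  Hilb.isometryOf
    { toFun := fun ψ p => ∑ b : Fin k → Bool,
        (U : Matrix (Fin k → Bool) (Fin k → Bool) ℂ) (p.2 ∘ e) b *
          ψ (p.1, Function.extend e b p.2)
      map_add' := fun ψ φ => by
        funext p
        simp [mul_add, Finset.sum_add_distrib]
      map_smul' := fun a ψ => by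
        funext p
        simp only [Pi.smul_apply, smul_eq_mul, RingHom.id_apply, Finset.mul_sum]
        exact Finset.sum_congr rfl fun b _ => by ring }
    (fun ψ => by
      have h := hasSum_of_fiber_sums (φ := splitQubits e) (F := fun p => ‖ψ p‖ ^ 2)
        (G := fun p => ‖∑ b : Fin k → Bool,
          (U : Matrix (Fin k → Bool) (Fin k → Bool) ℂ) (p.2 ∘ e) b *
            ψ (p.1, Function.extend e b p.2)‖ ^ 2)
        (fun p => by positivity) (fun r => by
          have h1 := sum_norm_sq_mulVec U fun b => ψ ((splitQubits e).symm (b, r))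
          simpa [splitQubits_symm_comp, splitQubits_symm_extend, Matrix.mulVec,
            dotProduct] using h1)
        (Hilb.summable_norm_sq ψ).hasSum
      exact h)

/-- A gate of `𝒞` placed on distinct qubits among `n` qubits. -/
structure PlacedGate (𝒞 : GateSet) (n : ℕ) where
  gate : Fin 𝒞.num
  qubits : Fin (𝒞.arity gate) ↪ Fin n

/-! ### Circuits with a counter -/

/-- The elementary operations on `n` qubits and a counter `B`. -/
inductive Op (𝒞 : GateSet) (n : ℕ) where
  /-- a gate of the gate set, acting on qubits only -/
  | gate (g : PlacedGate 𝒞 n)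
  /-- increment `B`, controlled on qubit `i` -/
  | incr (i : Fin n)
  /-- apply Pauli `X` to qubit `i`, conditioned on `B` being in the state `|0⟩` -/
  | checkZero (i : Fin n)

/-- A counter register with basis `|d⟩`, `d : κ`: its zero state and its increment. -/
structure Counter (κ : Type) where
  zero : κ
  succ : κ ↪ κ

/-- The infinite counter, with basis `|d⟩`, `d ∈ ℕ`, and the isometry `|d⟩ ↦ |d+1⟩`. -/
def infCounter : Counter ℕ where
  zero := 0
  succ := ⟨Nat.succ, Nat.succ_injective⟩

/-- The counter on `span {|0⟩, …, |D-1⟩}` with increment modulo `D`. -/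
def modCounter (D : ℕ) [NeZero D] : Counter (Fin D) where
  zero := 0
  succ := ⟨fun d => d + 1, add_left_injective 1⟩

/-- The trivial one-dimensional register, used for circuits that have no counter. -/
def noCounter : Counter Unit where
  zero := ()
  succ := Function.Embedding.refl Unit

variable {κ : Type} [DecidableEq κ] {𝒞 : GateSet} {n : ℕ}

/-- `|d⟩|y⟩ ↦ |d + y_i⟩|y⟩`. -/
def incrLabel (B : Counter κ) (i : Fin n) : κ × (Fin n → Bool) ↪ κ × (Fin n → Bool) where
  toFun p := (if p.2 i then B.succ p.1 else p.1, p.2)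
  inj' := by
    rintro ⟨d, y⟩ ⟨d', y'⟩ h
    obtain ⟨h1, rfl⟩ := Prod.mk.inj h
    by_cases hy : y i = true
    · simp only [hy, if_true] at h1
      rw [B.succ.injective h1]
    · simp only [hy] at h1
      exact Prod.ext h1 rfl

/-- `|d⟩|y⟩ ↦ |d⟩ X_i|y⟩` if `d = 0`, and `|d⟩|y⟩ ↦ |d⟩|y⟩` otherwise. -/
def checkZeroLabel (B : Counter κ) (i : Fin n) :
    κ × (Fin n → Bool) ↪ κ × (Fin n → Bool) where
  toFun p := (p.1, if p.1 = B.zero then Function.update p.2 i (!p.2 i) else p.2)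
  inj' := by
    refine Function.Involutive.injective fun p => ?_
    by_cases h : p.1 = B.zero <;> simp [h, Prod.ext_iff]

/-- The isometry performed by an elementary operation. -/
def Op.toIsometry (B : Counter κ) :
    Op 𝒞 n → (Hilb (κ × (Fin n → Bool)) →ₗᵢ[ℂ] Hilb (κ × (Fin n → Bool)))
  | .gate g => applyGate g.qubits (𝒞.unitary g.gate)
  | .incr i => Hilb.basisMap (incrLabel B i)
  | .checkZero i => Hilb.basisMap (checkZeroLabel B i)

/-- The isometry performed by a list of operations, the head of the list acting first. -/
def runOps (B : Counter κ) :
    List (Op 𝒞 n) → (Hilb (κ × (Fin n → Bool)) →ₗᵢ[ℂ] Hilb (κ × (Fin n → Bool)))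
  | [] => LinearIsometry.id
  | op :: ops => (runOps B ops).comp (op.toIsometry B)

/-- A circuit over `𝒞` on `k` qubits, without ancillas and without counter, that implements the
permutation `|y⟩ ↦ |f y⟩` of the computational basis exactly. -/
def GateSet.Implements (𝒞 : GateSet) {k : ℕ} (f : (Fin k → Bool) → (Fin k → Bool)) : Prop :=
  ∃ gs : List (PlacedGate 𝒞 k), ∀ (ψ : Hilb (Unit × (Fin k → Bool))) (y : Fin k → Bool),
    runOps noCounter (gs.map Op.gate) ψ ((), f y) = ψ ((), y)

/-- NOT, CNOT and Toffoli can be implemented exactly over the gate set. -/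
structure GateSet.HasReversibleGates (𝒞 : GateSet) : Prop where
  not : 𝒞.Implements (k := 1) fun y => Function.update y 0 (!y 0)
  cnot : 𝒞.Implements (k := 2) fun y => Function.update y 1 (xor (y 1) (y 0))
  toffoli : 𝒞.Implements (k := 3) fun y => Function.update y 2 (xor (y 2) (y 0 && y 1))

/-! ### Verifiers -/

/-- A verification circuit: an ancilla register `A` of `anc` qubits (the first ones), a witness
register `W` of `wit` qubits (the last ones), possibly a counter `B`, which is part of the
witness, the qubit `M` that is measured at the end, and the list of operations. -/
structure VerifierCircuit (𝒞 : GateSet) where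
  anc : ℕ
  wit : ℕ
  out : Fin (anc + wit)
  ops : List (Op 𝒞 (anc + wit))

namespace VerifierCircuit

/-- The isometry performed by the circuit, with the counter register `B`. -/
def toIsometry (V : VerifierCircuit 𝒞) (B : Counter κ) :
    Hilb (κ × (Fin (V.anc + V.wit) → Bool)) →ₗᵢ[ℂ] Hilb (κ × (Fin (V.anc + V.wit) → Bool)) :=
  runOps B V.ops

/-- `|d⟩_B |y⟩_W ↦ |d⟩_B |0⟩_A |y⟩_W`. -/
def inputLabel (κ : Type) (V : VerifierCircuit 𝒞) :
    κ × (Fin V.wit → Bool) ↪ κ × (Fin (V.anc + V.wit) → Bool) where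
  toFun p := (p.1, Fin.append (fun _ => false) p.2)
  inj' := by
    rintro ⟨d, y⟩ ⟨d', y'⟩ h
    obtain ⟨h1, h2⟩ := Prod.mk.inj h
    refine Prod.ext h1 (funext fun j => ?_)
    simpa using congrFun h2 (Fin.natAdd V.anc j)

/-- The acceptance probability `‖Π_acc V |0⟩_A |w⟩_{BW}‖²` on the witness `w`. -/
def acceptProb (V : VerifierCircuit 𝒞) (B : Counter κ) (w : Hilb (κ × (Fin V.wit → Bool))) : ℝ :=
  ‖Hilb.project {p | p.2 V.out = true}
    (V.toIsometry B (Hilb.basisMap (V.inputLabel κ) w))‖ ^ 2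

/-- The number of applications of the controlled increment. -/
def numIncr (V : VerifierCircuit 𝒞) : ℕ :=
  V.ops.countP fun op => match op with
    | .incr _ => true
    | _ => false

/-- The circuit does not use the counter operations. -/
def CounterFree (V : VerifierCircuit 𝒞) : Prop :=
  ∀ op ∈ V.ops, ∃ g, op = Op.gate g

end VerifierCircuit

/-- An operation as a list of natural numbers: its kind, followed by the qubits it acts on. -/
def Op.tokens : Op 𝒞 n → List ℕ
  | .incr i => [0, i]
  | .checkZero i => [1, i]
  | .gate g => ((g.gate : ℕ) + 2) :: List.ofFn fun j => (g.qubits j : ℕ)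

/-- The description of a circuit as a bit string; every number is written in unary. -/
def VerifierCircuit.describe (V : VerifierCircuit 𝒞) : List Bool :=
  ([V.anc, V.wit, (V.out : ℕ)] ++ V.ops.flatMap Op.tokens).flatMap
    fun k => List.replicate k true ++ [false]

/-- A uniformly generated polynomial-time circuit family: a polynomial-time Turing machine
outputs the description of `V x` on input `x`. -/
def PolyTimeUniform (V : List Bool → VerifierCircuit 𝒞) : Prop :=
  Nonempty (Turing.TM2ComputableInPolyTime id VerifierCircuit.describe V)

structure PromiseProblem where
  yes : Set (List Bool)
  no : Set (List Bool)
  disjoint : Disjoint yes no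

/-- Completeness `c` and soundness `s` (which may depend on the instance) of a family of
verification circuits with counter register `B`. -/
def CompleteAndSound (B : Counter κ) (V : List Bool → VerifierCircuit 𝒞) (L : PromiseProblem)
    (c s : List Bool → ℝ) : Prop :=
  (∀ x ∈ L.yes, ∃ w, ‖w‖ = 1 ∧ c x ≤ (V x).acceptProb B w) ∧
    ∀ x ∈ L.no, ∀ w, ‖w‖ = 1 → (V x).acceptProb B w ≤ s x

/-- `V` is a `QMA^∞(c,s)` verifier for `L`. -/
def IsQMAInfVerifier (V : List Bool → VerifierCircuit 𝒞) (L : PromiseProblem)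
    (c s : List Bool → ℝ) : Prop :=
  PolyTimeUniform V ∧ CompleteAndSound infCounter V L c s

/-- `V` is a `QMA(c,s)` verifier for `L`. -/
def IsQMAVerifier (V : List Bool → VerifierCircuit 𝒞) (L : PromiseProblem)
    (c s : List Bool → ℝ) : Prop :=
  PolyTimeUniform V ∧ (∀ x, (V x).CounterFree) ∧ CompleteAndSound noCounter V L c s

/-! ### Truncation -/

/-- The number `log D` of qubits of the truncated counter, `D` being the smallest power of two
greater than `2 ^ m + ℓ`. -/
def truncBits (m ℓ : ℕ) : ℕ := Nat.clog 2 (2 ^ m + ℓ + 1)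

theorem isLeast_truncBits (m ℓ : ℕ) : IsLeast {b | 2 ^ m + ℓ < 2 ^ b} (truncBits m ℓ) :=
  ⟨Nat.lt_of_succ_le (Nat.le_pow_clog (by norm_num) _),
    fun _ hb => Nat.clog_le_of_le_pow (Nat.succ_le_of_lt hb)⟩

theorem le_truncBits (m ℓ : ℕ) : m ≤ truncBits m ℓ := by
  have h : 2 ^ m + ℓ < 2 ^ truncBits m ℓ := (isLeast_truncBits m ℓ).1
  exact (Nat.pow_lt_pow_iff_right (by norm_num : 1 < 2)).1
    (lt_of_le_of_lt (Nat.le_add_right _ _) h) |>.le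

/-- The `D`-level truncation of `V`: the same operations, with the counter register replaced by
`span {|0⟩, …, |D-1⟩}`, the increment by the increment modulo `D`, and the conditioning on
`|0⟩_B` by conditioning on the zero state of the new register. -/
def VerifierCircuit.truncation (V : VerifierCircuit 𝒞) (D : ℕ) [NeZero D] :
    Hilb (Fin D × (Fin (V.anc + V.wit) → Bool)) →ₗᵢ[ℂ]
      Hilb (Fin D × (Fin (V.anc + V.wit) → Bool)) :=
  V.toIsometry (modCounter D)

/-- The qubits of `A` and `W` inside the registers `A'` and `W'`: here `A'` consists of `A`, of
`h` qubits of the truncated counter and of `t` work qubits, and `W'` consists of `W` and of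
`m` qubits of the truncated counter. -/
def layoutQubit {a w : ℕ} (h t m : ℕ) : Fin (a + w) → Fin (a + h + t + (w + m)) :=
  Fin.addCases (fun i => Fin.castAdd (w + m) (Fin.castAdd t (Fin.castAdd h i)))
    (fun j => Fin.natAdd (a + h + t) (Fin.castAdd m j))

/-- Storing a `b`-bit counter and the registers `A`, `W` in qubits: `A'` holds `A`, then the
`b - m` most significant bits of the counter, then `t` work qubits in the state `|0⟩`, and `W'`
holds `W`, then the `m` least significant bits of the counter. -/
def layout (a w m b t : ℕ) (hmb : m ≤ b) :
    Fin (2 ^ b) × (Fin (a + w) → Bool) ↪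
      Unit × (Fin (a + (b - m) + t + (w + m)) → Bool) where
  toFun p := ((), Fin.append
    (Fin.append
      (Fin.append (fun i : Fin a => p.2 (Fin.castAdd w i))
        (fun j : Fin (b - m) => (p.1 : ℕ).testBit (m + j)))
      (fun _ : Fin t => false))
    (Fin.append (fun i : Fin w => p.2 (Fin.natAdd a i))
      (fun j : Fin m => (p.1 : ℕ).testBit j)))
  inj' := by
    rintro ⟨d, y⟩ ⟨d', y'⟩ h
    have h0 := (Prod.mk.inj h).2
    have hA : ∀ i : Fin a, y (Fin.castAdd w i) = y' (Fin.castAdd w i) := fun i => by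
      simpa using congrFun h0 (Fin.castAdd (w + m) (Fin.castAdd t (Fin.castAdd (b - m) i)))
    have hH : ∀ j : Fin (b - m), (d : ℕ).testBit (m + j) = (d' : ℕ).testBit (m + j) :=
      fun j => by
        simpa using congrFun h0 (Fin.castAdd (w + m) (Fin.castAdd t (Fin.natAdd a j)))
    have hW : ∀ i : Fin w, y (Fin.natAdd a i) = y' (Fin.natAdd a i) := fun i => by
      simpa using congrFun h0 (Fin.natAdd (a + (b - m) + t) (Fin.castAdd m i))
    have hL : ∀ j : Fin m, (d : ℕ).testBit j = (d' : ℕ).testBit j := fun j => by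
      simpa using congrFun h0 (Fin.natAdd (a + (b - m) + t) (Fin.natAdd w j))
    refine Prod.ext (Fin.ext (Nat.eq_of_testBit_eq fun k => ?_))
      (funext fun i => Fin.addCases hA hW i)
    by_cases hk : k < m
    · exact hL ⟨k, hk⟩
    · by_cases hk' : k < b
      · have := hH ⟨k - m, by omega⟩
        simpa [Nat.add_sub_cancel' (not_lt.1 hk)] using this
      · have hle : 2 ^ b ≤ 2 ^ k := Nat.pow_le_pow_right (by norm_num) (not_lt.1 hk')
        rw [Nat.testBit_lt_two_pow (lt_of_lt_of_le d.2 hle),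
          Nat.testBit_lt_two_pow (lt_of_lt_of_le d'.2 hle)]

/-- `V'` is a circuit for the `D`-level truncation of `V`, `D` being the smallest power of two
greater than `2 ^ m + ℓ` for the number `ℓ` of controlled increments of `V`. The ancilla register
of `V'` consists of `A`, of the `log D - m` most significant qubits of the truncated counter, and
of work qubits; its witness register consists of `W` and the `m` least significant qubits of the
truncated counter. With the work qubits in the state `|0⟩`, `V'` acts exactly as the truncation
of `V`, and it leaves the work qubits in the state `|0⟩`; the same qubit is measured. -/
def VerifierCircuit.IsTruncationCircuit (V : VerifierCircuit 𝒞) (m : ℕ)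
    (V' : VerifierCircuit 𝒞) : Prop :=
  let b := truncBits m V.numIncr
  ∃ (t : ℕ) (ops : List (Op 𝒞 (V.anc + (b - m) + t + (V.wit + m)))),
    V' = ⟨V.anc + (b - m) + t, V.wit + m, layoutQubit (b - m) t m V.out, ops⟩ ∧
    ∀ ψ : Hilb (Fin (2 ^ b) × (Fin (V.anc + V.wit) → Bool)),
      runOps noCounter ops
          (Hilb.basisMap (layout V.anc V.wit m b t (le_truncBits m V.numIncr)) ψ) =
        Hilb.basisMap (layout V.anc V.wit m b t (le_truncBits m V.numIncr))
          (V.truncation (2 ^ b) ψ)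

end

/-!
The constant is `K = 4`. Write `ℓ` for the number of controlled increments of a circuit and
`N = 2 ^ m`, so that `8 * ℓ < N`.

*The circuit.* The condition on `m` makes the truncated counter one bit longer than `m`
(`truncBits_eq`). Each controlled increment is replaced by a ripple-carry addition modulo
`2 ^ (m + 1)`, and each conditional `X` by a test whether all `m + 1` bits vanish. Both are
reversible circuits of NOT, CNOT and Toffoli gates that compute a chain of carries in `m + 1` work
qubits and erase it again (`TruncLayout.incrGates`, `TruncLayout.checkGates`); hence the result is
a circuit for the truncation (`VerifierCircuit.isTruncationCircuit_truncCircuit`).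

*Soundness.* Requiring the high bit and the work qubits to be `0` at the beginning restricts the
witness to counter values below `N`. Starting there, `ℓ` increments do not exhaust a counter with
more than `N + ℓ` values, so the truncated and the infinite counter give the same acceptance
probability (`VerifierCircuit.IsTruncationCircuit.exists_acceptProb_eq`), and the bound `s` is
inherited.

*Completeness.* It has to be shown that restricting the witness to counter values below `N` costs
at most `4 * √(ℓ / N)` (`VerifierCircuit.exists_bounded_witness`). The counter values are cut into
blocks of length `N - 1`, where `0` and `1` share a position, and the first `ℓ` positions of each
block are declared a gap. Of the possible positions of the cuts about `N / ℓ` have disjoint gaps,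
so for one of them the gaps have weight at most `2 * ℓ / N` (`exists_small_gap`), and discarding
that part of the witness changes the acceptance probability by at most twice its norm. After that,
`ℓ` increments do not lead from one block into the values reached from another one, so the outputs
of different blocks are orthogonal even after the measurement and the acceptance probability is
the sum over the blocks (`VerifierCircuit.acceptProb_le_tsum_blocks`). Therefore some block,
normalized, is accepted with at least the average probability. As a circuit only distinguishes
zero from positive counter values, this block can be shifted down to the values below `N`
(`VerifierCircuit.acceptProb_shift`).

*Uniformity.* The descriptions of the circuits have to be computed by one polynomial-time machine
`Turing.FinTM2`, from machines for the given circuits and for `m`. For this a small language of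
program fragments with bounds on their running times is set up: sequential composition, loops that
pop a stack, and calls of a given machine as a subroutine (`StackProgram.Fragment`). The program
copies its input, calls the two machines, and then translates the unary description operation by
operation, with registers that hold unary numbers (`StackProgram.exists_run_convertOps`). It takes
time `O(n ^ 3)`, where `n` is the sum of the lengths of the input, of the given description and
of `m`, and of the running times of the two machines
(`StackProgram.polyTimeUniform_truncCircuit`).
-/

/-! ### Basis maps, supports and the change of the counter register -/

namespace Hilb

variable {ι ι' ι'' : Type}

theorem basisMap_apply_of_notMem (f : ι ↪ ι') (ψ : Hilb ι) {j : ι'} (hj : ¬ ∃ i, f i = j) :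
    basisMap f ψ j = 0 :=
  Function.extend_apply' _ _ _ hj

theorem basisMap_basisMap (f : ι ↪ ι') (g : ι' ↪ ι'') (ψ : Hilb ι) :
    basisMap g (basisMap f ψ) = basisMap (f.trans g) ψ := by
  refine lp.ext (funext fun j => ?_)
  by_cases hj : ∃ i, g i = j
  · obtain ⟨i, rfl⟩ := hj
    rw [basisMap_apply]
    by_cases hi : ∃ k, f k = i
    · obtain ⟨k, rfl⟩ := hi
      rw [basisMap_apply]
      exact (basisMap_apply (f.trans g) ψ k).symm
    · rw [basisMap_apply_of_notMem _ _ hi, basisMap_apply_of_notMem]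
      rintro ⟨k, hk⟩
      exact hi ⟨k, g.injective hk⟩
  · rw [basisMap_apply_of_notMem _ _ hj, basisMap_apply_of_notMem]
    rintro ⟨k, hk⟩
    exact hj ⟨f k, hk⟩

theorem basisMap_congr {f g : ι ↪ ι'} {ψ : Hilb ι} (h : ∀ i, ψ i ≠ 0 → f i = g i) :
    basisMap f ψ = basisMap g ψ := by
  have key : ∀ (f g : ι ↪ ι'), (∀ i, ψ i ≠ 0 → f i = g i) → ∀ j, basisMap f ψ j ≠ 0 →
      basisMap f ψ j = basisMap g ψ j := by
    intro f g h j hj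
    by_cases hi : ∃ i, f i = j
    · obtain ⟨i, rfl⟩ := hi
      rw [basisMap_apply] at hj ⊢
      rw [h i hj, basisMap_apply]
    · exact absurd (basisMap_apply_of_notMem f ψ hi) hj
  refine lp.ext (funext fun j => ?_)
  by_cases hf : basisMap f ψ j = 0
  · by_cases hg : basisMap g ψ j = 0
    · rw [hf, hg]
    · exact (key g f (fun i hi => (h i hi).symm) j hg).symm
  · exact key f g h j hf

@[simp] theorem project_apply_of_mem {S : Set ι} (ψ : Hilb ι) {i : ι} (h : i ∈ S) :
    project S ψ i = ψ i :=
  Set.indicator_of_mem h _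

@[simp] theorem project_apply_of_notMem {S : Set ι} (ψ : Hilb ι) {i : ι} (h : i ∉ S) :
    project S ψ i = 0 :=
  Set.indicator_of_notMem h _

theorem project_basisMap (f : ι ↪ ι') {S : Set ι} {S' : Set ι'} (h : ∀ i, f i ∈ S' ↔ i ∈ S)
    (ψ : Hilb ι) : project S' (basisMap f ψ) = basisMap f (project S ψ) := by
  refine lp.ext (funext fun j => ?_)
  by_cases hi : ∃ i, f i = j
  · obtain ⟨i, rfl⟩ := hi
    rw [basisMap_apply]
    by_cases hS : i ∈ S
    · rw [project_apply_of_mem _ hS, project_apply_of_mem _ ((h i).2 hS), basisMap_apply]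
    · rw [project_apply_of_notMem _ hS, project_apply_of_notMem _ (fun h' => hS ((h i).1 h'))]
  · rw [basisMap_apply_of_notMem _ _ hi]
    by_cases hS : j ∈ S'
    · rw [project_apply_of_mem _ hS, basisMap_apply_of_notMem _ _ hi]
    · rw [project_apply_of_notMem _ hS]

theorem norm_project_le (S : Set ι) (ψ : Hilb ι) : ‖project S ψ‖ ≤ ‖ψ‖ := by
  refine (sq_le_sq₀ (norm_nonneg _) (norm_nonneg _)).1 ?_
  rw [norm_sq, norm_sq]
  refine (summable_norm_sq _).tsum_le_tsum (fun i => ?_) (summable_norm_sq _)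
  by_cases h : i ∈ S
  · rw [project_apply_of_mem _ h]
  · rw [project_apply_of_notMem _ h]; simp

theorem project_sub (S : Set ι) (ψ φ : Hilb ι) :
    project S (ψ - φ) = project S ψ - project S φ := by
  refine lp.ext (funext fun i => ?_)
  by_cases h : i ∈ S
  · simp [h]
  · simp [h]

theorem project_smul (S : Set ι) (a : ℂ) (ψ : Hilb ι) :
    project S (a • ψ) = a • project S ψ := by
  refine lp.ext (funext fun i => ?_)
  by_cases h : i ∈ S
  · simp [h]
  · simp [h]

end Hilb

theorem applyGate_apply {κ : Type} {n k : ℕ} (e : Fin k ↪ Fin n)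
    (U : Matrix.unitaryGroup (Fin k → Bool) ℂ) (ψ : Hilb (κ × (Fin n → Bool)))
    (p : κ × (Fin n → Bool)) :
    applyGate e U ψ p = ∑ b : Fin k → Bool,
      (U : Matrix (Fin k → Bool) (Fin k → Bool) ℂ) (p.2 ∘ e) b *
        ψ (p.1, Function.extend e b p.2) :=
  rfl

theorem extend_extend {n k : ℕ} (e : Fin k ↪ Fin n) (b b' : Fin k → Bool) (y : Fin n → Bool) :
    Function.extend e b (Function.extend e b' y) = Function.extend e b y := by
  funext i
  by_cases h : ∃ j, e j = i
  · obtain ⟨j, rfl⟩ := h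
    simp [e.injective.extend_apply]
  · simp [Function.extend_apply' _ _ _ h]

theorem extend_comp_self {n k : ℕ} (e : Fin k ↪ Fin n) (y : Fin n → Bool) :
    Function.extend e (y ∘ e) y = y := by
  funext i
  by_cases h : ∃ j, e j = i
  · obtain ⟨j, rfl⟩ := h
    simp [e.injective.extend_apply]
  · simp [Function.extend_apply' _ _ _ h]

/-- A gate commutes with a relabelling of the basis that carries the qubits `e` to the
qubits `e'`. -/
theorem applyGate_basisMap {κ κ' : Type} {n n' k : ℕ}
    (F : κ × (Fin n → Bool) ↪ κ' × (Fin n' → Bool)) (e : Fin k ↪ Fin n) (e' : Fin k ↪ Fin n')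
    (h1 : ∀ p, (F p).2 ∘ e' = p.2 ∘ e)
    (h2 : ∀ p b, F (p.1, Function.extend e b p.2) = ((F p).1, Function.extend e' b (F p).2))
    (U : Matrix.unitaryGroup (Fin k → Bool) ℂ) (ψ : Hilb (κ × (Fin n → Bool))) :
    applyGate e' U (Hilb.basisMap F ψ) = Hilb.basisMap F (applyGate e U ψ) := by
  refine lp.ext (funext fun p' => ?_)
  rw [applyGate_apply]
  by_cases hp : ∃ p, F p = p'
  · obtain ⟨p, rfl⟩ := hp
    rw [Hilb.basisMap_apply, applyGate_apply, h1]
    refine Finset.sum_congr rfl fun b _ => ?_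
    rw [← h2, Hilb.basisMap_apply]
  · rw [Hilb.basisMap_apply_of_notMem _ _ hp]
    refine Finset.sum_eq_zero fun b _ => ?_
    rw [Hilb.basisMap_apply_of_notMem, mul_zero]
    rintro ⟨q, hq⟩
    refine hp ⟨(q.1, Function.extend e (p'.2 ∘ e') q.2), ?_⟩
    rw [h2, hq]
    exact Prod.ext rfl (by simp only [extend_extend, extend_comp_self])

section

variable {κ κ' : Type} [DecidableEq κ] [DecidableEq κ'] {𝒞 : GateSet} {n : ℕ}

@[simp] theorem runOps_cons (B : Counter κ) (op : Op 𝒞 n) (ops : List (Op 𝒞 n))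
    (ψ : Hilb (κ × (Fin n → Bool))) :
    runOps B (op :: ops) ψ = runOps B ops (op.toIsometry B ψ) := rfl

theorem runOps_append (B : Counter κ) (ops ops' : List (Op 𝒞 n))
    (ψ : Hilb (κ × (Fin n → Bool))) :
    runOps B (ops ++ ops') ψ = runOps B ops' (runOps B ops ψ) := by
  induction ops generalizing ψ with
  | nil => rfl
  | cons op ops ih => simp [ih]

omit [DecidableEq κ] in
theorem incrLabel_apply (B : Counter κ) (i : Fin n) (p : κ × (Fin n → Bool)) :
    incrLabel B i p = (if p.2 i then B.succ p.1 else p.1, p.2) := rfl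

theorem checkZeroLabel_apply (B : Counter κ) (i : Fin n) (p : κ × (Fin n → Bool)) :
    checkZeroLabel B i p =
      (p.1, if p.1 = B.zero then Function.update p.2 i (!p.2 i) else p.2) := rfl

/-- Whether an operation is a controlled increment. -/
def Op.isIncr : Op 𝒞 n → Bool
  | .incr _ => true
  | _ => false

theorem VerifierCircuit.numIncr_eq (V : VerifierCircuit 𝒞) :
    V.numIncr = V.ops.countP Op.isIncr := by
  unfold VerifierCircuit.numIncr
  congr 1
  funext op
  cases op <;> rfl

/-- All amplitudes of the state on counter values outside `S` vanish. -/
def CounterSupp (S : Set κ) (ψ : Hilb (κ × (Fin n → Bool))) : Prop :=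
  ∀ p, p.1 ∉ S → ψ p = 0

omit [DecidableEq κ] in
theorem CounterSupp.mono {S T : Set κ} {ψ : Hilb (κ × (Fin n → Bool))} (h : CounterSupp S ψ)
    (hST : S ⊆ T) : CounterSupp T ψ :=
  fun p hp => h p fun h' => hp (hST h')

omit [DecidableEq κ] in
theorem CounterSupp.mem {S : Set κ} {ψ : Hilb (κ × (Fin n → Bool))} (h : CounterSupp S ψ)
    {p : κ × (Fin n → Bool)} (hp : ψ p ≠ 0) : p.1 ∈ S :=
  by_contra fun h' => hp (h p h')

omit [DecidableEq κ] in
theorem CounterSupp.applyGate {S : Set κ} {ψ : Hilb (κ × (Fin n → Bool))} (h : CounterSupp S ψ)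
    {k : ℕ} (e : Fin k ↪ Fin n) (U : Matrix.unitaryGroup (Fin k → Bool) ℂ) :
    CounterSupp S (applyGate e U ψ) := fun p hp => by
  rw [applyGate_apply]
  exact Finset.sum_eq_zero fun b _ => mul_eq_zero_of_right _ (h _ hp)

omit [DecidableEq κ] [DecidableEq κ'] in
theorem CounterSupp.basisMap {n' : ℕ} {S : Set κ} {T : Set κ'} {ψ : Hilb (κ × (Fin n → Bool))}
    (h : CounterSupp S ψ) (f : κ × (Fin n → Bool) ↪ κ' × (Fin n' → Bool))
    (hf : ∀ p, p.1 ∈ S → (f p).1 ∈ T) : CounterSupp T (Hilb.basisMap f ψ) := fun p hp => by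
  by_cases hi : ∃ i, f i = p
  · obtain ⟨i, rfl⟩ := hi
    rw [Hilb.basisMap_apply]
    exact h _ fun h' => hp (hf _ h')
  · exact Hilb.basisMap_apply_of_notMem _ _ hi

/-- Relabelling of the counter register. -/
def counterMap (n : ℕ) (f : κ ↪ κ') : κ × (Fin n → Bool) ↪ κ' × (Fin n → Bool) :=
  f.prodMap (Function.Embedding.refl _)

omit [DecidableEq κ] [DecidableEq κ'] in
@[simp] theorem counterMap_apply (f : κ ↪ κ') (p : κ × (Fin n → Bool)) :
    counterMap n f p = (f p.1, p.2) := rfl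

/-- A relabelling `f` of the counter commutes with a circuit if it respects zero and increment on
the counter values that can occur: `S k` contains the values possible while `k` increments are
still to be performed. -/
theorem runOps_counterMap (B : Counter κ) (B' : Counter κ') (f : κ ↪ κ') (S : ℕ → Set κ)
    (hzero : ∀ k, ∀ d ∈ S k, f d = B'.zero ↔ d = B.zero)
    (hsucc : ∀ k, ∀ d ∈ S (k + 1), d ∈ S k ∧ B.succ d ∈ S k ∧ f (B.succ d) = B'.succ (f d))
    (ops : List (Op 𝒞 n)) (ψ : Hilb (κ × (Fin n → Bool)))
    (hψ : CounterSupp (S (ops.countP Op.isIncr)) ψ) :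
    runOps B' ops (Hilb.basisMap (counterMap n f) ψ) =
      Hilb.basisMap (counterMap n f) (runOps B ops ψ) := by
  induction ops generalizing ψ with
  | nil => rfl
  | cons op ops ih =>
    rw [runOps_cons, runOps_cons]
    cases op with
    | gate g =>
      rw [List.countP_cons_of_neg (by simp [Op.isIncr])] at hψ
      refine Eq.trans ?_ (ih _ (hψ.applyGate _ _))
      refine congrArg _ ?_
      exact applyGate_basisMap _ _ _ (fun p => rfl) (fun p b => rfl) _ _
    | incr i =>
      rw [List.countP_cons_of_pos (by simp [Op.isIncr])] at hψ
      rw [← ih]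
      · congr 1
        simp only [Op.toIsometry, Hilb.basisMap_basisMap]
        refine Hilb.basisMap_congr fun p hp => ?_
        have h := hsucc _ _ (hψ.mem hp)
        by_cases hi : p.2 i = true <;> simp [incrLabel_apply, hi, h.2.2]
      · refine hψ.basisMap _ fun p hp => ?_
        have h := hsucc _ _ hp
        by_cases hi : p.2 i = true <;> simp [incrLabel_apply, hi, h.1, h.2.1]
    | checkZero i =>
      rw [List.countP_cons_of_neg (by simp [Op.isIncr])] at hψ
      rw [← ih]
      · congr 1
        simp only [Op.toIsometry, Hilb.basisMap_basisMap]
        refine Hilb.basisMap_congr fun p hp => ?_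
        simp [checkZeroLabel_apply, hzero _ _ (hψ.mem hp)]
      · exact hψ.basisMap _ fun p hp => hp

/-- `k` increments raise the value of the infinite counter by at most `k`. -/
theorem CounterSupp.runOps {S : Set ℕ} {ψ : Hilb (ℕ × (Fin n → Bool))} (h : CounterSupp S ψ)
    (ops : List (Op 𝒞 n)) :
    CounterSupp {d | ∃ d₀ ∈ S, d₀ ≤ d ∧ d ≤ d₀ + ops.countP Op.isIncr}
      (runOps infCounter ops ψ) := by
  induction ops generalizing S ψ with
  | nil =>
    refine h.mono fun d hd => ⟨d, hd, le_rfl, ?_⟩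
    simp
  | cons op ops ih =>
    rw [runOps_cons]
    cases op with
    | gate g =>
      rw [List.countP_cons_of_neg (by simp [Op.isIncr])]
      exact ih (h.applyGate _ _)
    | incr i =>
      rw [List.countP_cons_of_pos (by simp [Op.isIncr])]
      have h' : CounterSupp {d | ∃ d₀ ∈ S, d₀ ≤ d ∧ d ≤ d₀ + 1}
          ((Op.incr i : Op 𝒞 n).toIsometry infCounter ψ) := by
        refine h.basisMap _ fun p hp => ⟨p.1, hp, ?_⟩
        by_cases hi : p.2 i = true <;> simp [incrLabel_apply, hi, infCounter]
      refine (ih h').mono ?_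
      rintro d ⟨d₁, ⟨d₀, hd₀, h1, h2⟩, h3, h4⟩
      exact ⟨d₀, hd₀, by omega, by omega⟩
    | checkZero i =>
      rw [List.countP_cons_of_neg (by simp [Op.isIncr])]
      exact ih (h.basisMap _ fun p hp => hp)

end

/-! ### Reversible classical gates placed on qubits -/

/-- A state with the amplitudes of `ψ` on the range of `f` and with the norm of `ψ` has no
amplitude elsewhere. -/
theorem Hilb.eq_basisMap_of_norm_eq {ι ι' : Type} (f : ι ↪ ι') {ψ : Hilb ι} {χ : Hilb ι'}
    (h : ∀ i, χ (f i) = ψ i) (hn : ‖χ‖ = ‖ψ‖) : χ = Hilb.basisMap f ψ := by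
  have hle : ∀ j, ‖Hilb.basisMap f ψ j‖ ^ 2 ≤ ‖χ j‖ ^ 2 := fun j => by
    by_cases hj : ∃ i, f i = j
    · obtain ⟨i, rfl⟩ := hj
      rw [Hilb.basisMap_apply, h]
    · rw [Hilb.basisMap_apply_of_notMem _ _ hj]; simp
  have hsum := (Hilb.summable_norm_sq χ).hasSum.sub
    (Hilb.summable_norm_sq (Hilb.basisMap f ψ)).hasSum
  rw [← Hilb.norm_sq, ← Hilb.norm_sq, LinearIsometry.norm_map, hn, sub_self,
    hasSum_zero_iff_of_nonneg fun j => sub_nonneg.2 (hle j)] at hsum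
  refine lp.ext (funext fun j => ?_)
  by_cases hj : ∃ i, f i = j
  · obtain ⟨i, rfl⟩ := hj
    rw [Hilb.basisMap_apply, h]
  · have h0 : ‖χ j‖ ^ 2 - ‖Hilb.basisMap f ψ j‖ ^ 2 = 0 := congrFun hsum j
    rw [Hilb.basisMap_apply_of_notMem _ _ hj] at h0 ⊢
    simpa using h0

section

variable {𝒞 : GateSet} {n k : ℕ}

/-- The slice of a state of `n` qubits in which the qubits outside the range of `e` are fixed to
the values given by `y`. -/
noncomputable def qubitSlice (e : Fin k ↪ Fin n) (y : Fin n → Bool)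
    (φ : Hilb (Unit × (Fin n → Bool))) : Hilb (Unit × (Fin k → Bool)) :=
  ⟨fun p => φ ((), Function.extend e p.2 y),
    Hilb.mem_of_summable (hasSum_fintype _).summable⟩

theorem qubitSlice_apply (e : Fin k ↪ Fin n) (y : Fin n → Bool)
    (φ : Hilb (Unit × (Fin n → Bool))) (p : Unit × (Fin k → Bool)) :
    qubitSlice e y φ p = φ ((), Function.extend e p.2 y) := rfl

/-- The placed gate `g` carried along an embedding of the qubits. -/
def PlacedGate.trans (g : PlacedGate 𝒞 k) (e : Fin k ↪ Fin n) : PlacedGate 𝒞 n :=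
  ⟨g.gate, g.qubits.trans e⟩

theorem extend_trans {j : ℕ} (q : Fin j ↪ Fin k) (e : Fin k ↪ Fin n) (b' : Fin j → Bool)
    (b : Fin k → Bool) (y : Fin n → Bool) :
    Function.extend (q.trans e) b' (Function.extend e b y) =
      Function.extend e (Function.extend q b' b) y := by
  funext i
  by_cases hi : ∃ l, e l = i
  · obtain ⟨l, rfl⟩ := hi
    rw [e.injective.extend_apply]
    by_cases hl : ∃ u, q u = l
    · obtain ⟨u, rfl⟩ := hl
      rw [q.injective.extend_apply]
      exact (q.trans e).injective.extend_apply _ _ u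
    · rw [Function.extend_apply' _ _ _ hl, Function.extend_apply', e.injective.extend_apply]
      rintro ⟨u, hu⟩
      exact hl ⟨u, e.injective hu⟩
  · rw [Function.extend_apply' _ _ _ hi, Function.extend_apply', Function.extend_apply' _ _ _ hi]
    rintro ⟨u, hu⟩
    exact hi ⟨q u, hu⟩

theorem qubitSlice_runOps (e : Fin k ↪ Fin n) (y : Fin n → Bool) (gs : List (PlacedGate 𝒞 k))
    (φ : Hilb (Unit × (Fin n → Bool))) :
    qubitSlice e y (runOps noCounter (gs.map fun g => Op.gate (g.trans e)) φ) =
      runOps noCounter (gs.map Op.gate) (qubitSlice e y φ) := by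
  induction gs generalizing φ with
  | nil => rfl
  | cons g gs ih =>
    rw [List.map_cons, List.map_cons, runOps_cons, runOps_cons, ih]
    refine congrArg _ (lp.ext (funext fun p => ?_))
    rw [qubitSlice_apply]
    refine (applyGate_apply _ _ _ _).trans
      (Eq.trans (Finset.sum_congr rfl fun b _ => ?_) (applyGate_apply _ _ _ _).symm)
    have h1 : Function.extend e p.2 y ∘ (g.trans e).qubits = p.2 ∘ g.qubits :=
      funext fun j => e.injective.extend_apply _ _ _
    have h2 : Function.extend (g.trans e).qubits b (Function.extend e p.2 y) =
        Function.extend e (Function.extend g.qubits b p.2) y := extend_trans _ _ _ _ _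
    rw [qubitSlice_apply]
    simp only [h1, h2]
    rfl

/-- A circuit implementing the permutation `f` of the basis states of `k` qubits implements it
on any `k` qubits among `n`. -/
theorem runOps_trans_of_implements {f : (Fin k → Bool) → (Fin k → Bool)}
    {gs : List (PlacedGate 𝒞 k)}
    (hgs : ∀ (ψ : Hilb (Unit × (Fin k → Bool))) (y : Fin k → Bool),
      runOps noCounter (gs.map Op.gate) ψ ((), f y) = ψ ((), y))
    (e : Fin k ↪ Fin n) (y : Fin n → Bool) (φ : Hilb (Unit × (Fin n → Bool))) :
    runOps noCounter (gs.map fun g => Op.gate (g.trans e)) φ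
      ((), Function.extend e (f (y ∘ e)) y) = φ ((), y) := by
  have h := hgs (qubitSlice e y φ) (y ∘ e)
  rw [← qubitSlice_runOps, qubitSlice_apply, qubitSlice_apply] at h
  simpa only [extend_comp_self] using h

end

/-- A reversible classical gate, acting on bits that are indexed by natural numbers; the target
is the last argument. -/
inductive RevGate where
  | not (t : ℕ)
  | cnot (c t : ℕ)
  | toffoli (c₁ c₂ t : ℕ)

namespace RevGate

/-- The number of bits that the gate acts on. -/
def arity : RevGate → ℕ
  | not _ => 1
  | cnot _ _ => 2
  | toffoli _ _ _ => 3

/-- The bits that the gate acts on. -/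
def pos : (g : RevGate) → Fin g.arity → ℕ
  | not t => ![t]
  | cnot c t => ![c, t]
  | toffoli c₁ c₂ t => ![c₁, c₂, t]

/-- The permutation performed by the gate on its own bits. -/
def localMap : (g : RevGate) → (Fin g.arity → Bool) → (Fin g.arity → Bool)
  | not _ => (fun y => Function.update y 0 (!y 0) : (Fin 1 → Bool) → (Fin 1 → Bool))
  | cnot _ _ =>
    (fun y => Function.update y 1 (xor (y 1) (y 0)) : (Fin 2 → Bool) → (Fin 2 → Bool))
  | toffoli _ _ _ =>
    (fun y => Function.update y 2 (xor (y 2) (y 0 && y 1)) : (Fin 3 → Bool) → (Fin 3 → Bool))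

/-- The action of the gate on bit assignments. -/
def act : RevGate → (ℕ → Bool) → (ℕ → Bool)
  | not t, f => Function.update f t (!f t)
  | cnot c t, f => Function.update f t (xor (f t) (f c))
  | toffoli c₁ c₂ t, f => Function.update f t (xor (f t) (f c₁ && f c₂))

/-- The gate acts on distinct bits among the first `n`. -/
def Valid (n : ℕ) (g : RevGate) : Prop :=
  (∀ j, g.pos j < n) ∧ Function.Injective g.pos

theorem valid_not {n t : ℕ} : (not t).Valid n ↔ t < n := by
  refine ⟨fun h => h.1 (0 : Fin 1), fun h => ⟨fun j => ?_, fun i j _ => ?_⟩⟩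
  · exact (Fin.forall_fin_one (p := fun j => (![t] : Fin 1 → ℕ) j < n)).2 h j
  · exact Subsingleton.elim (α := Fin 1) i j

theorem valid_cnot {n c t : ℕ} (hc : c < n) (ht : t < n) (h : c ≠ t) : (cnot c t).Valid n := by
  refine ⟨(Fin.forall_fin_two (p := fun j => (![c, t] : Fin 2 → ℕ) j < n)).2 ⟨hc, ht⟩, ?_⟩
  change Function.Injective (![c, t] : Fin 2 → ℕ)
  intro i j hij
  fin_cases i <;> fin_cases j <;> simp_all

theorem valid_toffoli {n c₁ c₂ t : ℕ} (hc₁ : c₁ < n) (hc₂ : c₂ < n) (ht : t < n) (h₁ : c₁ ≠ c₂)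
    (h₂ : c₁ ≠ t) (h₃ : c₂ ≠ t) : (toffoli c₁ c₂ t).Valid n := by
  constructor
  · change ∀ j : Fin 3, (![c₁, c₂, t] : Fin 3 → ℕ) j < n
    intro j
    fin_cases j <;> simp_all
  · change Function.Injective (![c₁, c₂, t] : Fin 3 → ℕ)
    intro i j hij
    fin_cases i <;> fin_cases j <;> simp_all

theorem act_pos {n : ℕ} {g : RevGate} (hg : g.Valid n) (f : ℕ → Bool) (j : Fin g.arity) :
    g.act f (g.pos j) = g.localMap (f ∘ g.pos) j := by
  have hinj := hg.2
  cases g with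
  | not t =>
    have key : ∀ j : Fin 1, Function.update f t (!f t) ((![t] : Fin 1 → ℕ) j) =
        Function.update (f ∘ ![t]) 0 (!(f ∘ ![t]) 0) j := by
      intro j
      fin_cases j
      simp
    exact key j
  | cnot c t =>
    have h : c ≠ t := fun h => absurd (@hinj (0 : Fin 2) (1 : Fin 2) h)
      (show ¬(0 : Fin 2) = 1 by decide)
    have key : ∀ j : Fin 2, Function.update f t (xor (f t) (f c)) ((![c, t] : Fin 2 → ℕ) j) =
        Function.update (f ∘ ![c, t]) 1 (xor ((f ∘ ![c, t]) 1) ((f ∘ ![c, t]) 0)) j := by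
      intro j
      fin_cases j <;> simp [h]
    exact key j
  | toffoli c₁ c₂ t =>
    have h₁ : c₁ ≠ t := fun h => absurd (@hinj (0 : Fin 3) (2 : Fin 3) h)
      (show ¬(0 : Fin 3) = 2 by decide)
    have h₂ : c₂ ≠ t := fun h => absurd (@hinj (1 : Fin 3) (2 : Fin 3) h)
      (show ¬(1 : Fin 3) = 2 by decide)
    have key : ∀ j : Fin 3, Function.update f t (xor (f t) (f c₁ && f c₂))
          ((![c₁, c₂, t] : Fin 3 → ℕ) j) =
        Function.update (f ∘ ![c₁, c₂, t]) 2 (xor ((f ∘ ![c₁, c₂, t]) 2)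
          ((f ∘ ![c₁, c₂, t]) 0 && (f ∘ ![c₁, c₂, t]) 1)) j := by
      intro j
      fin_cases j <;> simp [h₁, h₂]
    exact key j

theorem act_of_ne {g : RevGate} (f : ℕ → Bool) {x : ℕ} (h : ∀ j, g.pos j ≠ x) :
    g.act f x = f x := by
  cases g with
  | not t => exact Function.update_of_ne (h (0 : Fin 1)).symm _ _
  | cnot c t => exact Function.update_of_ne (h (1 : Fin 2)).symm _ _
  | toffoli c₁ c₂ t => exact Function.update_of_ne (h (2 : Fin 3)).symm _ _

variable {𝒞 : GateSet}

/-- A circuit for NOT. -/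
noncomputable def notCircuit (h : 𝒞.HasReversibleGates) : List (PlacedGate 𝒞 1) := h.not.choose

/-- A circuit for CNOT. -/
noncomputable def cnotCircuit (h : 𝒞.HasReversibleGates) : List (PlacedGate 𝒞 2) := h.cnot.choose

/-- A circuit for the Toffoli gate. -/
noncomputable def toffoliCircuit (h : 𝒞.HasReversibleGates) : List (PlacedGate 𝒞 3) :=
  h.toffoli.choose

/-- A circuit over the gate set for a reversible gate, on its own bits. -/
noncomputable def circuit (h : 𝒞.HasReversibleGates) : (g : RevGate) → List (PlacedGate 𝒞 g.arity)
  | not _ => notCircuit h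
  | cnot _ _ => cnotCircuit h
  | toffoli _ _ _ => toffoliCircuit h

theorem circuit_spec (h : 𝒞.HasReversibleGates) (g : RevGate)
    (ψ : Hilb (Unit × (Fin g.arity → Bool))) (y : Fin g.arity → Bool) :
    runOps noCounter ((g.circuit h).map Op.gate) ψ ((), g.localMap y) = ψ ((), y) := by
  cases g with
  | not t => exact h.not.choose_spec ψ y
  | cnot c t => exact h.cnot.choose_spec ψ y
  | toffoli c₁ c₂ t => exact h.toffoli.choose_spec ψ y

/-- The embedding of the bits of a valid gate into `Fin n`. -/
def emb {n : ℕ} {g : RevGate} (hg : g.Valid n) : Fin g.arity ↪ Fin n where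
  toFun j := ⟨g.pos j, hg.1 j⟩
  inj' _ _ hij := hg.2 (Fin.mk.inj hij)

open Classical in
/-- The reversible gate as a list of operations on `n` qubits; empty if the gate does not act on
distinct qubits among the first `n`. -/
noncomputable def toOps (h : 𝒞.HasReversibleGates) (n : ℕ) (g : RevGate) : List (Op 𝒞 n) :=
  if hg : g.Valid n then (g.circuit h).map fun p => Op.gate (p.trans (emb hg)) else []

theorem runOps_toOps (h : 𝒞.HasReversibleGates) {n : ℕ} {g : RevGate} (hg : g.Valid n)
    (f : ℕ → Bool) (φ : Hilb (Unit × (Fin n → Bool))) :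
    runOps noCounter (g.toOps h n) φ ((), fun i : Fin n => g.act f i) =
      φ ((), fun i : Fin n => f i) := by
  have key : (fun i : Fin n => g.act f i) = Function.extend (emb hg)
      (g.localMap ((fun i : Fin n => f i) ∘ emb hg)) (fun i : Fin n => f i) := by
    funext i
    by_cases hi : ∃ j, emb hg j = i
    · obtain ⟨j, rfl⟩ := hi
      rw [(emb hg).injective.extend_apply]
      exact act_pos hg f j
    · rw [Function.extend_apply' _ _ _ hi]
      exact act_of_ne f fun j hj => hi ⟨j, Fin.ext hj⟩
  rw [toOps, dif_pos hg, key]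
  exact runOps_trans_of_implements (circuit_spec h g) (emb hg) (fun i : Fin n => f i) φ

/-- The action of a list of gates, the head acting first. -/
def actList : List RevGate → (ℕ → Bool) → (ℕ → Bool)
  | [], f => f
  | g :: gs, f => actList gs (g.act f)

@[simp] theorem actList_nil (f : ℕ → Bool) : actList [] f = f := rfl

@[simp] theorem actList_cons (g : RevGate) (gs : List RevGate) (f : ℕ → Bool) :
    actList (g :: gs) f = actList gs (g.act f) := rfl

theorem actList_append (gs gs' : List RevGate) (f : ℕ → Bool) :
    actList (gs ++ gs') f = actList gs' (actList gs f) := by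
  induction gs generalizing f with
  | nil => rfl
  | cons g gs ih => simp [ih]

theorem runOps_flatMap_toOps (h : 𝒞.HasReversibleGates) {n : ℕ} {gs : List RevGate}
    (hgs : ∀ g ∈ gs, g.Valid n) (f : ℕ → Bool) (φ : Hilb (Unit × (Fin n → Bool))) :
    runOps noCounter (gs.flatMap (toOps h n)) φ ((), fun i : Fin n => actList gs f i) =
      φ ((), fun i : Fin n => f i) := by
  induction gs generalizing f φ with
  | nil => rfl
  | cons g gs ih =>
    rw [List.flatMap_cons, runOps_append, actList_cons,
      ih fun g' hg' => hgs g' (List.mem_cons_of_mem _ hg'), runOps_toOps h (hgs g (by simp))]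

/-- If a list of reversible gates carries the labels `F p` to the labels `F' p`, then it carries
the states `|F p⟩` to the states `|F' p⟩`. -/
theorem runOps_flatMap_toOps_basisMap (h : 𝒞.HasReversibleGates) {n : ℕ} {gs : List RevGate}
    (hgs : ∀ g ∈ gs, g.Valid n) {ι : Type} (F F' : ι ↪ Unit × (Fin n → Bool))
    (f : ι → ℕ → Bool) (hF : ∀ p, (F p).2 = fun i : Fin n => f p i)
    (hF' : ∀ p, (F' p).2 = fun i : Fin n => actList gs (f p) i) (ψ : Hilb ι) :
    runOps noCounter (gs.flatMap (toOps h n)) (Hilb.basisMap F ψ) = Hilb.basisMap F' ψ := by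
  refine Hilb.eq_basisMap_of_norm_eq _ (fun p => ?_) ?_
  · have h1 : F' p = ((), fun i : Fin n => actList gs (f p) i) := Prod.ext rfl (hF' p)
    have h2 : F p = ((), fun i : Fin n => f p i) := Prod.ext rfl (hF p)
    rw [h1, runOps_flatMap_toOps h hgs, ← h2, Hilb.basisMap_apply]
  · rw [LinearIsometry.norm_map, LinearIsometry.norm_map]

end RevGate

/-! ### Reversible circuits for the truncated counter -/

/-- The carry into position `j` when the bit `b` is added to the number with bits `g`. -/
def carry (b : Bool) (g : ℕ → Bool) : ℕ → Bool
  | 0 => b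
  | j + 1 => carry b g j && g j

theorem carry_congr {b : Bool} {g g' : ℕ → Bool} {k : ℕ} (h : ∀ i < k, g i = g' i) :
    carry b g k = carry b g' k := by
  induction k with
  | zero => rfl
  | succ k ih => rw [carry, carry, ih fun i hi => h i (by omega), h k (by omega)]

theorem carry_eq_true_iff {b : Bool} {g : ℕ → Bool} {k : ℕ} :
    carry b g k = true ↔ b = true ∧ ∀ i < k, g i = true := by
  induction k with
  | zero => simp [carry]
  | succ k ih =>
    rw [carry, Bool.and_eq_true, ih]
    constructor
    · rintro ⟨⟨h1, h2⟩, h3⟩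
      refine ⟨h1, fun i hi => ?_⟩
      rcases Nat.lt_succ_iff_lt_or_eq.1 hi with h | rfl
      exacts [h2 i h, h3]
    · rintro ⟨h1, h2⟩
      exact ⟨⟨h1, fun i hi => h2 i (by omega)⟩, h2 k (by omega)⟩

theorem carry_succ' (b : Bool) (g : ℕ → Bool) (j : ℕ) :
    carry b g (j + 1) = carry (b && g 0) (fun i => g (i + 1)) j := by
  induction j with
  | zero => rfl
  | succ j ih => rw [carry, ih, carry]

theorem testBit_add_toNat (d : ℕ) (b : Bool) (j : ℕ) :
    (d + b.toNat).testBit j = xor (d.testBit j) (carry b d.testBit j) := by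
  induction j generalizing d b with
  | zero =>
    rw [carry]
    cases b <;> rcases Nat.mod_two_eq_zero_or_one d with h | h <;>
      simp [Nat.testBit_zero, h, Nat.add_mod]
  | succ j ih =>
    have h : (d + b.toNat) / 2 = d / 2 + (b && d.testBit 0).toNat := by
      cases b <;> rcases Nat.mod_two_eq_zero_or_one d with h | h <;>
        simp [Nat.testBit_zero, h] <;> omega
    rw [Nat.testBit_succ, h, ih, carry_succ', Nat.testBit_succ]
    congr 2
    funext i
    rw [Nat.testBit_succ]

namespace TruncLayout

variable (a w m : ℕ)

/-- The position of the `j`-th work qubit. -/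
def work (j : ℕ) : ℕ := a + 1 + j

/-- The position of the `j`-th of the `m` least significant bits of the counter. -/
def low (j : ℕ) : ℕ := a + m + 2 + w + j

/-- The new position of the qubit `q` of the registers `A`, `W`: the qubits of `W` make room for
the most significant bit of the counter and for `m + 1` work qubits. -/
def shiftQubit (q : ℕ) : ℕ := if q < a then q else q + (m + 2)

/-- Compute into the `(j + 1)`-st work qubit whether the first work qubit and the first `j + 1`
bits of the counter are all set. -/
def chainGate (j : ℕ) : RevGate := .toffoli (work a j) (low a w m j) (work a (j + 1))

/-- Compute the first `k` carries. -/
def chainUp (k : ℕ) : List RevGate := (List.range k).flatMap fun j => [chainGate a w m j]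

/-- Uncompute the first `k` carries. -/
def chainDown (k : ℕ) : List RevGate := (List.range k).reverse.flatMap fun j => [chainGate a w m j]

/-- Uncompute the first `k` carries and add each of them to its bit of the counter. -/
def addDown (k : ℕ) : List RevGate :=
  (List.range k).reverse.flatMap fun j => [chainGate a w m j, .cnot (work a j) (low a w m j)]

/-- Flip the first `k` bits of the counter. -/
def flipLow (k : ℕ) : List RevGate := (List.range k).flatMap fun j => [.not (low a w m j)]

/-- Increment the `(m + 1)`-bit counter, controlled on `q`. -/
def incrGates (q : ℕ) : List RevGate :=
  [.cnot q (work a 0)] ++ chainUp a w m m ++ [.cnot (work a m) a] ++ addDown a w m m ++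
    [.cnot q (work a 0)]

/-- Flip `q` if the `(m + 1)`-bit counter is zero. -/
def checkGates (q : ℕ) : List RevGate :=
  flipLow a w m m ++ [.not a, .not (work a 0)] ++ chainUp a w m m ++ [.toffoli (work a m) a q] ++
    chainDown a w m m ++ [.not (work a 0), .not a] ++ flipLow a w m m

theorem valid_chainGate {n j : ℕ} (hn : n = a + m + 2 + w + m) (hj : j < m) :
    (chainGate a w m j).Valid n :=
  RevGate.valid_toffoli (by unfold work; omega) (by unfold low; omega) (by unfold work; omega)
    (by unfold work low; omega) (by unfold work; omega) (by unfold work low; omega)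

theorem valid_chainUp {n : ℕ} (hn : n = a + m + 2 + w + m) :
    ∀ g ∈ chainUp a w m m, g.Valid n := by
  intro g hg
  obtain ⟨j, hj, hg⟩ := List.mem_flatMap.1 hg
  rw [List.mem_singleton.1 hg]
  exact valid_chainGate a w m hn (List.mem_range.1 hj)

theorem valid_flipLow {n : ℕ} (hn : n = a + m + 2 + w + m) :
    ∀ g ∈ flipLow a w m m, g.Valid n := by
  intro g hg
  obtain ⟨j, hj, hg⟩ := List.mem_flatMap.1 hg
  rw [List.mem_singleton.1 hg, RevGate.valid_not, low]
  have := List.mem_range.1 hj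
  omega

theorem valid_incrGates {n q : ℕ} (hn : n = a + m + 2 + w + m) (hq : q < n)
    (hqa : q < a ∨ a + m + 2 ≤ q) : ∀ g ∈ incrGates a w m q, g.Valid n := by
  have hc : (RevGate.cnot q (work a 0)).Valid n :=
    RevGate.valid_cnot hq (by unfold work; omega) (by unfold work; omega)
  intro g hg
  simp only [incrGates, List.mem_append, List.mem_singleton] at hg
  rcases hg with (((rfl | hg) | rfl) | hg) | rfl
  · exact hc
  · exact valid_chainUp a w m hn g hg
  · exact RevGate.valid_cnot (by unfold work; omega) (by omega) (by unfold work; omega)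
  · obtain ⟨j, hj, hg⟩ := List.mem_flatMap.1 hg
    rw [List.mem_reverse, List.mem_range] at hj
    simp only [List.mem_cons, List.not_mem_nil, or_false] at hg
    rcases hg with rfl | rfl
    · exact valid_chainGate a w m hn hj
    · exact RevGate.valid_cnot (by unfold work; omega) (by unfold low; omega)
        (by unfold work low; omega)
  · exact hc

theorem valid_checkGates {n q : ℕ} (hn : n = a + m + 2 + w + m) (hq : q < n)
    (hqa : q < a ∨ a + m + 2 ≤ q) : ∀ g ∈ checkGates a w m q, g.Valid n := by
  intro g hg
  simp only [checkGates, List.mem_append, List.mem_cons, List.not_mem_nil, or_false] at hg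
  rcases hg with (((((hg | rfl | rfl) | hg) | rfl) | hg) | rfl | rfl) | hg
  · exact valid_flipLow a w m hn g hg
  · exact RevGate.valid_not.2 (by omega)
  · exact RevGate.valid_not.2 (by unfold work; omega)
  · exact valid_chainUp a w m hn g hg
  · exact RevGate.valid_toffoli (by unfold work; omega) (by omega) hq (by unfold work; omega)
      (by unfold work; omega) (by omega)
  · obtain ⟨j, hj, hg⟩ := List.mem_flatMap.1 hg
    rw [List.mem_reverse, List.mem_range] at hj
    rw [List.mem_singleton.1 hg]
    exact valid_chainGate a w m hn hj
  · exact RevGate.valid_not.2 (by unfold work; omega)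
  · exact RevGate.valid_not.2 (by omega)
  · exact valid_flipLow a w m hn g hg

variable {a w m}

theorem actList_chainUp {k : ℕ} (hk : k ≤ m) {f : ℕ → Bool}
    (hf : ∀ i, 0 < i → i ≤ k → f (work a i) = false) :
    RevGate.actList (chainUp a w m k) f = fun x =>
      if a + 1 < x ∧ x ≤ a + 1 + k then
        carry (f (work a 0)) (fun i => f (low a w m i)) (x - (a + 1))
      else f x := by
  induction k with
  | zero =>
    funext x
    rw [if_neg (by omega)]
    rfl
  | succ k ih =>
    have h0 : chainUp a w m (k + 1) = chainUp a w m k ++ [chainGate a w m k] := by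
      simp [chainUp, List.range_succ, List.flatMap_append]
    have hc : (if a + 1 < work a k ∧ work a k ≤ a + 1 + k then
        carry (f (work a 0)) (fun i => f (low a w m i)) (work a k - (a + 1))
        else f (work a k)) = carry (f (work a 0)) (fun i => f (low a w m i)) k := by
      rcases Nat.eq_zero_or_pos k with rfl | hk0
      · rw [if_neg (by unfold work; omega), carry]
      · rw [if_pos (by unfold work; omega), show work a k - (a + 1) = k by unfold work; omega]
    rw [h0, RevGate.actList_append, ih (by omega) fun i h1 h2 => hf i h1 (by omega)]
    simp only [RevGate.actList_cons, RevGate.actList_nil, chainGate, RevGate.act]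
    rw [hc, if_neg (by unfold work; omega), if_neg (by unfold low; omega),
      hf _ (Nat.succ_pos k) le_rfl, Bool.false_xor]
    funext x
    by_cases hx : x = work a (k + 1)
    · subst hx
      rw [Function.update_self, if_pos (by unfold work; omega),
        show work a (k + 1) - (a + 1) = k + 1 by unfold work; omega, carry]
    · rw [Function.update_of_ne hx]
      refine if_congr ?_ rfl rfl
      unfold work at hx
      omega

theorem actList_chainDown {k : ℕ} (hk : k ≤ m) {f : ℕ → Bool}
    (hf : ∀ i, 0 < i → i ≤ k →
      f (work a i) = carry (f (work a 0)) (fun i => f (low a w m i)) i) :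
    RevGate.actList (chainDown a w m k) f = fun x =>
      if a + 1 < x ∧ x ≤ a + 1 + k then false else f x := by
  induction k generalizing f with
  | zero =>
    funext x
    rw [if_neg (by omega)]
    rfl
  | succ k ih =>
    have h0 : chainDown a w m (k + 1) = chainGate a w m k :: chainDown a w m k := by
      simp [chainDown, List.range_succ, List.reverse_append]
    have hc : f (work a k) = carry (f (work a 0)) (fun i => f (low a w m i)) k := by
      rcases Nat.eq_zero_or_pos k with rfl | hk0
      · rfl
      · exact hf k hk0 (by omega)
    have hg : (chainGate a w m k).act f = Function.update f (work a (k + 1)) false := by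
      rw [chainGate, RevGate.act, hf _ (Nat.succ_pos k) le_rfl, hc, carry, Bool.xor_self]
    have hw : ∀ i ≤ k, Function.update f (work a (k + 1)) false (work a i) = f (work a i) :=
      fun i hi => Function.update_of_ne (by unfold work; omega) _ _
    have hl : ∀ i, Function.update f (work a (k + 1)) false (low a w m i) = f (low a w m i) :=
      fun i => Function.update_of_ne (by unfold work low; omega) _ _
    rw [h0, RevGate.actList_cons, hg, ih (by omega)]
    · funext x
      by_cases hx : x = work a (k + 1)
      · subst hx
        rw [if_neg (by unfold work; omega), Function.update_self, if_pos (by unfold work; omega)]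
      · rw [Function.update_of_ne hx]
        refine if_congr ?_ rfl rfl
        unfold work at hx
        omega
    · intro i h1 h2
      simp only [hl, hw i h2, hw 0 (Nat.zero_le k)]
      exact hf i h1 (by omega)

theorem actList_addDown {k : ℕ} (hk : k ≤ m) {f : ℕ → Bool}
    (hf : ∀ i, 0 < i → i ≤ k →
      f (work a i) = carry (f (work a 0)) (fun i => f (low a w m i)) i) :
    RevGate.actList (addDown a w m k) f = fun x =>
      if a + 1 < x ∧ x ≤ a + 1 + k then false
      else if low a w m 0 ≤ x ∧ x < low a w m k then
        xor (f x) (carry (f (work a 0)) (fun i => f (low a w m i)) (x - low a w m 0))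
      else f x := by
  induction k generalizing f with
  | zero =>
    funext x
    rw [if_neg (by omega), if_neg (by omega)]
    rfl
  | succ k ih =>
    have h0 : addDown a w m (k + 1) =
        chainGate a w m k :: .cnot (work a k) (low a w m k) :: addDown a w m k := by
      simp [addDown, List.range_succ, List.reverse_append]
    have hc : f (work a k) = carry (f (work a 0)) (fun i => f (low a w m i)) k := by
      rcases Nat.eq_zero_or_pos k with rfl | hk0
      · rfl
      · exact hf k hk0 (by omega)
    set f' : ℕ → Bool := Function.update (Function.update f (work a (k + 1)) false) (low a w m k)
      (xor (f (low a w m k)) (carry (f (work a 0)) (fun i => f (low a w m i)) k)) with hf'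
    have hg : RevGate.actList [chainGate a w m k, .cnot (work a k) (low a w m k)] f = f' := by
      have h1 : (chainGate a w m k).act f = Function.update f (work a (k + 1)) false := by
        rw [chainGate, RevGate.act, hf _ (Nat.succ_pos k) le_rfl, hc, carry, Bool.xor_self]
      rw [RevGate.actList_cons, RevGate.actList_cons, RevGate.actList_nil, h1, RevGate.act,
        Function.update_of_ne (show low a w m k ≠ work a (k + 1) by unfold work low; omega),
        Function.update_of_ne (show work a k ≠ work a (k + 1) by unfold work; omega), hc]
    have hw : ∀ i ≤ k, f' (work a i) = f (work a i) := fun i hi => by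
      rw [hf', Function.update_of_ne (by unfold work low; omega),
        Function.update_of_ne (by unfold work; omega)]
    have hl : ∀ i < k, f' (low a w m i) = f (low a w m i) := fun i hi => by
      rw [hf', Function.update_of_ne (by unfold low; omega),
        Function.update_of_ne (by unfold work low; omega)]
    have hcar : ∀ i ≤ k, carry (f' (work a 0)) (fun i => f' (low a w m i)) i =
        carry (f (work a 0)) (fun i => f (low a w m i)) i := fun i hi => by
      rw [hw 0 (Nat.zero_le k)]
      exact carry_congr fun j hj => hl j (by omega)
    rw [h0, ← List.singleton_append, ← List.singleton_append (x := RevGate.cnot _ _),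
      ← List.append_assoc, RevGate.actList_append, List.singleton_append, hg, ih (by omega)]
    · funext x
      by_cases hx1 : x = work a (k + 1)
      · subst hx1
        rw [if_neg (by unfold work; omega), if_neg (by unfold work low; omega),
          if_pos (by unfold work; omega), hf',
          Function.update_of_ne (by unfold work low; omega), Function.update_self]
      by_cases hx2 : x = low a w m k
      · subst hx2
        rw [if_neg (by unfold low; omega), if_neg (by omega), if_neg (by unfold low; omega),
          if_pos (by unfold low; omega), hf', Function.update_self,
          show low a w m k - low a w m 0 = k by unfold low; omega]
      have hx : f' x = f x := by
        rw [hf', Function.update_of_ne hx2, Function.update_of_ne hx1]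
      rw [hx]
      refine if_congr (by unfold work at hx1; omega) rfl ?_
      by_cases h : low a w m 0 ≤ x ∧ x < low a w m k
      · rw [if_pos h, if_pos ⟨h.1, by unfold low at h ⊢; omega⟩,
          hcar _ (by unfold low at h ⊢; omega)]
      · rw [if_neg h, if_neg fun h' => h ⟨h'.1, by unfold low at *; omega⟩]
    · intro i h1 h2
      rw [hcar i h2, hw i h2]
      exact hf i h1 (by omega)

theorem actList_flipLow {k : ℕ} {f : ℕ → Bool} :
    RevGate.actList (flipLow a w m k) f = fun x =>
      if low a w m 0 ≤ x ∧ x < low a w m k then !f x else f x := by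
  induction k with
  | zero =>
    funext x
    rw [if_neg (by omega)]
    rfl
  | succ k ih =>
    have h0 : flipLow a w m (k + 1) = flipLow a w m k ++ [.not (low a w m k)] := by
      simp [flipLow, List.range_succ, List.flatMap_append]
    rw [h0, RevGate.actList_append, ih, RevGate.actList_cons, RevGate.actList_nil, RevGate.act,
      if_neg (by omega)]
    funext x
    by_cases hx : x = low a w m k
    · subst hx
      rw [Function.update_self, if_pos (by unfold low; omega)]
    · rw [Function.update_of_ne hx]
      refine if_congr ?_ rfl rfl
      unfold low at *
      omega

variable (a w m)

/-- The content of the qubits when the counter is `d` and the registers `A`, `W` hold `y`. -/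
def label (d : ℕ) (y : ℕ → Bool) (x : ℕ) : Bool :=
  if x < a then y x
  else if x = a then d.testBit m
  else if x < a + m + 2 then false
  else if x < a + m + 2 + w then y (x - (m + 2))
  else d.testBit (x - low a w m 0)

variable {a w m}

theorem label_of_lt {d : ℕ} {y : ℕ → Bool} {x : ℕ} (h : x < a) : label a w m d y x = y x :=
  if_pos h

theorem label_high (d : ℕ) (y : ℕ → Bool) : label a w m d y a = d.testBit m := by
  simp [label]

theorem label_work {d : ℕ} {y : ℕ → Bool} {x : ℕ} (h : a < x) (h' : x < a + m + 2) :
    label a w m d y x = false := by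
  rw [label, if_neg (by omega), if_neg (by omega), if_pos h']

theorem label_wit {d : ℕ} {y : ℕ → Bool} {x : ℕ} (h : a + m + 2 ≤ x) (h' : x < low a w m 0) :
    label a w m d y x = y (x - (m + 2)) := by
  unfold low at h'
  rw [label, if_neg (by omega), if_neg (by omega), if_neg (by omega), if_pos (by omega)]

theorem label_low {d : ℕ} {y : ℕ → Bool} {x : ℕ} (h : low a w m 0 ≤ x) :
    label a w m d y x = d.testBit (x - low a w m 0) := by
  have h' := h
  unfold low at h'
  rw [label, if_neg (by omega), if_neg (by omega), if_neg (by omega), if_neg (by omega)]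

theorem label_shiftQubit {d : ℕ} {y : ℕ → Bool} {q : ℕ} (hq : q < a + w) :
    label a w m d y (shiftQubit a m q) = y q := by
  unfold shiftQubit
  by_cases h : q < a
  · rw [if_pos h, label_of_lt h]
  · rw [if_neg h, label_wit (by omega) (by unfold low; omega), Nat.add_sub_cancel]

theorem shiftQubit_lt {q : ℕ} (hq : q < a + w) : shiftQubit a m q < low a w m 0 := by
  unfold shiftQubit low
  split_ifs <;> omega

theorem shiftQubit_or (q : ℕ) : shiftQubit a m q < a ∨ a + m + 2 ≤ shiftQubit a m q := by
  unfold shiftQubit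
  split_ifs <;> omega

theorem actList_incrGates {q d : ℕ} (hq : q < a + w) (y : ℕ → Bool) {x : ℕ}
    (hx : x < low a w m m) :
    RevGate.actList (incrGates a w m (shiftQubit a m q)) (label a w m d y) x =
      label a w m ((d + (y q).toNat) % 2 ^ (m + 1)) y x := by
  have hqn := shiftQubit_lt (m := m) hq
  have hqo := shiftQubit_or (a := a) (m := m) q
  have hqy : label a w m d y (shiftQubit a m q) = y q := label_shiftQubit hq
  generalize shiftQubit a m q = q' at *
  set f := label a w m d y with hf
  set f1 := Function.update f (work a 0) (y q) with hf1
  have hf1low : ∀ i, f1 (low a w m i) = d.testBit i := fun i => by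
    rw [hf1, Function.update_of_ne (by unfold work low; omega), hf,
      label_low (by unfold low; omega)]
    congr 1
    unfold low
    omega
  have hcar : ∀ j, carry (f1 (work a 0)) (fun i => f1 (low a w m i)) j =
      carry (y q) d.testBit j := fun j => by
    rw [hf1, Function.update_self, ← hf1]
    exact carry_congr fun i _ => hf1low i
  have h1 : (RevGate.cnot q' (work a 0)).act f = f1 := by
    rw [RevGate.act, hqy, hf, label_work (by unfold work; omega) (by unfold work; omega),
      Bool.false_xor]
  have h2 : RevGate.actList (chainUp a w m m) f1 = fun x =>
      if a + 1 < x ∧ x ≤ a + 1 + m then carry (y q) d.testBit (x - (a + 1)) else f1 x := by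
    rw [actList_chainUp le_rfl fun i hi hi' => ?_]
    · funext x
      rw [hcar]
    · rw [hf1, Function.update_of_ne (by unfold work; omega), hf,
        label_work (by unfold work; omega) (by unfold work; omega)]
  set f2 := fun x =>
      if a + 1 < x ∧ x ≤ a + 1 + m then carry (y q) d.testBit (x - (a + 1)) else f1 x with hf2
  have hf2w : ∀ i ≤ m, f2 (work a i) = carry (y q) d.testBit i := fun i hi => by
    simp only [hf2]
    rcases Nat.eq_zero_or_pos i with rfl | hi0
    · rw [if_neg (by unfold work; omega), hf1, Function.update_self, carry]
    · rw [if_pos (by unfold work; omega)]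
      congr 1
      unfold work
      omega
  have hf2a : f2 a = d.testBit m := by
    simp only [hf2]
    rw [if_neg (by omega), hf1, Function.update_of_ne (by unfold work; omega), hf, label_high]
  have h3 : (RevGate.cnot (work a m) a).act f2 =
      Function.update f2 a (xor (d.testBit m) (carry (y q) d.testBit m)) := by
    rw [RevGate.act, hf2w m le_rfl, hf2a]
  set f3 := Function.update f2 a (xor (d.testBit m) (carry (y q) d.testBit m)) with hf3
  have hf3w : ∀ i ≤ m, f3 (work a i) = carry (y q) d.testBit i := fun i hi => by
    rw [hf3, Function.update_of_ne (by unfold work; omega), hf2w i hi]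
  have hf3low : ∀ i, f3 (low a w m i) = d.testBit i := fun i => by
    rw [hf3, Function.update_of_ne (by unfold low; omega)]
    simp only [hf2]
    rw [if_neg (by unfold low; omega), hf1low]
  have hcar3 : ∀ j, carry (f3 (work a 0)) (fun i => f3 (low a w m i)) j =
      carry (y q) d.testBit j := fun j => by
    rw [hf3w 0 (Nat.zero_le m), carry]
    exact carry_congr fun i _ => hf3low i
  have h4 := actList_addDown (f := f3) (a := a) (w := w) (m := m) le_rfl
    fun i hi hi' => by rw [hf3w i hi', hcar3]
  simp only [hcar3] at h4
  set f4 := fun x =>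
      if a + 1 < x ∧ x ≤ a + 1 + m then false
      else if low a w m 0 ≤ x ∧ x < low a w m m then
        xor (f3 x) (carry (y q) d.testBit (x - low a w m 0))
      else f3 x with hf4
  have hother : ∀ z, z ≠ a → ¬ (a < z ∧ z < a + m + 2) → z < low a w m 0 → f4 z = f z := by
    intro z hz1 hz2 hz3
    simp only [hf4]
    rw [if_neg (by omega), if_neg (by omega), hf3, Function.update_of_ne hz1]
    simp only [hf2]
    rw [if_neg (by omega), hf1, Function.update_of_ne (by unfold work; omega)]
  have hf4q : f4 q' = y q := by
    rw [hother q' (by omega) (by omega) hqn, hqy]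
  have hf4w : f4 (work a 0) = y q := by
    simp only [hf4]
    rw [if_neg (by unfold work; omega), if_neg (by unfold work low; omega),
      hf3w 0 (Nat.zero_le m), carry]
  have h5 : (RevGate.cnot q' (work a 0)).act f4 = Function.update f4 (work a 0) false := by
    rw [RevGate.act, hf4q, hf4w, Bool.xor_self]
  have h6 : RevGate.actList (incrGates a w m q') f = Function.update f4 (work a 0) false := by
    simp only [incrGates, RevGate.actList_append, RevGate.actList_cons, RevGate.actList_nil, h1,
      h2, h3, h4, h5]
  rw [h6]
  have hbit : ∀ j ≤ m, ((d + (y q).toNat) % 2 ^ (m + 1)).testBit j =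
      xor (d.testBit j) (carry (y q) d.testBit j) := fun j hj => by
    rw [Nat.testBit_mod_two_pow, testBit_add_toNat, decide_eq_true (by omega), Bool.true_and]
  rcases lt_trichotomy x a with hxa | rfl | hxa
  · rw [Function.update_of_ne (by unfold work; omega), label_of_lt hxa,
      hother x (by omega) (by omega) (by unfold low; omega), hf, label_of_lt hxa]
  · rw [Function.update_of_ne (by unfold work; omega), label_high, hbit m le_rfl]
    simp only [hf4]
    rw [if_neg (by omega), if_neg (by unfold low; omega), hf3, Function.update_self]
  by_cases hx1 : x < a + m + 2
  · rw [label_work hxa hx1]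
    by_cases hx0 : x = work a 0
    · rw [hx0, Function.update_self]
    · rw [Function.update_of_ne hx0]
      simp only [hf4]
      rw [if_pos (by unfold work at hx0; omega)]
  by_cases hx2 : x < low a w m 0
  · rw [Function.update_of_ne (by unfold work; omega), label_wit (by omega) hx2,
      hother x (by omega) (by omega) hx2, hf, label_wit (by omega) hx2]
  · rw [Function.update_of_ne (by unfold work; omega), label_low (by omega),
      hbit _ (by unfold low at *; omega)]
    simp only [hf4]
    rw [if_neg (by omega), if_pos ⟨by omega, hx⟩]
    congr 1
    have := hf3low (x - low a w m 0)
    rwa [show low a w m (x - low a w m 0) = x by unfold low at *; omega] at this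

/-- The carry chain on the complemented bits tests whether the counter is zero. -/
theorem carry_not_testBit_and {d : ℕ} (hd : d < 2 ^ (m + 1)) :
    (carry true (fun i => !d.testBit i) m && !d.testBit m) = decide (d = 0) := by
  rw [Bool.eq_iff_iff, Bool.and_eq_true, carry_eq_true_iff, decide_eq_true_iff]
  constructor
  · rintro ⟨⟨-, h1⟩, h2⟩
    refine Nat.eq_of_testBit_eq fun i => ?_
    rw [Nat.zero_testBit]
    rcases lt_trichotomy i m with h | rfl | h
    · simpa using h1 i h
    · simpa using h2
    · exact Nat.testBit_lt_two_pow (hd.trans_le (Nat.pow_le_pow_right (by norm_num) h))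
  · rintro rfl
    simp

theorem actList_checkGates {q d : ℕ} (hq : q < a + w) (hd : d < 2 ^ (m + 1)) (y : ℕ → Bool)
    {x : ℕ} (hx : x < low a w m m) :
    RevGate.actList (checkGates a w m (shiftQubit a m q)) (label a w m d y) x =
      label a w m d (if d = 0 then Function.update y q (!y q) else y) x := by
  have hqn := shiftQubit_lt (m := m) hq
  have hqo := shiftQubit_or (a := a) (m := m) q
  set q' := shiftQubit a m q with hq'
  set f := label a w m d y with hf
  have hqy : f q' = y q := label_shiftQubit hq
  -- the state after the bits of the counter and the first work qubit have been flipped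
  set f1 : ℕ → Bool := fun z =>
    if z = a ∨ z = work a 0 ∨ (low a w m 0 ≤ z ∧ z < low a w m m) then !f z else f z with hf1
  have h1 : RevGate.actList (flipLow a w m m ++ [.not a, .not (work a 0)]) f = f1 := by
    rw [RevGate.actList_append, actList_flipLow]
    simp only [RevGate.actList_cons, RevGate.actList_nil, RevGate.act]
    funext z
    simp only [hf1]
    by_cases hz : z = work a 0
    · subst hz
      rw [Function.update_self, Function.update_of_ne (by unfold work; omega),
        if_neg (by unfold work low; omega), if_pos (by simp)]
    · rw [Function.update_of_ne hz]
      by_cases hz' : z = a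
      · subst hz'
        rw [Function.update_self, if_neg (by unfold low; omega), if_pos (by simp)]
      · rw [Function.update_of_ne hz']
        exact if_congr (by simp [hz, hz']) rfl rfl
  have h1' : ∀ g : ℕ → Bool, RevGate.actList ([.not (work a 0), .not a] ++ flipLow a w m m) g =
      fun z => if z = a ∨ z = work a 0 ∨ (low a w m 0 ≤ z ∧ z < low a w m m)
        then !g z else g z := by
    intro g
    rw [RevGate.actList_append, actList_flipLow]
    simp only [RevGate.actList_cons, RevGate.actList_nil, RevGate.act]
    funext z
    by_cases hz : z = a
    · subst hz
      rw [if_neg (by unfold low; omega), Function.update_self,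
        Function.update_of_ne (by unfold work; omega), if_pos (by simp)]
    · rw [Function.update_of_ne hz]
      by_cases hz' : z = work a 0
      · subst hz'
        rw [Function.update_self, if_neg (by unfold work low; omega), if_pos (by simp)]
      · rw [Function.update_of_ne hz']
        exact if_congr (by simp [hz, hz']) rfl rfl
  have hf1low : ∀ i < m, f1 (low a w m i) = !d.testBit i := fun i hi => by
    simp only [hf1]
    rw [if_pos (by unfold low work; omega), hf, label_low (by unfold low; omega)]
    congr 2
    unfold low
    omega
  have hf1w0 : f1 (work a 0) = true := by
    simp only [hf1]
    rw [if_pos (by simp), hf, label_work (by unfold work; omega) (by unfold work; omega),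
      Bool.not_false]
  have hf1a : f1 a = !d.testBit m := by
    simp only [hf1]
    rw [if_pos (by simp), hf, label_high]
  have hf1w : ∀ i, 0 < i → i ≤ m → f1 (work a i) = false := fun i hi hi' => by
    simp only [hf1]
    rw [if_neg (by unfold work low; omega), hf,
      label_work (by unfold work; omega) (by unfold work; omega)]
  have hf1q : f1 q' = y q := by
    simp only [hf1]
    rw [if_neg (by unfold work; omega), hqy]
  have hcar : ∀ j ≤ m, carry (f1 (work a 0)) (fun i => f1 (low a w m i)) j =
      carry true (fun i => !d.testBit i) j := fun j hj => by
    rw [hf1w0]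
    exact carry_congr fun i hi => hf1low i (by omega)
  have h2 : RevGate.actList (chainUp a w m m) f1 = fun z =>
      if a + 1 < z ∧ z ≤ a + 1 + m then carry true (fun i => !d.testBit i) (z - (a + 1))
      else f1 z := by
    rw [actList_chainUp le_rfl hf1w]
    funext z
    split_ifs with hz
    · exact hcar _ (by omega)
    · rfl
  set f2 := fun z =>
      if a + 1 < z ∧ z ≤ a + 1 + m then carry true (fun i => !d.testBit i) (z - (a + 1))
      else f1 z with hf2
  have hf2w : ∀ i ≤ m, f2 (work a i) = carry true (fun i => !d.testBit i) i := fun i hi => by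
    simp only [hf2]
    rcases Nat.eq_zero_or_pos i with rfl | hi0
    · rw [if_neg (by unfold work; omega), hf1w0, carry]
    · rw [if_pos (by unfold work; omega)]
      congr 1
      unfold work
      omega
  have hf2of : ∀ z, ¬ (a + 1 < z ∧ z ≤ a + 1 + m) → f2 z = f1 z := fun z hz => if_neg hz
  have h3 : (RevGate.toffoli (work a m) a q').act f2 =
      Function.update f2 q' (xor (y q) (decide (d = 0))) := by
    rw [RevGate.act, hf2w m le_rfl, hf2of a (by omega), hf1a, carry_not_testBit_and hd,
      hf2of q' (by omega), hf1q]
  set f3 := Function.update f2 q' (xor (y q) (decide (d = 0))) with hf3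
  have hf3w : ∀ i ≤ m, f3 (work a i) = carry true (fun i => !d.testBit i) i := fun i hi => by
    rw [hf3, Function.update_of_ne (by unfold work; omega), hf2w i hi]
  have hf3low : ∀ i < m, f3 (low a w m i) = !d.testBit i := fun i hi => by
    rw [hf3, Function.update_of_ne (by unfold low at *; omega), hf2of _ (by unfold low; omega),
      hf1low i hi]
  have h4 := actList_chainDown (f := f3) (a := a) (w := w) (m := m) le_rfl fun i hi hi' => by
    rw [hf3w i hi', hf3w 0 (Nat.zero_le m), carry]
    exact carry_congr fun j hj => (hf3low j (by omega)).symm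
  have h5 : RevGate.actList (checkGates a w m q') f = fun z =>
      if z = a ∨ z = work a 0 ∨ (low a w m 0 ≤ z ∧ z < low a w m m) then
        !(if a + 1 < z ∧ z ≤ a + 1 + m then false else f3 z)
      else if a + 1 < z ∧ z ≤ a + 1 + m then false else f3 z := by
    have h0 : checkGates a w m q' = (flipLow a w m m ++ [.not a, .not (work a 0)]) ++
        (chainUp a w m m ++ (.toffoli (work a m) a q' :: (chainDown a w m m ++
          ([.not (work a 0), .not a] ++ flipLow a w m m)))) := by
      simp [checkGates]
    rw [h0, RevGate.actList_append, h1, RevGate.actList_append, h2, RevGate.actList_cons, h3,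
      RevGate.actList_append, h4, h1']
  have hf3of : ∀ z, z ≠ q' → ¬ (a + 1 < z ∧ z ≤ a + 1 + m) → f3 z = f1 z := fun z hz hz' => by
    rw [hf3, Function.update_of_ne hz, hf2of z hz']
  have h6 : RevGate.actList (checkGates a w m q') f x =
      if x = q' then xor (y q) (decide (d = 0)) else f x := by
    rw [h5]
    beta_reduce
    by_cases hxq : x = q'
    · rw [if_pos hxq, if_neg (by unfold work; omega), if_neg (by omega), hxq, hf3,
        Function.update_self]
    · rw [if_neg hxq]
      by_cases hxw : a + 1 < x ∧ x ≤ a + 1 + m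
      · rw [if_neg (by unfold work low; omega), if_pos hxw, hf,
          label_work (by omega) (by omega)]
      · simp only [if_neg hxw, hf3of x hxq hxw, hf1]
        split_ifs
        · rw [Bool.not_not]
        · rfl
  rw [h6]
  by_cases hd0 : d = 0
  · rw [if_pos hd0, decide_eq_true hd0, Bool.xor_true]
    have hne : ∀ z, z ≠ q → Function.update y q (!y q) z = y z :=
      fun z hz => Function.update_of_ne hz _ _
    by_cases hxq : x = q'
    · rw [if_pos hxq, hxq, hq', label_shiftQubit hq, Function.update_self]
    · rw [if_neg hxq, hf]
      rw [hq', shiftQubit] at hxq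
      unfold label
      split_ifs at hxq ⊢ <;> first | rfl | (rw [hne]; omega)
  · rw [if_neg hd0, decide_eq_false hd0, Bool.xor_false]
    split_ifs with hxq
    · rw [hxq, ← hf, hqy]
    · rfl

/-- Extension of an assignment of `n` bits by `false`. -/
def extendFalse {n : ℕ} (y : Fin n → Bool) (x : ℕ) : Bool :=
  if hx : x < n then y ⟨x, hx⟩ else false

theorem extendFalse_val {n : ℕ} (y : Fin n → Bool) (i : Fin n) : extendFalse y i = y i :=
  dif_pos i.2

theorem extendFalse_update {n : ℕ} (y : Fin n → Bool) (i : Fin n) (b : Bool) :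
    extendFalse (Function.update y i b) = Function.update (extendFalse y) i b := by
  funext x
  by_cases hx : x < n
  · by_cases hxi : x = i
    · subst hxi
      rw [extendFalse_val, Function.update_self, Function.update_self]
    · rw [Function.update_of_ne hxi]
      have hxi' : (⟨x, hx⟩ : Fin n) ≠ i := fun h => hxi (congrArg Fin.val h)
      simp only [extendFalse, dif_pos hx, Function.update_of_ne hxi']
  · have hxi : x ≠ i := fun h => hx (h ▸ i.2)
    rw [Function.update_of_ne hxi]
    simp only [extendFalse, dif_neg hx]

variable {b t : ℕ}

theorem layout_snd_eq (hmb : m ≤ b) (p : Fin (2 ^ b) × (Fin (a + w) → Bool)) :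
    (layout a w m b t hmb p).2 = Fin.append
      (Fin.append (Fin.append (fun i : Fin a => p.2 (Fin.castAdd w i))
        (fun j : Fin (b - m) => (p.1 : ℕ).testBit (m + j))) (fun _ : Fin t => false))
      (Fin.append (fun i : Fin w => p.2 (Fin.natAdd a i))
        (fun j : Fin m => (p.1 : ℕ).testBit j)) := rfl

/-- With `m + 1` counter bits and `m + 1` work qubits, the layout of the registers is the one on
which the reversible circuits have been analysed. -/
theorem layout_snd (hmb : m ≤ b) (hb : b = m + 1) (ht : t = m + 1)
    (p : Fin (2 ^ b) × (Fin (a + w) → Bool)) :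
    (layout a w m b t hmb p).2 =
      fun i : Fin (a + (b - m) + t + (w + m)) => label a w m p.1 (extendFalse p.2) i := by
  rw [layout_snd_eq]
  funext i
  induction i using Fin.addCases with
  | left i =>
    rw [Fin.append_left]
    induction i using Fin.addCases with
    | left i =>
      rw [Fin.append_left]
      induction i using Fin.addCases with
      | left i =>
        rw [Fin.append_left, label_of_lt (by simp), ← extendFalse_val p.2]
        rfl
      | right i =>
        have hi : (i : ℕ) = 0 := by omega
        rw [Fin.append_right]
        simp [hi, label_high]
    | right i =>
      rw [Fin.append_right, label_work] <;> simp <;> omega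
  | right i =>
    rw [Fin.append_right]
    induction i using Fin.addCases with
    | left i =>
      rw [Fin.append_left, label_wit (by simp; omega) (by simp [low]; omega),
        ← extendFalse_val p.2]
      congr 1
      simp
      omega
    | right i =>
      rw [Fin.append_right, label_low (by simp [low]; omega)]
      congr 1
      simp [low]
      omega

theorem val_layoutQubit {h : ℕ} (hh : h = 1) (ht : t = m + 1) (i : Fin (a + w)) :
    (layoutQubit h t m i : ℕ) = shiftQubit a m i := by
  refine Fin.addCases (fun i => ?_) (fun i => ?_) i
  · simp [layoutQubit, shiftQubit]
  · simp [layoutQubit, shiftQubit]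
    omega

theorem layoutQubit_injective {h : ℕ} :
    Function.Injective (layoutQubit h t m : Fin (a + w) → Fin (a + h + t + (w + m))) := by
  intro i j
  refine Fin.addCases (fun i => ?_) (fun i => ?_) i <;>
    refine Fin.addCases (fun j => ?_) (fun j => ?_) j <;>
    intro hij <;> have hij' := congrArg Fin.val hij <;>
    simp [layoutQubit] at hij' <;> apply Fin.ext <;> simp <;> omega

/-- `layoutQubit` as an embedding. -/
def layoutEmb (a w h t m : ℕ) : Fin (a + w) ↪ Fin (a + h + t + (w + m)) :=
  ⟨layoutQubit h t m, layoutQubit_injective⟩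

theorem layout_layoutQubit (hmb : m ≤ b) (p : Fin (2 ^ b) × (Fin (a + w) → Bool))
    (i : Fin (a + w)) : (layout a w m b t hmb p).2 (layoutQubit (b - m) t m i) = p.2 i := by
  rw [layout_snd_eq]
  refine Fin.addCases (fun i => ?_) (fun i => ?_) i <;> simp [layoutQubit]

/-- A bit of the layout that does not belong to `A` or `W` is determined by the counter. -/
theorem layout_congr (hmb : m ≤ b) (d : Fin (2 ^ b)) (y y' : Fin (a + w) → Bool)
    {x : Fin (a + (b - m) + t + (w + m))}
    (hx : ¬ ∃ i : Fin (a + w), layoutQubit (b - m) t m i = x) :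
    (layout a w m b t hmb (d, y)).2 x = (layout a w m b t hmb (d, y')).2 x := by
  rw [layout_snd_eq, layout_snd_eq]
  induction x using Fin.addCases with
  | left i =>
    rw [Fin.append_left, Fin.append_left]
    induction i using Fin.addCases with
    | left i =>
      rw [Fin.append_left, Fin.append_left]
      induction i using Fin.addCases with
      | left i => exact absurd ⟨Fin.castAdd w i, by simp [layoutQubit]⟩ hx
      | right i => rw [Fin.append_right, Fin.append_right]
    | right i => rw [Fin.append_right, Fin.append_right]
  | right i =>
    rw [Fin.append_right, Fin.append_right]
    induction i using Fin.addCases with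
    | left i => exact absurd ⟨Fin.natAdd a i, by simp [layoutQubit]⟩ hx
    | right i => rw [Fin.append_right, Fin.append_right]

variable {𝒞 : GateSet}

/-- The operations that replace an operation of the original circuit. -/
noncomputable def truncOp (hC : 𝒞.HasReversibleGates) (a w m h t : ℕ) :
    Op 𝒞 (a + w) → List (Op 𝒞 (a + h + t + (w + m)))
  | .gate g => [.gate (g.trans (layoutEmb a w h t m))]
  | .incr i => (incrGates a w m (shiftQubit a m i)).flatMap (RevGate.toOps hC _)
  | .checkZero i => (checkGates a w m (shiftQubit a m i)).flatMap (RevGate.toOps hC _)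

theorem runOps_truncOp (hC : 𝒞.HasReversibleGates) (hmb : m ≤ b) (hb : b = m + 1)
    (ht : t = m + 1) (op : Op 𝒞 (a + w)) (ψ : Hilb (Fin (2 ^ b) × (Fin (a + w) → Bool))) :
    runOps noCounter (truncOp hC a w m (b - m) t op) (Hilb.basisMap (layout a w m b t hmb) ψ) =
      Hilb.basisMap (layout a w m b t hmb) (op.toIsometry (modCounter (2 ^ b)) ψ) := by
  have hn : a + (b - m) + t + (w + m) = a + m + 2 + w + m := by omega
  have hshift : ∀ i : Fin (a + w), shiftQubit a m i < a + (b - m) + t + (w + m) := fun i => by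
    have := shiftQubit_lt (m := m) i.2
    unfold low at this
    omega
  cases op with
  | gate g =>
    refine applyGate_basisMap (layout a w m b t hmb) g.qubits
      (g.qubits.trans (layoutEmb a w (b - m) t m))
      (fun p => funext fun j => layout_layoutQubit hmb p _) (fun p c => Prod.ext rfl ?_) _ ψ
    change (layout a w m b t hmb (p.1, Function.extend g.qubits c p.2)).2 =
      Function.extend (g.qubits.trans (layoutEmb a w (b - m) t m)) c (layout a w m b t hmb p).2
    funext x
    by_cases hx : ∃ i : Fin (a + w), layoutQubit (b - m) t m i = x
    · obtain ⟨i, rfl⟩ := hx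
      rw [layout_layoutQubit]
      change Function.extend g.qubits c p.2 i = _
      by_cases hi : ∃ j, g.qubits j = i
      · obtain ⟨j, rfl⟩ := hi
        rw [g.qubits.injective.extend_apply]
        exact ((g.qubits.trans (layoutEmb a w (b - m) t m)).injective.extend_apply _ _ j).symm
      · rw [Function.extend_apply' _ _ _ hi, Function.extend_apply', layout_layoutQubit]
        rintro ⟨j, hj⟩
        exact hi ⟨j, layoutQubit_injective hj⟩
    · rw [Function.extend_apply']
      · exact layout_congr hmb _ _ _ hx
      · rintro ⟨j, hj⟩
        exact hx ⟨_, hj⟩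
  | incr i =>
    rw [truncOp, Op.toIsometry, Hilb.basisMap_basisMap]
    refine RevGate.runOps_flatMap_toOps_basisMap hC
      (valid_incrGates a w m hn (hshift i) (shiftQubit_or _)) _ _ _ (layout_snd hmb hb ht) ?_ ψ
    intro p
    refine (layout_snd hmb hb ht _).trans (funext fun x => ?_)
    rw [actList_incrGates i.2 _ (by have := x.2; unfold low; omega), extendFalse_val]
    congr 1
    rw [incrLabel_apply]
    cases p.2 i
    · have : (p.1 : ℕ) < 2 ^ (m + 1) := by
        have := p.1.2
        simp only [hb] at this
        exact this
      simp [Nat.mod_eq_of_lt this]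
    · simp [modCounter, Fin.val_add, hb]
  | checkZero i =>
    rw [truncOp, Op.toIsometry, Hilb.basisMap_basisMap]
    refine RevGate.runOps_flatMap_toOps_basisMap hC
      (valid_checkGates a w m hn (hshift i) (shiftQubit_or _)) _ _ _ (layout_snd hmb hb ht) ?_ ψ
    intro p
    refine (layout_snd hmb hb ht _).trans (funext fun x => ?_)
    have hd : (p.1 : ℕ) < 2 ^ (m + 1) := by
      have := p.1.2
      simp only [hb] at this
      exact this
    rw [actList_checkGates i.2 hd _ (by have := x.2; unfold low; omega)]
    congr 1
    rw [checkZeroLabel_apply]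
    by_cases hp : p.1 = (modCounter (2 ^ b)).zero
    · have hp' : (p.1 : ℕ) = 0 := by rw [hp]; rfl
      rw [if_pos hp, if_pos hp', extendFalse_update, extendFalse_val]
    · have hp' : (p.1 : ℕ) ≠ 0 := fun h => hp (Fin.ext h)
      rw [if_neg hp, if_neg hp']

theorem runOps_flatMap_truncOp (hC : 𝒞.HasReversibleGates) (hmb : m ≤ b) (hb : b = m + 1)
    (ht : t = m + 1) (ops : List (Op 𝒞 (a + w)))
    (ψ : Hilb (Fin (2 ^ b) × (Fin (a + w) → Bool))) :
    runOps noCounter (ops.flatMap (truncOp hC a w m (b - m) t))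
        (Hilb.basisMap (layout a w m b t hmb) ψ) =
      Hilb.basisMap (layout a w m b t hmb) (runOps (modCounter (2 ^ b)) ops ψ) := by
  induction ops generalizing ψ with
  | nil => rfl
  | cons op ops ih =>
    rw [List.flatMap_cons, runOps_append, runOps_truncOp hC hmb hb ht, ih, runOps_cons]

end TruncLayout

variable {𝒞 : GateSet}

/-- Under the assumption on `m` the truncated counter has exactly one qubit more than `m`. -/
theorem truncBits_eq {m ℓ : ℕ} (h : 8 * ℓ < 2 ^ m) : truncBits m ℓ = m + 1 := by
  refine (isLeast_truncBits m ℓ).unique ⟨?_, fun k hk => ?_⟩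
  · change 2 ^ m + ℓ < 2 ^ (m + 1)
    rw [pow_succ]
    omega
  · by_contra hlt
    have hle : 2 ^ k ≤ 2 ^ m := Nat.pow_le_pow_right (by norm_num) (by omega)
    have hk' : 2 ^ m + ℓ < 2 ^ k := hk
    omega

/-- The circuit for the truncation of `V`, with `m + 1` work qubits. -/
noncomputable def VerifierCircuit.truncCircuit (hC : 𝒞.HasReversibleGates) (m : ℕ)
    (V : VerifierCircuit 𝒞) : VerifierCircuit 𝒞 :=
  ⟨V.anc + (truncBits m V.numIncr - m) + (m + 1), V.wit + m,
    layoutQubit (truncBits m V.numIncr - m) (m + 1) m V.out,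
    V.ops.flatMap (TruncLayout.truncOp hC V.anc V.wit m (truncBits m V.numIncr - m) (m + 1))⟩

theorem VerifierCircuit.isTruncationCircuit_truncCircuit (hC : 𝒞.HasReversibleGates) {m : ℕ}
    (V : VerifierCircuit 𝒞) (hm : 8 * V.numIncr < 2 ^ m) :
    V.IsTruncationCircuit m (V.truncCircuit hC m) :=
  ⟨m + 1, _, rfl, fun ψ => TruncLayout.runOps_flatMap_truncOp hC _ (truncBits_eq hm) rfl _ ψ⟩

theorem VerifierCircuit.counterFree_truncCircuit (hC : 𝒞.HasReversibleGates) {m : ℕ}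
    (V : VerifierCircuit 𝒞) : (V.truncCircuit hC m).CounterFree := by
  have hgates : ∀ (gs : List RevGate) (n : ℕ), ∀ op ∈ gs.flatMap (RevGate.toOps hC n),
      ∃ g, op = Op.gate g := by
    intro gs n op hop
    obtain ⟨g, -, hop⟩ := List.mem_flatMap.1 hop
    rw [RevGate.toOps] at hop
    split_ifs at hop
    · obtain ⟨p, -, rfl⟩ := List.mem_map.1 hop
      exact ⟨_, rfl⟩
    · simp at hop
  intro op hop
  obtain ⟨op', -, hop⟩ := List.mem_flatMap.1 hop
  cases op' with
  | gate g => exact ⟨_, List.mem_singleton.1 hop⟩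
  | incr i => exact hgates _ _ op hop
  | checkZero i => exact hgates _ _ op hop

/-! ### Acceptance probabilities of the truncation -/

theorem Hilb.exists_basisMap_eq {ι ι' : Type} (f : ι ↪ ι') (φ : Hilb ι')
    (h : ∀ j, φ j ≠ 0 → ∃ i, f i = j) : ∃ ψ : Hilb ι, Hilb.basisMap f ψ = φ := by
  refine ⟨⟨fun i => φ (f i),
    Hilb.mem_of_summable ((Hilb.summable_norm_sq φ).comp_injective f.injective)⟩, ?_⟩
  refine lp.ext (funext fun j => ?_)
  by_cases hj : ∃ i, f i = j
  · obtain ⟨i, rfl⟩ := hj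
    rw [Hilb.basisMap_apply]
  · rw [Hilb.basisMap_apply_of_notMem _ _ hj]
    by_contra hne
    exact hj (h j fun h0 => hne h0.symm)

theorem Hilb.project_zero {ι : Type} (S : Set ι) : Hilb.project S (0 : Hilb ι) = 0 := by
  have h := Hilb.project_sub S (0 : Hilb ι) 0
  rwa [sub_self, sub_self] at h

/-- The witness register of the truncation: `w` qubits, and the `m` least significant bits of the
counter. -/
def counterOfBits (w m : ℕ) : Unit × (Fin (w + m) → Bool) ↪ ℕ × (Fin w → Bool) where
  toFun p := (Nat.ofBits fun j : Fin m => p.2 (Fin.natAdd w j), fun i => p.2 (Fin.castAdd m i))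
  inj' := by
    rintro ⟨⟨⟩, y⟩ ⟨⟨⟩, y'⟩ h
    obtain ⟨h1, h2⟩ := Prod.mk.inj h
    refine Prod.ext rfl (funext fun i => ?_)
    induction i using Fin.addCases with
    | left i => exact congrFun h2 i
    | right j =>
      have := congrArg (fun d => d.testBit j) h1
      simpa [Nat.testBit_ofBits_lt _ _ j.2] using this

theorem counterOfBits_apply {w m : ℕ} (f : Fin (w + m) → Bool) :
    counterOfBits w m ((), f) =
      (Nat.ofBits fun j : Fin m => f (Fin.natAdd w j), fun i => f (Fin.castAdd m i)) := rfl

theorem counterOfBits_fst_lt {w m : ℕ} (p : Unit × (Fin (w + m) → Bool)) :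
    (counterOfBits w m p).1 < 2 ^ m :=
  Nat.ofBits_lt_two_pow _

theorem exists_counterOfBits {w m : ℕ} {p : ℕ × (Fin w → Bool)} (h : p.1 < 2 ^ m) :
    ∃ y, counterOfBits w m y = p := by
  refine ⟨((), Fin.append p.2 fun j : Fin m => p.1.testBit j), ?_⟩
  rw [counterOfBits_apply]
  simp only [Fin.append_left, Fin.append_right]
  refine Prod.ext (Nat.eq_of_testBit_eq fun i => ?_) rfl
  by_cases hi : i < m
  · rw [Nat.testBit_ofBits_lt _ _ hi]
  · rw [Nat.testBit_ofBits_ge _ _ (not_lt.1 hi), Nat.testBit_lt_two_pow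
      (h.trans_le (Nat.pow_le_pow_right (by norm_num) (not_lt.1 hi)))]

namespace VerifierCircuit

variable {𝒞 : GateSet}

/-- The state produced by the circuit from a witness. -/
noncomputable def outState {κ : Type} [DecidableEq κ] (V : VerifierCircuit 𝒞) (B : Counter κ) :
    Hilb (κ × (Fin V.wit → Bool)) →ₗᵢ[ℂ] Hilb (κ × (Fin (V.anc + V.wit) → Bool)) :=
  (V.toIsometry B).comp (Hilb.basisMap (V.inputLabel κ))

theorem outState_apply {κ : Type} [DecidableEq κ] (V : VerifierCircuit 𝒞) (B : Counter κ)
    (φ : Hilb (κ × (Fin V.wit → Bool))) :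
    V.outState B φ = runOps B V.ops (Hilb.basisMap (V.inputLabel κ) φ) := rfl

theorem acceptProb_eq {κ : Type} [DecidableEq κ] (V : VerifierCircuit 𝒞) (B : Counter κ)
    (φ : Hilb (κ × (Fin V.wit → Bool))) :
    V.acceptProb B φ = ‖Hilb.project {p | p.2 V.out = true} (V.outState B φ)‖ ^ 2 := rfl

theorem acceptProb_smul {κ : Type} [DecidableEq κ] (V : VerifierCircuit 𝒞) (B : Counter κ)
    (a : ℂ) (φ : Hilb (κ × (Fin V.wit → Bool))) :
    V.acceptProb B (a • φ) = ‖a‖ ^ 2 * V.acceptProb B φ := by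
  rw [acceptProb_eq, acceptProb_eq, map_smul, Hilb.project_smul, norm_smul, mul_pow]

/-- A circuit that acts as the truncated counter on the layout accepts a witness with the same
probability as the circuit with the infinite counter. -/
theorem acceptProb_of_layout (V : VerifierCircuit 𝒞) {m b t : ℕ} (hmb : m ≤ b)
    (hD : 2 ^ m + V.numIncr < 2 ^ b) (ops : List (Op 𝒞 (V.anc + (b - m) + t + (V.wit + m))))
    (hops : ∀ ψ : Hilb (Fin (2 ^ b) × (Fin (V.anc + V.wit) → Bool)),
      runOps noCounter ops (Hilb.basisMap (layout V.anc V.wit m b t hmb) ψ) =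
        Hilb.basisMap (layout V.anc V.wit m b t hmb) (V.truncation (2 ^ b) ψ))
    (v : Hilb (Unit × (Fin (V.wit + m) → Bool))) :
    (⟨V.anc + (b - m) + t, V.wit + m, layoutQubit (b - m) t m V.out, ops⟩ :
      VerifierCircuit 𝒞).acceptProb noCounter v =
      V.acceptProb infCounter (Hilb.basisMap (counterOfBits V.wit m) v) := by
  have hlt : ∀ y : Unit × (Fin (V.wit + m) → Bool), (counterOfBits V.wit m y).1 < 2 ^ b :=
    fun y => (counterOfBits_fst_lt y).trans_le (Nat.pow_le_pow_right (by norm_num) hmb)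
  -- the input states as states of the truncated counter
  let E : Unit × (Fin (V.wit + m) → Bool) ↪ Fin (2 ^ b) × (Fin (V.anc + V.wit) → Bool) :=
    { toFun := fun y => (⟨(counterOfBits V.wit m y).1, hlt y⟩,
        Fin.append (fun _ => false) (counterOfBits V.wit m y).2)
      inj' := by
        intro y y' h
        obtain ⟨h1, h2⟩ := Prod.mk.inj h
        refine (counterOfBits V.wit m).injective (Prod.ext (Fin.mk.inj h1) (funext fun i => ?_))
        simpa using congrFun h2 (Fin.natAdd V.anc i) }
  have hE1 : ∀ y, E y = (⟨(counterOfBits V.wit m y).1, hlt y⟩,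
        Fin.append (fun _ => false) (counterOfBits V.wit m y).2) := fun y => rfl
  have hin : ∀ y : Unit × (Fin (V.wit + m) → Bool),
      (((), Fin.append (fun _ : Fin (V.anc + (b - m) + t) => false) y.2) :
        Unit × (Fin (V.anc + (b - m) + t + (V.wit + m)) → Bool)) =
        layout V.anc V.wit m b t hmb (E y) := by
    intro y
    suffices h : Fin.append (fun _ : Fin (V.anc + (b - m) + t) => false) y.2 =
        (layout V.anc V.wit m b t hmb (E y)).2 by
      rw [h]
    rw [TruncLayout.layout_snd_eq, hE1]
    funext i
    induction i using Fin.addCases with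
    | left i =>
      rw [Fin.append_left, Fin.append_left]
      induction i using Fin.addCases with
      | left i =>
        rw [Fin.append_left]
        induction i using Fin.addCases with
        | left i => simp
        | right i =>
          rw [Fin.append_right]
          exact (Nat.testBit_lt_two_pow ((counterOfBits_fst_lt y).trans_le
            (Nat.pow_le_pow_right (by norm_num) (Nat.le_add_right m i)))).symm
      | right i => rw [Fin.append_right]
    | right i =>
      rw [Fin.append_right, Fin.append_right]
      induction i using Fin.addCases with
      | left i =>
        rw [Fin.append_left]
        dsimp only
        rw [Fin.append_right]
        rfl
      | right i =>
        rw [Fin.append_right]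
        exact (Nat.testBit_ofBits_lt (fun j => y.2 (Fin.natAdd V.wit j)) _ i.2).symm
  have h1 : (⟨V.anc + (b - m) + t, V.wit + m, layoutQubit (b - m) t m V.out, ops⟩ :
      VerifierCircuit 𝒞).outState noCounter v = Hilb.basisMap (layout V.anc V.wit m b t hmb)
        (V.truncation (2 ^ b) (Hilb.basisMap E v)) := by
    rw [← hops, Hilb.basisMap_basisMap]
    rw [outState_apply]
    refine congrArg (runOps noCounter ops) (Hilb.basisMap_congr fun y _ => ?_)
    exact hin y
  have h2 : V.outState infCounter (Hilb.basisMap (counterOfBits V.wit m) v) =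
      Hilb.basisMap (counterMap _ Fin.valEmbedding)
        (V.truncation (2 ^ b) (Hilb.basisMap E v)) := by
    have h3 := runOps_counterMap (modCounter (2 ^ b)) infCounter Fin.valEmbedding
      (fun k => {d | (d : ℕ) + k < 2 ^ b}) (fun k d _ => Fin.val_eq_zero_iff)
      (fun k d hd => by
        have hd' : (d : ℕ) + (k + 1) < 2 ^ b := hd
        have hs : (((modCounter (2 ^ b)).succ d : Fin (2 ^ b)) : ℕ) = d + 1 := by
          change ((d + 1 : Fin (2 ^ b)) : ℕ) = d + 1
          exact Fin.val_add_one_of_lt' (by omega)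
        refine ⟨?_, ?_, hs⟩
        · change (d : ℕ) + k < 2 ^ b
          omega
        · change (((modCounter (2 ^ b)).succ d : Fin (2 ^ b)) : ℕ) + k < 2 ^ b
          omega)
      V.ops (Hilb.basisMap E v) (by
        have : CounterSupp Set.univ v := fun p hp => absurd (Set.mem_univ _) hp
        refine this.basisMap E fun y _ => ?_
        have := counterOfBits_fst_lt y
        rw [hE1, ← V.numIncr_eq]
        change (counterOfBits V.wit m y).1 + V.numIncr < 2 ^ b
        omega)
    refine Eq.trans ?_ h3
    rw [outState_apply, Hilb.basisMap_basisMap, Hilb.basisMap_basisMap]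
    exact congrArg (runOps infCounter V.ops) (Hilb.basisMap_congr fun y _ => rfl)
  rw [VerifierCircuit.acceptProb_eq, VerifierCircuit.acceptProb_eq, h1, h2,
    Hilb.project_basisMap (S := {p | p.2 V.out = true}) _ fun p => ?_,
    Hilb.project_basisMap (S := {p | p.2 V.out = true}) _ fun p => ?_,
    LinearIsometry.norm_map, LinearIsometry.norm_map]
  · exact Iff.rfl
  · change (layout V.anc V.wit m b t hmb p).2 (layoutQubit (b - m) t m V.out) = true ↔ _
    rw [TruncLayout.layout_layoutQubit]
    rfl

/-- On witnesses whose counter value is below `2 ^ m` the infinite counter and the truncated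
counter cannot be told apart, since `ℓ` increments do not lead out of the truncated register. -/
theorem IsTruncationCircuit.exists_acceptProb_eq {V V' : VerifierCircuit 𝒞} {m : ℕ}
    (hV : V.IsTruncationCircuit m V') :
    ∃ J : Unit × (Fin V'.wit → Bool) ↪ ℕ × (Fin V.wit → Bool),
      (∀ p : ℕ × (Fin V.wit → Bool), p.1 < 2 ^ m → ∃ y, J y = p) ∧
      ∀ v, V'.acceptProb noCounter v = V.acceptProb infCounter (Hilb.basisMap J v) := by
  obtain ⟨t, ops, rfl, hops⟩ := hV
  exact ⟨counterOfBits V.wit m, fun p hp => exists_counterOfBits hp,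
    V.acceptProb_of_layout _ (isLeast_truncBits m V.numIncr).1 ops hops⟩

/-- Soundness of the truncation. -/
theorem IsTruncationCircuit.acceptProb_le {V V' : VerifierCircuit 𝒞} {m : ℕ}
    (hV : V.IsTruncationCircuit m V') {s : ℝ}
    (hs : ∀ w, ‖w‖ = 1 → V.acceptProb infCounter w ≤ s) {v : Hilb (Unit × (Fin V'.wit → Bool))}
    (hv : ‖v‖ = 1) : V'.acceptProb noCounter v ≤ s := by
  obtain ⟨J, -, hJ⟩ := hV.exists_acceptProb_eq
  rw [hJ]
  exact hs _ (by rw [LinearIsometry.norm_map, hv])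

theorem acceptProb_nonneg {κ : Type} [DecidableEq κ] (V : VerifierCircuit 𝒞) (B : Counter κ)
    (φ : Hilb (κ × (Fin V.wit → Bool))) : 0 ≤ V.acceptProb B φ := sq_nonneg _

theorem acceptProb_sub_le {κ : Type} [DecidableEq κ] (V : VerifierCircuit 𝒞) (B : Counter κ)
    {φ χ : Hilb (κ × (Fin V.wit → Bool))} (hφ : ‖φ‖ ≤ 1) (hχ : ‖χ‖ ≤ 1) :
    V.acceptProb B φ - 2 * ‖φ - χ‖ ≤ V.acceptProb B χ := by
  rw [acceptProb_eq, acceptProb_eq]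
  set P := fun ψ => Hilb.project {p | p.2 V.out = true} (V.outState B ψ)
  have hle : ∀ ψ, ‖P ψ‖ ≤ ‖ψ‖ := fun ψ =>
    (Hilb.norm_project_le _ _).trans (LinearIsometry.norm_map _ _).le
  have h1 : ‖P φ‖ - ‖P χ‖ ≤ ‖φ - χ‖ := by
    refine (norm_sub_norm_le _ _).trans ?_
    have : P φ - P χ = P (φ - χ) := by simp only [P, map_sub, Hilb.project_sub]
    rw [this]
    exact hle _
  have h2 := (hle φ).trans hφ
  have h3 := (hle χ).trans hχ
  change ‖P φ‖ ^ 2 - 2 * ‖φ - χ‖ ≤ ‖P χ‖ ^ 2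
  nlinarith [norm_nonneg (P φ), norm_nonneg (P χ), norm_nonneg (φ - χ)]

/-- Once the counter is positive, its exact value is irrelevant. -/
theorem acceptProb_shift (V : VerifierCircuit 𝒞) (T : ℕ) {φ : Hilb (ℕ × (Fin V.wit → Bool))}
    (hφ : CounterSupp {d | T = 0 ∨ 1 ≤ d} φ) :
    V.acceptProb infCounter (Hilb.basisMap (counterMap _ (addRightEmbedding T)) φ) =
      V.acceptProb infCounter φ := by
  have h := runOps_counterMap infCounter infCounter (addRightEmbedding T)
    (fun _ => {d | T = 0 ∨ 1 ≤ d})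
    (fun k d hd => by
      have hd' : T = 0 ∨ 1 ≤ d := hd
      change d + T = 0 ↔ d = 0
      omega)
    (fun k d hd => ⟨hd, hd.imp_right fun h => h.trans (Nat.le_succ d), by
      change d + 1 + T = d + T + 1
      omega⟩)
    V.ops (Hilb.basisMap (V.inputLabel ℕ) φ) (hφ.basisMap _ fun p hp => hp)
  have h' : V.outState infCounter (Hilb.basisMap (counterMap _ (addRightEmbedding T)) φ) =
      Hilb.basisMap (counterMap _ (addRightEmbedding T)) (V.outState infCounter φ) := by
    refine Eq.trans ?_ h
    rw [outState_apply, Hilb.basisMap_basisMap, Hilb.basisMap_basisMap]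
    exact congrArg (runOps infCounter V.ops) (Hilb.basisMap_congr fun y _ => rfl)
  rw [acceptProb_eq, acceptProb_eq, h', Hilb.project_basisMap (S := {p | p.2 V.out = true}) _
    fun p => Iff.rfl, LinearIsometry.norm_map]

end VerifierCircuit

/-! ### Cutting the counter into blocks -/

/-- The position of the counter value `d` relative to blocks of length `q`, the first of which is
shortened to length `s`; the values `0` and `1` have the same position. -/
def blockPos (q s d : ℕ) : ℕ := (d - 1) + (q - s)

theorem blockPos_mod_lt_iff {q s ℓ d : ℕ} (hq : s + ℓ ≤ q) (hs : s < q) :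
    blockPos q s d % q < ℓ ↔ s ≤ (d - 1) % q ∧ (d - 1) % q < s + ℓ := by
  have h1 := Nat.mod_lt (d - 1) (by omega : 0 < q)
  have h2 : blockPos q s d = ((d - 1) % q + (q - s)) + q * ((d - 1) / q) := by
    have := Nat.mod_add_div (d - 1) q
    unfold blockPos
    omega
  rw [h2, Nat.add_mul_mod_self_left]
  by_cases h : s ≤ (d - 1) % q
  · have h3 : (d - 1) % q + (q - s) = ((d - 1) % q - s) + q := by omega
    rw [h3, Nat.add_mod_right, Nat.mod_eq_of_lt (by omega)]
    omega
  · rw [Nat.mod_eq_of_lt (by omega)]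
    omega

/-- The block from which a counter value with at most `ℓ` increments originates. -/
theorem div_eq_of_increments {q s ℓ d₀ d : ℕ} (hq : s + ℓ ≤ q) (hs : s < q)
    (hd : ¬ blockPos q s d₀ % q < ℓ) (h1 : d₀ ≤ d) (h2 : d ≤ d₀ + ℓ) :
    (d - 1 + (q - s - ℓ)) / q = blockPos q s d₀ / q := by
  have h3 := Nat.mod_add_div (blockPos q s d₀) q
  have h4 := Nat.mod_lt (blockPos q s d₀) (by omega : 0 < q)
  have h5 : blockPos q s d₀ = (d₀ - 1) + (q - s) := rfl
  refine Nat.div_eq_of_lt_le ?_ ?_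
  · rw [mul_comm]
    omega
  · rw [mul_comm, Nat.mul_succ]
    omega

/-- Among the possible positions of the cuts there is one where the state has little weight. -/
theorem exists_small_gap {w : ℕ} {N ℓ : ℕ} (hN : 2 ≤ N) (hℓ : 8 * ℓ < N)
    {φ : Hilb (ℕ × (Fin w → Bool))} (hφ : ‖φ‖ = 1) :
    ∃ s, s < N - 1 ∧ s + ℓ ≤ N - 1 ∧
      ‖Hilb.project {p | blockPos (N - 1) s p.1 % (N - 1) < ℓ} φ‖ ^ 2 ≤ 2 * (ℓ / N : ℝ) := by
  rcases Nat.eq_zero_or_pos ℓ with rfl | hpos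
  · refine ⟨0, by omega, by omega, ?_⟩
    have : Hilb.project {p : ℕ × (Fin w → Bool) | blockPos (N - 1) 0 p.1 % (N - 1) < 0} φ = 0 :=
      lp.ext (funext fun p => Hilb.project_apply_of_notMem _ (by simp))
    rw [this]
    simp
  set q := N - 1 with hqN
  -- the cuts at the multiples of `ℓ` have disjoint gaps, and there are `R` of them
  set R := q / ℓ with hR
  have hRpos : 0 < R := Nat.div_pos (by omega) hpos
  have hs : ∀ r < R, r * ℓ + ℓ ≤ q := fun r hr => by
    have h1 : (r + 1) * ℓ ≤ R * ℓ := Nat.mul_le_mul_right _ hr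
    have h2 : R * ℓ ≤ q := Nat.div_mul_le_self _ _
    rw [Nat.succ_mul] at h1
    omega
  set G : ℕ → Set (ℕ × (Fin w → Bool)) := fun r => {p | blockPos q (r * ℓ) p.1 % q < ℓ} with hG
  have hsum : ∑ r ∈ Finset.range R, ‖Hilb.project (G r) φ‖ ^ 2 ≤ ‖φ‖ ^ 2 := by
    simp only [Hilb.norm_sq]
    rw [← Summable.tsum_finsetSum fun r _ => Hilb.summable_norm_sq _]
    refine Summable.tsum_le_tsum (fun p => ?_)
      (summable_sum fun r _ => Hilb.summable_norm_sq _) (Hilb.summable_norm_sq φ)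
    -- a basis state lies in at most one of the gaps
    have hone : ∀ r ∈ Finset.range R, r ≠ ((p.1 - 1) % q) / ℓ →
        ‖Hilb.project (G r) φ p‖ ^ 2 = 0 := by
      intro r hr hne
      rw [Hilb.project_apply_of_notMem, norm_zero, zero_pow two_ne_zero]
      intro hp
      have hr' := hs r (Finset.mem_range.1 hr)
      have h := (blockPos_mod_lt_iff hr' (by omega)).1 hp
      refine hne (Nat.div_eq_of_lt_le h.1 ?_).symm
      rw [Nat.succ_mul]
      exact h.2
    by_cases hmem : ((p.1 - 1) % q) / ℓ ∈ Finset.range R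
    · rw [Finset.sum_eq_single_of_mem _ hmem hone]
      by_cases h : p ∈ G (((p.1 - 1) % q) / ℓ)
      · rw [Hilb.project_apply_of_mem _ h]
      · rw [Hilb.project_apply_of_notMem _ h]
        simp
    · rw [Finset.sum_eq_zero fun r hr => hone r hr fun h => hmem (h ▸ hr)]
      positivity
  obtain ⟨r, hr, hle⟩ : ∃ r ∈ Finset.range R, ‖Hilb.project (G r) φ‖ ^ 2 ≤ 1 / (R : ℝ) := by
    refine Finset.exists_le_of_sum_le ⟨0, Finset.mem_range.2 hRpos⟩ (hsum.trans ?_)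
    rw [Finset.sum_const, Finset.card_range, nsmul_eq_mul, hφ,
      mul_one_div_cancel (by positivity)]
    norm_num
  have hr' := hs r (Finset.mem_range.1 hr)
  refine ⟨r * ℓ, by omega, hr', hle.trans ?_⟩
  have h1 : N < 2 * (R * ℓ) := by
    have := Nat.mod_add_div q ℓ
    have h2 := Nat.mod_lt q hpos
    rw [mul_comm R ℓ, hR]
    omega
  have h2 : (N : ℝ) ≤ 2 * (R * ℓ) := by exact_mod_cast h1.le
  rw [← mul_div_assoc, div_le_div_iff₀ (by positivity) (by positivity)]
  linarith

namespace VerifierCircuit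

variable {𝒞 : GateSet}

/-- The acceptance probability is at most the sum of those of the blocks, if the blocks are
separated by gaps that `ℓ` increments do not bridge: the outputs of different blocks then have
different counter values. -/
theorem acceptProb_le_tsum_blocks (V : VerifierCircuit 𝒞) {q s : ℕ} (hs : s < q)
    (hsℓ : s + V.numIncr ≤ q) {χ : Hilb (ℕ × (Fin V.wit → Bool))}
    (hχ : CounterSupp {d | ¬ blockPos q s d % q < V.numIncr} χ) :
    ∃ g : ℕ → ℝ, HasSum g (V.acceptProb infCounter χ) ∧
      ∀ k, g k ≤ V.acceptProb infCounter (Hilb.project {p | blockPos q s p.1 / q = k} χ) := by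
  set lab : ℕ × (Fin (V.anc + V.wit) → Bool) → ℕ :=
    fun p => (p.1 - 1 + (q - s - V.numIncr)) / q with hlab
  set P := fun ψ => Hilb.project {p | p.2 V.out = true} (V.outState infCounter ψ) with hP
  set χb : ℕ → Hilb (ℕ × (Fin V.wit → Bool)) :=
    fun k => Hilb.project {p | blockPos q s p.1 / q = k} χ with hχb
  have hχb' : ∀ k, χb k = Hilb.project {p | blockPos q s p.1 / q = k} χ := fun k => rfl
  have hout : ∀ p, V.outState infCounter χ p = V.outState infCounter (χb (lab p)) p := by
    intro p
    have hsupp : CounterSupp {d | ¬ blockPos q s d % q < V.numIncr ∧ blockPos q s d / q ≠ lab p}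
        (χ - χb (lab p)) := by
      intro p' hp'
      change χ p' - χb (lab p) p' = 0
      by_cases h : p' ∈ {x : ℕ × (Fin V.wit → Bool) | blockPos q s x.1 / q = lab p}
      · rw [hχb', Hilb.project_apply_of_mem _ h, sub_self]
      · rw [hχb', Hilb.project_apply_of_notMem _ h, sub_zero]
        exact hχ p' fun h' => hp' ⟨h', h⟩
    have h := (hsupp.basisMap (V.inputLabel ℕ) fun _ h => h).runOps V.ops
    rw [← V.numIncr_eq] at h
    have h0 : V.outState infCounter (χ - χb (lab p)) p = 0 := by
      refine h p ?_
      rintro ⟨d₀, ⟨hd₀, hd₀'⟩, h1, h2⟩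
      exact hd₀' (div_eq_of_increments hsℓ hs hd₀ h1 h2).symm
    rw [map_sub] at h0
    exact sub_eq_zero.1 h0
  have hsum : HasSum (fun p => ‖P χ p‖ ^ 2) (V.acceptProb infCounter χ) := by
    rw [acceptProb_eq, Hilb.norm_sq]
    exact (Hilb.summable_norm_sq _).hasSum
  refine ⟨_, hsum.tsum_fiberwise lab, fun k => ?_⟩
  rw [acceptProb_eq, Hilb.norm_sq]
  refine le_trans (le_of_eq ?_)
    (Summable.tsum_subtype_le (fun p => ‖P (χb k) p‖ ^ 2) (lab ⁻¹' {k}) (fun p => by positivity)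
      (Hilb.summable_norm_sq _))
  refine tsum_congr fun p => ?_
  have hp : lab p = k := p.2
  simp only [hP]
  by_cases h : (p : ℕ × (Fin (V.anc + V.wit) → Bool)) ∈ {p | p.2 V.out = true}
  · rw [Hilb.project_apply_of_mem _ h, Hilb.project_apply_of_mem _ h, hout, hp]
  · rw [Hilb.project_apply_of_notMem _ h, Hilb.project_apply_of_notMem _ h]

theorem hasSum_norm_sq_blocks {w : ℕ} (q s : ℕ) (χ : Hilb (ℕ × (Fin w → Bool))) :
    HasSum (fun k => ‖Hilb.project {p | blockPos q s p.1 / q = k} χ‖ ^ 2) (‖χ‖ ^ 2) := by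
  have h := (Hilb.summable_norm_sq χ).hasSum.tsum_fiberwise fun p => blockPos q s p.1 / q
  rw [← Hilb.norm_sq] at h
  refine Eq.subst (motive := fun f => HasSum f (‖χ‖ ^ 2)) (funext fun k => ?_) h
  rw [Hilb.norm_sq, tsum_subtype ((fun p : ℕ × (Fin w → Bool) => blockPos q s p.1 / q) ⁻¹' {k})
    fun p => ‖χ p‖ ^ 2]
  refine tsum_congr fun p => Eq.symm ?_
  by_cases hp : p ∈ {x : ℕ × (Fin w → Bool) | blockPos q s x.1 / q = k}
  · rw [Hilb.project_apply_of_mem _ hp, Set.indicator_of_mem (by exact hp)]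
  · rw [Hilb.project_apply_of_notMem _ hp, Set.indicator_of_notMem (by exact hp)]
    simp

/-- A state on one block can be moved to the counter values at most `q` without changing its
acceptance probability. -/
theorem exists_shift_block (V : VerifierCircuit 𝒞) {q s k : ℕ} (hs : s < q)
    {χ : Hilb (ℕ × (Fin V.wit → Bool))} (hχ : CounterSupp {d | blockPos q s d / q = k} χ) :
    ∃ ψ : Hilb (ℕ × (Fin V.wit → Bool)), ‖ψ‖ = ‖χ‖ ∧ CounterSupp {d | d ≤ q} ψ ∧
      V.acceptProb infCounter ψ = V.acceptProb infCounter χ := by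
  have hblock : ∀ d, blockPos q s d / q = k → q * k ≤ d - 1 + (q - s) ∧
      d - 1 + (q - s) < q * k + q := fun d hd => by
    have h1 := Nat.mod_add_div (blockPos q s d) q
    have h2 := Nat.mod_lt (blockPos q s d) (by omega : 0 < q)
    rw [hd] at h1
    unfold blockPos at h1 h2
    omega
  set T := q * k - (q - s) with hT
  obtain ⟨ψ, hψ⟩ := Hilb.exists_basisMap_eq (counterMap V.wit (addRightEmbedding T)) χ
    fun p hp => by
      have h1 : blockPos q s p.1 / q = k := hχ.mem hp
      have h2 := hblock _ h1
      refine ⟨(p.1 - T, p.2), Prod.ext ?_ rfl⟩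
      change p.1 - T + T = p.1
      omega
  have hψsupp : ∀ p, ψ p ≠ 0 → blockPos q s (p.1 + T) / q = k := fun p hp => by
    have h1 : χ (counterMap V.wit (addRightEmbedding T) p) ≠ 0 := by
      rw [← hψ, Hilb.basisMap_apply]
      exact hp
    exact hχ.mem h1
  refine ⟨ψ, by rw [← hψ, LinearIsometry.norm_map], fun p hp => ?_, ?_⟩
  · by_contra hne
    have h1 := hblock _ (hψsupp p hne)
    have h2 : ¬ p.1 ≤ q := hp
    omega
  · rw [← hψ, V.acceptProb_shift]
    intro p hp
    by_contra hne
    have h1 := hblock _ (hψsupp p hne)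
    have h2 : ¬ (T = 0 ∨ 1 ≤ p.1) := hp
    omega

/-- A witness can be replaced by one with counter values below `N`, at the cost of
`O(√(ℓ / N))` in the acceptance probability. -/
theorem exists_bounded_witness (V : VerifierCircuit 𝒞) {N : ℕ} (hN : 2 ≤ N)
    (hℓ : 8 * V.numIncr < N) {φ : Hilb (ℕ × (Fin V.wit → Bool))} (hφ : ‖φ‖ = 1) :
    ∃ ψ : Hilb (ℕ × (Fin V.wit → Bool)), ‖ψ‖ = 1 ∧ CounterSupp {d | d < N} ψ ∧
      V.acceptProb infCounter φ - 4 * √((V.numIncr : ℝ) / N) ≤ V.acceptProb infCounter ψ := by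
  set C := V.acceptProb infCounter φ - 4 * √((V.numIncr : ℝ) / N) with hC
  obtain ⟨s, hs, hsℓ, hgap⟩ := exists_small_gap hN hℓ hφ
  set q := N - 1 with hq
  set S := {p : ℕ × (Fin V.wit → Bool) | blockPos q s p.1 % q < V.numIncr} with hS
  set χ := φ - Hilb.project S φ with hχ
  have hχval : ∀ p, χ p = φ p - Hilb.project S φ p := fun p => rfl
  have hχsupp : CounterSupp {d | ¬ blockPos q s d % q < V.numIncr} χ := fun p hp => by
    have hp' : p ∈ S := not_not.1 hp
    rw [hχval, Hilb.project_apply_of_mem _ hp', sub_self]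
  have hχnorm : ‖χ‖ ≤ 1 := by
    have : χ = Hilb.project Sᶜ φ := lp.ext (funext fun p => by
      by_cases hp : p ∈ S
      · rw [hχval, Hilb.project_apply_of_mem _ hp,
          Hilb.project_apply_of_notMem _ (Set.notMem_compl_iff.2 hp), sub_self]
      · rw [hχval, Hilb.project_apply_of_notMem _ hp, Hilb.project_apply_of_mem _ hp, sub_zero])
    rw [this, ← hφ]
    exact Hilb.norm_project_le _ _
  have hCχ : C ≤ V.acceptProb infCounter χ := by
    refine le_trans ?_ (V.acceptProb_sub_le infCounter hφ.le hχnorm)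
    have h1 : φ - χ = Hilb.project S φ := by rw [hχ, sub_sub_cancel]
    have h2 : ‖Hilb.project S φ‖ ≤ 2 * √((V.numIncr : ℝ) / N) := by
      refine le_of_sq_le_sq ?_ (by positivity)
      rw [mul_pow, Real.sq_sqrt (by positivity)]
      have : (0 : ℝ) ≤ (V.numIncr : ℝ) / N := by positivity
      linarith
    rw [h1, hC]
    linarith
  -- it is enough to find a block with at least average acceptance probability
  suffices h : ∃ k, Hilb.project {p | blockPos q s p.1 / q = k} χ ≠ 0 ∧
      C * ‖Hilb.project {p | blockPos q s p.1 / q = k} χ‖ ^ 2 ≤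
        V.acceptProb infCounter (Hilb.project {p | blockPos q s p.1 / q = k} χ) by
    obtain ⟨k, hne, hk⟩ := h
    obtain ⟨ψ, hψn, hψs, hψa⟩ := V.exists_shift_block (k := k) hs
      (χ := Hilb.project {p | blockPos q s p.1 / q = k} χ)
      (by intro p hp; exact Hilb.project_apply_of_notMem _ hp)
    have hn : 0 < ‖ψ‖ := by rw [hψn]; exact norm_pos_iff.2 hne
    refine ⟨((‖ψ‖⁻¹ : ℝ) : ℂ) • ψ, ?_, fun p hp => ?_, ?_⟩
    · rw [norm_smul, Complex.norm_real, norm_inv, norm_norm, inv_mul_cancel₀ hn.ne']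
    · have hpq : ¬ p.1 ≤ q := fun h => hp (show p.1 < N by omega)
      rw [lp.coeFn_smul, Pi.smul_apply, hψs p hpq, smul_zero]
    · rw [acceptProb_smul, hψa, Complex.norm_real, norm_inv, norm_norm, inv_pow,
        ← div_eq_inv_mul, le_div_iff₀ (by positivity), hψn]
      exact hk
  have hblocks := hasSum_norm_sq_blocks q s χ
  obtain ⟨g, hg, hgle⟩ := V.acceptProb_le_tsum_blocks hs hsℓ hχsupp
  -- the gaps do not carry the whole state, so that some block is nonzero
  have hzero : ∃ k, Hilb.project {p | blockPos q s p.1 / q = k} χ ≠ 0 := by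
    by_contra! h0
    simp only [h0, norm_zero, zero_pow two_ne_zero] at hblocks
    have h1 : ‖χ‖ ^ 2 = 0 := hblocks.unique hasSum_zero
    have h2 : χ = 0 := by simpa using h1
    have h3 : φ = Hilb.project S φ := sub_eq_zero.1 h2
    rw [← h3, hφ] at hgap
    have h4 : (8 * V.numIncr : ℝ) < N := by exact_mod_cast hℓ
    have h5 : (V.numIncr / N : ℝ) ≤ 1 / 8 := by
      rw [div_le_div_iff₀ (by positivity) (by norm_num)]
      linarith
    linarith
  -- if all nonzero blocks were below average, `χ` would be accepted with probability less than
  -- `C * ‖χ‖ ^ 2`; this is impossible, because `C` is at most that probability and `‖χ‖ ≤ 1`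
  by_contra! hcon
  obtain ⟨k, hk⟩ := hzero
  have hlt := hasSum_lt (f := g)
    (g := fun k => C * ‖Hilb.project {p | blockPos q s p.1 / q = k} χ‖ ^ 2) (i := k)
    (fun j => by
      by_cases hj : Hilb.project {p | blockPos q s p.1 / q = j} χ = 0
      · have := hgle j
        beta_reduce
        rw [hj] at this ⊢
        simpa [acceptProb_eq, Hilb.project_zero] using this
      · exact (hgle j).trans (hcon j hj).le)
    ((hgle k).trans_lt (hcon k hk)) hg (hblocks.mul_left C)
  have h0 := V.acceptProb_nonneg infCounter χ
  nlinarith [norm_nonneg χ, pow_le_one₀ (n := 2) (norm_nonneg χ) hχnorm, sq_nonneg ‖χ‖]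

/-- Completeness of the truncation. -/
theorem IsTruncationCircuit.exists_le_acceptProb {V V' : VerifierCircuit 𝒞} {m : ℕ}
    (hV : V.IsTruncationCircuit m V') (hm : 0 < m) (hℓ : 8 * V.numIncr < 2 ^ m)
    {w : Hilb (ℕ × (Fin V.wit → Bool))} (hw : ‖w‖ = 1) :
    ∃ v, ‖v‖ = 1 ∧
      V.acceptProb infCounter w - 4 * √((V.numIncr : ℝ) / 2 ^ m) ≤ V'.acceptProb noCounter v := by
  obtain ⟨J, hJ, hacc⟩ := hV.exists_acceptProb_eq
  obtain ⟨ψ, hψ, hsupp, hle⟩ := V.exists_bounded_witness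
    (Nat.le_self_pow hm.ne' 2) hℓ hw
  obtain ⟨v, rfl⟩ := Hilb.exists_basisMap_eq J ψ fun p hp => hJ p (hsupp.mem hp)
  refine ⟨v, by rw [← hψ, LinearIsometry.norm_map], ?_⟩
  rw [hacc]
  simpa using hle

end VerifierCircuit

/-! ### Program fragments for stack machines -/

namespace StackProgram

open Turing Turing.TM2

section Fragment

variable {K : Type} [DecidableEq K] {Γ : K → Type} {τ : Type}

/-- Relabelling of the jumps in a statement. -/
def mapLabel {σ Λ Λ' : Type} (f : Λ → Λ') : Stmt Γ Λ σ → Stmt Γ Λ' σ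
  | .push k g q => .push k g (mapLabel f q)
  | .peek k g q => .peek k g (mapLabel f q)
  | .pop k g q => .pop k g (mapLabel f q)
  | .load g q => .load g (mapLabel f q)
  | .branch g q₁ q₂ => .branch g (mapLabel f q₁) (mapLabel f q₂)
  | .goto l => .goto fun v => f (l v)
  | .halt => .halt

/-- Relabelling of a configuration. -/
def mapCfg {σ Λ Λ' : Type} (f : Λ → Λ') (c : Cfg Γ Λ σ) : Cfg Γ Λ' σ :=
  ⟨c.l.map f, c.var, c.stk⟩

theorem stepAux_mapLabel {σ Λ Λ' : Type} (f : Λ → Λ') (q : Stmt Γ Λ σ) (v : σ)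
    (S : ∀ k, List (Γ k)) : stepAux (mapLabel f q) v S = mapCfg f (stepAux q v S) := by
  induction q generalizing v S with
  | push k g q ih => exact ih _ _
  | peek k g q ih => exact ih _ _
  | pop k g q ih => exact ih _ _
  | load g q ih => exact ih _ _
  | branch g q₁ q₂ ih₁ ih₂ =>
    simp only [mapLabel, stepAux]
    cases g v
    · exact ih₂ _ _
    · exact ih₁ _ _
  | goto l => rfl
  | halt => rfl

variable (Γ τ) in
/-- A piece of a program for a machine with stacks `Γ`, with one entry point and one exit, the
label `none`. The internal state consists of a register, which holds a symbol read from a stack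
and is empty at the entry and at the exit, and of a part in `τ`. -/
structure Fragment where
  Λ : Type
  [fin : Fintype Λ]
  entry : Λ
  code : Λ → Stmt Γ (Option Λ) (Option Bool × τ)

attribute [instance] Fragment.fin

/-- `n` steps of a fragment, none of them from its exit. -/
inductive Fragment.Steps (F : Fragment Γ τ) :
    ℕ → Cfg Γ (Option F.Λ) (Option Bool × τ) → Cfg Γ (Option F.Λ) (Option Bool × τ) → Prop
  | refl (c) : F.Steps 0 c c
  | step {n l v S c} (h : F.Steps n (stepAux (F.code l) v S) c) :
      F.Steps (n + 1) ⟨some (some l), v, S⟩ c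

theorem Fragment.Steps.trans {F : Fragment Γ τ} {n₁ n₂ c₁ c₂ c₃} (h₁ : F.Steps n₁ c₁ c₂)
    (h₂ : F.Steps n₂ c₂ c₃) : F.Steps (n₁ + n₂) c₁ c₃ := by
  induction h₁ with
  | refl c => rwa [Nat.zero_add]
  | step h ih =>
    rw [Nat.add_right_comm]
    exact (ih h₂).step

/-- A fragment that is contained in another one. -/
theorem Fragment.Steps.map {F G : Fragment Γ τ} {e : Option F.Λ → Option G.Λ} {g : F.Λ → G.Λ}
    (he : ∀ l, e (some l) = some (g l)) (hg : ∀ l, G.code (g l) = mapLabel e (F.code l))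
    {n c c'} (h : F.Steps n c c') : G.Steps n (mapCfg e c) (mapCfg e c') := by
  induction h with
  | refl c => exact .refl _
  | @step n l v S c h ih =>
    have h1 : (mapCfg e ⟨some (some l), v, S⟩ : Cfg Γ (Option G.Λ) (Option Bool × τ)) =
        ⟨some (some (g l)), v, S⟩ := by simp [mapCfg, he]
    rw [h1]
    refine .step ?_
    rwa [hg, stepAux_mapLabel]

/-- The fragment leads from its entry to its exit in at most `t` steps. -/
def Fragment.Exec (F : Fragment Γ τ) (t : ℕ) (c c' : τ × ∀ k, List (Γ k)) : Prop :=
  ∃ n ≤ t, F.Steps n ⟨some (some F.entry), (none, c.1), c.2⟩ ⟨some none, (none, c'.1), c'.2⟩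

theorem Fragment.Exec.mono {F : Fragment Γ τ} {t t' : ℕ} {c c'} (h : F.Exec t c c')
    (ht : t ≤ t') : F.Exec t' c c' :=
  let ⟨n, hn, h⟩ := h
  ⟨n, hn.trans ht, h⟩

/-- The fragment that does nothing. -/
def Fragment.skip : Fragment Γ τ where
  Λ := Unit
  entry := ()
  code _ := .goto fun _ => none

theorem Fragment.exec_skip (c : τ × ∀ k, List (Γ k)) : Fragment.skip.Exec 1 c c :=
  ⟨1, le_rfl, .step (.refl _)⟩

/-- Push a symbol. -/
def Fragment.push (k : K) (a : Γ k) : Fragment Γ τ where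
  Λ := Unit
  entry := ()
  code _ := .push k (fun _ => a) (.goto fun _ => none)

theorem Fragment.exec_push (k : K) (a : Γ k) (c : τ × ∀ k, List (Γ k)) :
    (Fragment.push k a).Exec 1 c (c.1, Function.update c.2 k (a :: c.2 k)) :=
  ⟨1, le_rfl, .step (.refl _)⟩

/-- Sequential composition. -/
def Fragment.seq (F G : Fragment Γ τ) : Fragment Γ τ where
  Λ := F.Λ ⊕ G.Λ
  entry := .inl F.entry
  code
    | .inl l => mapLabel (fun o => some (o.elim (.inr G.entry) .inl)) (F.code l)
    | .inr l => mapLabel (Option.map .inr) (G.code l)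

theorem Fragment.Exec.seq {F G : Fragment Γ τ} {t₁ t₂ : ℕ} {c₁ c₂ c₃} (h₁ : F.Exec t₁ c₁ c₂)
    (h₂ : G.Exec t₂ c₂ c₃) : (F.seq G).Exec (t₁ + t₂) c₁ c₃ := by
  obtain ⟨n₁, hn₁, h₁⟩ := h₁
  obtain ⟨n₂, hn₂, h₂⟩ := h₂
  have k₁ := h₁.map (G := F.seq G) (e := fun o => some (o.elim (.inr G.entry) .inl)) (g := .inl)
    (fun l => rfl) (fun l => rfl)
  have k₂ := h₂.map (G := F.seq G) (e := Option.map .inr) (g := .inr)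
    (fun l => rfl) (fun l => rfl)
  exact ⟨n₁ + n₂, Nat.add_le_add hn₁ hn₂, k₁.trans k₂⟩

/-- Pop a symbol from the stack `k` and continue according to the result; where `again` says so,
repeat. -/
def Fragment.popLoop (k : K) (dec : Γ k → Bool) (body : Option Bool → Fragment Γ τ)
    (again : Option Bool → Bool) : Fragment Γ τ where
  Λ := Option (Σ s, (body s).Λ)
  entry := none
  code
    | none => .pop k (fun v s => (s.map dec, v.2)) <|
        .branch (fun v => v.1 == none) (.goto fun _ => some (some ⟨none, (body none).entry⟩)) <|
        .branch (fun v => v.1 == some true)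
          (.load (fun v => (none, v.2))
            (.goto fun _ => some (some ⟨some true, (body (some true)).entry⟩)))
          (.load (fun v => (none, v.2))
            (.goto fun _ => some (some ⟨some false, (body (some false)).entry⟩)))
    | some l => mapLabel (fun o => o.elim (bif again l.1 then some none else none)
        fun l' => some (some ⟨l.1, l'⟩)) ((body l.1).code l.2)

variable {k : K} {dec : Γ k → Bool} {body : Option Bool → Fragment Γ τ}
  {again : Option Bool → Bool}

theorem Fragment.steps_popLoop {t : ℕ} {c c' : τ × ∀ k, List (Γ k)}
    (h : (body ((c.2 k).head?.map dec)).Exec t (c.1, Function.update c.2 k (c.2 k).tail) c') :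
    ∃ n ≤ t + 1, (Fragment.popLoop k dec body again).Steps n
      ⟨some (some none), (none, c.1), c.2⟩
      ⟨some (bif again ((c.2 k).head?.map dec) then some none else none), (none, c'.1), c'.2⟩ := by
  obtain ⟨n, hn, h⟩ := h
  set s := (c.2 k).head?.map dec with hs
  have h1 := h.map (G := Fragment.popLoop k dec body again)
    (e := fun o => o.elim (bif again s then some none else none) fun l' => some (some ⟨s, l'⟩))
    (g := fun l => some ⟨s, l⟩) (fun l => rfl) (fun l => rfl)
  refine ⟨n + 1, Nat.succ_le_succ hn, .step ?_⟩
  have h2 : stepAux ((Fragment.popLoop k dec body again).code none) (none, c.1) c.2 =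
      ⟨some (some (some ⟨s, (body s).entry⟩)), (none, c.1),
        Function.update c.2 k (c.2 k).tail⟩ := by
    simp only [Fragment.popLoop, stepAux, ← hs]
    rcases s with _ | _ | _ <;> rfl
  rw [h2]
  exact h1

/-- The last round of the loop. -/
theorem Fragment.Exec.popLoop_exit {t : ℕ} {c c' : τ × ∀ k, List (Γ k)} {s : Option Bool}
    (hs : (c.2 k).head?.map dec = s)
    (h : (body s).Exec t (c.1, Function.update c.2 k (c.2 k).tail) c') (hagain : again s = false) :
    (Fragment.popLoop k dec body again).Exec (t + 1) c c' := by
  subst hs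
  obtain ⟨n, hn, h⟩ := Fragment.steps_popLoop (again := again) h
  rw [hagain] at h
  exact ⟨n, hn, h⟩

/-- A round of the loop that is not the last one. -/
theorem Fragment.Exec.popLoop_again {t t' : ℕ} {c c' c'' : τ × ∀ k, List (Γ k)} {s : Option Bool}
    (hs : (c.2 k).head?.map dec = s)
    (h : (body s).Exec t (c.1, Function.update c.2 k (c.2 k).tail) c') (hagain : again s = true)
    (h' : (Fragment.popLoop k dec body again).Exec t' c' c'') :
    (Fragment.popLoop k dec body again).Exec (t + 1 + t') c c'' := by
  subst hs
  obtain ⟨n, hn, h⟩ := Fragment.steps_popLoop (again := again) h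
  rw [hagain] at h
  obtain ⟨n', hn', h'⟩ := h'
  exact ⟨n + n', Nat.add_le_add hn hn', h.trans h'⟩

/-- Move the content of the stack `k` to the stack `k'`, which reverses it. -/
def Fragment.transfer (k : K) (dec : Γ k → Bool) (k' : K) (enc : Bool → Γ k') : Fragment Γ τ :=
  .popLoop k dec (fun s => s.elim .skip fun b => .push k' (enc b)) Option.isSome

theorem Fragment.exec_transfer {k' : K} (hk : k' ≠ k) (dec : Γ k → Bool) (enc : Bool → Γ k')
    (c : τ × ∀ k, List (Γ k)) {l : List (Γ k)} (hl : c.2 k = l) :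
    (Fragment.transfer k dec k' enc).Exec (2 * l.length + 2) c
      (c.1, Function.update (Function.update c.2 k []) k'
        ((l.map (enc ∘ dec)).reverse ++ c.2 k')) := by
  induction l generalizing c with
  | nil =>
    have h := Fragment.Exec.popLoop_exit (dec := dec) (c := c) (again := Option.isSome)
      (body := fun s => s.elim .skip fun b => .push k' (enc b)) (s := none) (by rw [hl]; rfl)
      (Fragment.exec_skip _) rfl
    have h1 : Function.update (Function.update c.2 k []) k'
        ((([] : List (Γ k)).map (enc ∘ dec)).reverse ++ c.2 k') =
          Function.update c.2 k (c.2 k).tail := by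
      rw [hl]
      refine Function.update_eq_self_iff.2 ?_
      simp [Function.update_of_ne hk]
    rw [h1]
    exact h.mono (by simp)
  | cons a l ih =>
    have h := Fragment.exec_push k' (enc (dec a)) (τ := τ) (Γ := Γ)
      (c.1, Function.update c.2 k (c.2 k).tail)
    have h2 := Fragment.Exec.popLoop_again (dec := dec) (c := c) (again := Option.isSome)
      (body := fun s => s.elim .skip fun b => .push k' (enc b)) (s := some (dec a))
      (by rw [hl]; rfl) h rfl (ih _ (by simp [Function.update_of_ne hk.symm, hl]))
    have h1 : Function.update (Function.update c.2 k []) k'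
        (((a :: l).map (enc ∘ dec)).reverse ++ c.2 k') =
          Function.update (Function.update (Function.update (Function.update c.2 k (c.2 k).tail) k'
            (enc (dec a) :: (Function.update c.2 k (c.2 k).tail) k')) k []) k'
            ((l.map (enc ∘ dec)).reverse ++ Function.update (Function.update c.2 k (c.2 k).tail) k'
            (enc (dec a) :: (Function.update c.2 k (c.2 k).tail) k') k') := by
      funext i
      by_cases hi : i = k'
      · subst hi
        simp [Function.update_of_ne hk]
      · by_cases hi' : i = k
        · subst hi'
          simp [Function.update_of_ne hi]
        · simp [Function.update_of_ne hi, Function.update_of_ne hi']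
    rw [h1]
    exact h2.mono (by simp only [List.length_cons]; omega)

end Fragment

end StackProgram

/-! ### Machines as subroutines -/

namespace StackProgram

open Turing Turing.TM2

attribute [local instance] FinTM2.kFin FinTM2.ΛFin FinTM2.σFin

section Machine

variable {ι : Type} (M : ι → FinTM2) (O : Type)

/-- The stacks of a program that calls the machines `M i`: its own ones, which hold bits, and
those of all the machines. -/
abbrev Stack : Type := O ⊕ Σ i, (M i).K

/-- The alphabets of the stacks. -/
abbrev Alphabet : Stack M O → Type
  | .inl _ => Bool
  | .inr p => (M p.1).Γ p.2

/-- The internal states of all the machines. -/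
abbrev States : Type := ∀ i, (M i).σ

/-- The initial states of all the machines. -/
abbrev initialStates : States M := fun i => (M i).initialState

variable {M O}

/-- The contents of all stacks. -/
def contents (E : O → List Bool) (R : ∀ i k, List ((M i).Γ k)) :
    ∀ k, List (Alphabet M O k)
  | .inl o => E o
  | .inr p => R p.1 p.2

@[simp] theorem contents_inl (E : O → List Bool) (R : ∀ i k, List ((M i).Γ k)) (o : O) :
    contents E R (.inl o) = E o := rfl

variable [DecidableEq ι] [DecidableEq O]

@[simp] theorem update_contents_inl (E : O → List Bool) (R : ∀ i k, List ((M i).Γ k)) (o : O)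
    (l : List Bool) :
    Function.update (contents E R) (.inl o) l = contents (Function.update E o l) R := by
  funext k
  rcases k with o' | p
  · by_cases h : o' = o
    · subst h; simp
    · simp [h]
  · simp [contents]

theorem update_contents_inr (E : O → List Bool) (R : ∀ i k, List ((M i).Γ k)) (i : ι)
    (T : ∀ k, List ((M i).Γ k)) (k : (M i).K) (l : List ((M i).Γ k)) :
    Function.update (contents E (Function.update R i T)) (.inr ⟨i, k⟩) l =
      contents E (Function.update R i (Function.update T k l)) := by
  funext k'
  rcases k' with o | ⟨j, k'⟩
  · simp
  · by_cases h : j = i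
    · subst h
      by_cases h' : k' = k
      · subst h'; simp [contents]
      · simp [contents, h']
    · simp [contents, h]

/-- A statement of the machine `M i`, acting on the stacks and the internal state of `M i`
within a larger program. -/
def translate (i : ι) : Stmt (M i).Γ (M i).Λ (M i).σ →
    Stmt (Alphabet M O) (Option (M i).Λ) (Option Bool × States M)
  | .push k g q => .push (.inr ⟨i, k⟩) (fun v => g (v.2 i)) (translate i q)
  | .peek k g q => .peek (.inr ⟨i, k⟩)
      (fun v s => (v.1, Function.update v.2 i (g (v.2 i) s))) (translate i q)
  | .pop k g q => .pop (.inr ⟨i, k⟩)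
      (fun v s => (v.1, Function.update v.2 i (g (v.2 i) s))) (translate i q)
  | .load g q => .load (fun v => (v.1, Function.update v.2 i (g (v.2 i)))) (translate i q)
  | .branch g q₁ q₂ => .branch (fun v => g (v.2 i)) (translate i q₁) (translate i q₂)
  | .goto l => .goto fun v => some (l (v.2 i))
  | .halt => .goto fun _ => none

/-- A configuration of the machine `M i` within a larger program. -/
def embedCfg (E : O → List Bool) (v : States M) (R : ∀ i k, List ((M i).Γ k)) (i : ι)
    (c : Cfg (M i).Γ (M i).Λ (M i).σ) :
    Cfg (Alphabet M O) (Option (M i).Λ) (Option Bool × States M) :=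
  ⟨some c.l, (none, Function.update v i c.var), contents E (Function.update R i c.stk)⟩

theorem stepAux_translate (E : O → List Bool) (v : States M) (R : ∀ i k, List ((M i).Γ k))
    (i : ι) (q : Stmt (M i).Γ (M i).Λ (M i).σ) (s : (M i).σ) (T : ∀ k, List ((M i).Γ k)) :
    stepAux (translate i q) (none, Function.update v i s) (contents E (Function.update R i T)) =
      embedCfg E v R i (stepAux q s T) := by
  have hT : ∀ (T : ∀ k, List ((M i).Γ k)) (k : (M i).K),
      contents E (Function.update R i T) (.inr ⟨i, k⟩) = T k := fun T k => by simp [contents]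
  induction q generalizing s T with
  | push k g q ih =>
    simp only [translate, stepAux, Function.update_self]
    rw [hT, update_contents_inr, ih]
  | peek k g q ih =>
    simp only [translate, stepAux, Function.update_self, Function.update_idem]
    rw [hT, ih]
  | pop k g q ih =>
    simp only [translate, stepAux, Function.update_self, Function.update_idem]
    rw [hT, update_contents_inr, ih]
  | load g q ih =>
    simp only [translate, stepAux, Function.update_self, Function.update_idem]
    rw [ih]
  | branch g q₁ q₂ ih₁ ih₂ =>
    simp only [translate, stepAux, Function.update_self]
    cases g s
    · exact ih₂ _ _
    · exact ih₁ _ _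
  | goto l => simp [translate, stepAux, embedCfg]
  | halt => simp [translate, stepAux, embedCfg]

/-- Run the machine `M i` until it halts. -/
def Fragment.call (i : ι) : Fragment (Alphabet M O) (States M) where
  Λ := (M i).Λ
  entry := (M i).main
  code l := translate i ((M i).m l)

theorem Fragment.steps_call (E : O → List Bool) (v : States M) (R : ∀ i k, List ((M i).Γ k))
    (i : ι) {n : ℕ} {c c' : (M i).Cfg} (hc' : c'.l = none)
    (h : (flip bind (M i).step)^[n] (some c) = some c') :
    (Fragment.call i).Steps n (embedCfg E v R i c) (embedCfg E v R i c') := by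
  induction n generalizing c with
  | zero =>
    obtain rfl : c = c' := by simpa using h
    exact .refl _
  | succ n ih =>
    rw [Function.iterate_succ_apply] at h
    obtain ⟨l, s, T⟩ := c
    cases l with
    | none =>
      have h1 : ∀ n, (flip bind (M i).step)^[n] none = none := fun n => by
        induction n with
        | zero => rfl
        | succ n ih => rw [Function.iterate_succ_apply]; exact ih
      have h2 : flip bind (M i).step (some (⟨none, s, T⟩ : (M i).Cfg)) = none := rfl
      rw [h2, h1] at h
      simp at h
    | some l =>
      have h2 : flip bind (M i).step (some (⟨some l, s, T⟩ : (M i).Cfg)) =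
          some (stepAux ((M i).m l) s T) := rfl
      rw [h2] at h
      refine .step ?_
      have h3 := ih h
      rw [← stepAux_translate] at h3
      exact h3

theorem stk_initList (tm : FinTM2) (s : List (tm.Γ tm.k₀)) :
    (initList tm s).stk = Function.update (fun _ => []) tm.k₀ s := by
  funext k
  by_cases h : k = tm.k₀
  · subst h; simp [initList]
  · simp [initList, h]

theorem stk_haltList (tm : FinTM2) (s : List (tm.Γ tm.k₁)) :
    (haltList tm s).stk = Function.update (fun _ => []) tm.k₁ s := by
  funext k
  by_cases h : k = tm.k₁
  · subst h; simp [haltList]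
  · simp [haltList, h]

/-- The fragment takes its own stacks from `E` to `E'` in at most `t` steps, the machines being
in their initial states with empty stacks before and after. -/
def Fragment.Run (F : Fragment (Alphabet M O) (States M)) (t : ℕ) (E E' : O → List Bool) : Prop :=
  F.Exec t (initialStates M, contents E fun _ _ => []) (initialStates M, contents E' fun _ _ => [])

theorem Fragment.Run.mono {F : Fragment (Alphabet M O) (States M)} {t t' : ℕ}
    {E E' : O → List Bool} (h : F.Run t E E') (ht : t ≤ t') : F.Run t' E E' :=
  Fragment.Exec.mono h ht

theorem Fragment.run_skip (E : O → List Bool) :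
    (Fragment.skip : Fragment (Alphabet M O) (States M)).Run 1 E E :=
  Fragment.exec_skip _

/-- Push a bit on one of the program's own stacks. -/
def Fragment.write (o : O) (b : Bool) : Fragment (Alphabet M O) (States M) :=
  .push (.inl o) b

theorem Fragment.run_write (o : O) (b : Bool) (E : O → List Bool) :
    (Fragment.write o b : Fragment (Alphabet M O) (States M)).Run 1 E
      (Function.update E o (b :: E o)) := by
  have h := Fragment.exec_push (K := Stack M O) (.inl o) b
    (initialStates M, contents E fun _ _ => [])
  rwa [update_contents_inl] at h

theorem Fragment.Run.seq {F G : Fragment (Alphabet M O) (States M)} {t₁ t₂ : ℕ}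
    {E₁ E₂ E₃ : O → List Bool} (h₁ : F.Run t₁ E₁ E₂) (h₂ : G.Run t₂ E₂ E₃) :
    (F.seq G).Run (t₁ + t₂) E₁ E₃ :=
  Fragment.Exec.seq h₁ h₂

/-- Pop a bit from one of the program's own stacks and continue according to the result; where
`again` says so, repeat. -/
def Fragment.loop (o : O) (body : Option Bool → Fragment (Alphabet M O) (States M))
    (again : Option Bool → Bool) : Fragment (Alphabet M O) (States M) :=
  .popLoop (.inl o) id body again

section Loop

variable {o : O} {body : Option Bool → Fragment (Alphabet M O) (States M)}
  {again : Option Bool → Bool}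

theorem Fragment.Run.loop_exit {t : ℕ} {E E' : O → List Bool} (s : Option Bool)
    (hs : (E o).head? = s) (h : (body s).Run t (Function.update E o (E o).tail) E')
    (hagain : again s = false) : (Fragment.loop o body again).Run (t + 1) E E' := by
  refine Fragment.Exec.popLoop_exit (s := s) (by simpa using hs) ?_ hagain
  dsimp only
  rwa [contents_inl, update_contents_inl]

theorem Fragment.Run.loop_again {t t' : ℕ} {E E' E'' : O → List Bool} (s : Option Bool)
    (hs : (E o).head? = s) (h : (body s).Run t (Function.update E o (E o).tail) E')
    (hagain : again s = true) (h' : (Fragment.loop o body again).Run t' E' E'') :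
    (Fragment.loop o body again).Run (t + 1 + t') E E'' := by
  refine Fragment.Exec.popLoop_again (s := s) (by simpa using hs) ?_ hagain h'
  dsimp only
  rwa [contents_inl, update_contents_inl]

end Loop

/-- Move the content of one of the program's own stacks to another one, which reverses it. -/
def Fragment.move (o o' : O) : Fragment (Alphabet M O) (States M) :=
  .transfer (.inl o) id (.inl o') id

theorem Fragment.run_move {o o' : O} (h : o' ≠ o) (E : O → List Bool) :
    (Fragment.move o o' : Fragment (Alphabet M O) (States M)).Run (2 * (E o).length + 2) E
      (Function.update (Function.update E o []) o' ((E o).reverse ++ E o')) := by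
  have h1 := Fragment.exec_transfer (K := Stack M O) (Γ := Alphabet M O) (k := .inl o)
    (k' := .inl o') (by simpa using h) id id
    (initialStates M, contents E fun _ _ => []) rfl
  simp only [update_contents_inl, Function.comp_id, List.map_id, contents_inl] at h1
  exact h1

/-- Run the machine `M i` on the reverse of the content of the stack `o`, and put the reverse of
its output on the stack `o'`. -/
def Fragment.evaluate (i : ι) (o o' : O) (enc : Bool → (M i).Γ (M i).k₀)
    (dec : (M i).Γ (M i).k₁ → Bool) : Fragment (Alphabet M O) (States M) :=
  .seq (.transfer (.inl o) id (.inr ⟨i, (M i).k₀⟩) enc)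
    (.seq (.call i) (.transfer (.inr ⟨i, (M i).k₁⟩) dec (.inl o') id))

theorem Fragment.run_evaluate (i : ι) (o o' : O) {enc : Bool → (M i).Γ (M i).k₀}
    {dec : (M i).Γ (M i).k₁ → Bool} {l l' : List Bool} {r : List ((M i).Γ (M i).k₁)}
    (hr : r.map dec = l') {t : ℕ}
    (hM : TM2OutputsInTime (M i) (l.map enc) (some r) t) {E : O → List Bool}
    (hl : E o = l.reverse) :
    (Fragment.evaluate i o o' enc dec).Run (2 * l.length + 2 + (t + (2 * l'.length + 2))) E
      (Function.update (Function.update E o []) o' (l'.reverse ++ Function.update E o [] o')) := by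
  subst hr
  have hid : ∀ T : ∀ k, List ((M i).Γ k), (T = fun _ => []) →
      Function.update (fun j (k : (M j).K) => ([] : List ((M j).Γ k))) i T = fun _ _ => [] := by
    rintro T rfl
    exact Function.update_eq_self_iff.2 rfl
  refine Fragment.Exec.seq (c₂ := (initialStates M, contents (Function.update E o [])
      (Function.update (fun _ _ => []) i (initList (M i) (l.map enc)).stk))) ?_
    (Fragment.Exec.seq (c₂ := (initialStates M, contents (Function.update E o [])
      (Function.update (fun _ _ => []) i (haltList (M i) r).stk))) ?_ ?_)
  · have h1 := Fragment.exec_transfer (K := Stack M O) (Γ := Alphabet M O) (k := .inl o)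
      (k' := .inr ⟨i, (M i).k₀⟩) (by simp) id enc
      (initialStates M, contents E fun _ _ => []) rfl
    simp only [contents_inl, hl, List.length_reverse] at h1
    rw [update_contents_inl, ← hid _ rfl, update_contents_inr] at h1
    have h2 : contents E (Function.update (fun j (k : (M j).K) => ([] : List ((M j).Γ k))) i
      fun _ => []) (.inr ⟨i, (M i).k₀⟩) = [] := by simp [contents]
    rw [h2] at h1
    rw [stk_initList]
    rw [hid _ rfl] at h1
    simpa using h1
  · obtain ⟨⟨n, hn⟩, hnt⟩ := hM
    refine ⟨n, hnt, ?_⟩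
    have h1 := Fragment.steps_call (Function.update E o []) (initialStates M) (fun _ _ => []) i
      (c' := haltList (M i) r) rfl hn
    have h2 : Function.update (initialStates M) i (M i).initialState = initialStates M :=
      Function.update_eq_self_iff.2 rfl
    change (Fragment.call i).Steps n
      ⟨_, (none, Function.update (initialStates M) i (M i).initialState), _⟩
      ⟨_, (none, Function.update (initialStates M) i (M i).initialState), _⟩ at h1
    rw [h2] at h1
    exact h1
  · have h1 := Fragment.exec_transfer (K := Stack M O) (Γ := Alphabet M O)
      (k := .inr ⟨i, (M i).k₁⟩) (k' := .inl o') (by simp) dec id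
      (initialStates M, contents (Function.update E o [])
        (Function.update (fun _ _ => []) i (haltList (M i) r).stk))
      (l := r) (by simp [contents, stk_haltList])
    simp only [contents_inl, update_contents_inl, update_contents_inr, stk_haltList] at h1
    rw [hid (Function.update (Function.update _ _ _) _ _) (by simp)] at h1
    rw [stk_haltList]
    simpa using h1

section Computer

variable [Fintype ι] [Fintype O]

/-- The machine that runs the fragment once and halts. -/
def Fragment.toFinTM2 (F : Fragment (Alphabet M O) (States M)) (input output : O) : FinTM2 where
  K := Stack M O
  k₀ := .inl input
  k₁ := .inl output
  Γ := Alphabet M O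
  Λ := Option F.Λ
  main := some F.entry
  σ := Option Bool × States M
  initialState := (none, initialStates M)
  Γk₀Fin := inferInstanceAs (Fintype Bool)
  m
    | none => .halt
    | some l => F.code l

theorem Fragment.Steps.iterate {F : Fragment (Alphabet M O) (States M)} (input output : O)
    {n : ℕ} {c c'} (h : F.Steps n c c') :
    (flip bind (F.toFinTM2 input output).step)^[n] (some c) = some c' := by
  induction h with
  | refl c => rfl
  | step h ih =>
    rw [Function.iterate_succ_apply]
    exact ih

/-- A run of the fragment from the input to the output is a computation of the machine. -/
theorem Fragment.Run.outputsInTime {F : Fragment (Alphabet M O) (States M)} {input output : O}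
    {t : ℕ} {x y : List Bool}
    (h : F.Run t (Function.update (fun _ => []) input x)
      (Function.update (fun _ => []) output y)) :
    Nonempty (TM2OutputsInTime (F.toFinTM2 input output) x (some y) (t + 1)) := by
  obtain ⟨n, hn, h1⟩ := h
  have key : ∀ (o : O) (z : List Bool),
      contents (Function.update (fun _ => []) o z) (fun (i : ι) (k : (M i).K) => []) =
        Function.update (fun k : Stack M O => ([] : List (Alphabet M O k))) (Sum.inl o) z :=
      fun o z => by
    rw [← update_contents_inl]
    congr 1
    funext k
    rcases k with o | p <;> rfl
  have h2 : initList (F.toFinTM2 input output) x = ⟨some (some F.entry),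
      (none, initialStates M), contents (Function.update (fun _ => []) input x)
        fun _ _ => []⟩ := by
    rw [key]
    have h3 := stk_initList (F.toFinTM2 input output) x
    exact (Cfg.mk.injEq _ _ _ _ _ _).mpr ⟨rfl, rfl, h3⟩
  have h4 : haltList (F.toFinTM2 input output) y = ⟨none,
      (none, initialStates M), contents (Function.update (fun _ => []) output y)
        fun _ _ => []⟩ := by
    rw [key]
    have h3 := stk_haltList (F.toFinTM2 input output) y
    exact (Cfg.mk.injEq _ _ _ _ _ _).mpr ⟨rfl, rfl, h3⟩
  refine ⟨⟨⟨n + 1, ?_⟩, Nat.succ_le_succ hn⟩⟩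
  rw [Function.iterate_succ_apply', h2]
  exact (congrArg (flip bind (F.toFinTM2 input output).step) (h1.iterate input output)).trans
    (congrArg some h4.symm)

end Computer

end Machine

/-! ### The length of the output of a machine -/

/-- A bound for the number of symbols that a statement pushes. -/
def pushes {K : Type} [DecidableEq K] {Γ : K → Type} {Λ σ : Type} : Stmt Γ Λ σ → ℕ
  | .push _ _ q => pushes q + 1
  | .peek _ _ q => pushes q
  | .pop _ _ q => pushes q
  | .load _ q => pushes q
  | .branch _ q₁ q₂ => pushes q₁ + pushes q₂
  | .goto _ => 0
  | .halt => 0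

theorem length_stepAux_le {K : Type} [DecidableEq K] {Γ : K → Type} {Λ σ : Type}
    (q : Stmt Γ Λ σ) (v : σ) (S : ∀ k, List (Γ k)) (k : K) :
    ((stepAux q v S).stk k).length ≤ (S k).length + pushes q := by
  induction q generalizing v S with
  | push k' g q ih =>
    refine (ih _ _).trans ?_
    by_cases h : k = k'
    · subst h; simp [pushes]; omega
    · simp [pushes, h]
  | peek k' g q ih => exact ih _ _
  | pop k' g q ih =>
    refine (ih _ _).trans ?_
    by_cases h : k = k'
    · subst h; simp [pushes]
    · simp [pushes, h]
  | load g q ih => exact ih _ _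
  | branch g q₁ q₂ ih₁ ih₂ =>
    simp only [stepAux, pushes]
    cases g v
    · exact (ih₂ _ _).trans (by omega)
    · exact (ih₁ _ _).trans (by omega)
  | goto l => simp [stepAux, pushes]
  | halt => simp [stepAux, pushes]

/-- Up to a factor that depends on the machine, the output is not longer than the input and the
time taken together. -/
theorem exists_length_output_le (tm : FinTM2) : ∃ C : ℕ, ∀ (s : List (tm.Γ tm.k₀))
    (r : List (tm.Γ tm.k₁)) (t : ℕ), TM2OutputsInTime tm s (some r) t →
      r.length ≤ s.length + C * t := by
  refine ⟨∑ l, pushes (tm.m l), fun s r t ⟨⟨n, hn⟩, hnt⟩ => ?_⟩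
  have key : ∀ (n : ℕ) (c c' : tm.Cfg), (flip bind tm.step)^[n] (some c) = some c' →
      (c'.stk tm.k₁).length ≤ (c.stk tm.k₁).length + (∑ l, pushes (tm.m l)) * n := by
    intro n
    induction n with
    | zero =>
      intro c c' h
      obtain rfl : c = c' := by simpa using h
      simp
    | succ n ih =>
      intro c c' h
      rw [Function.iterate_succ_apply'] at h
      cases h1 : (flip bind tm.step)^[n] (some c) with
      | none => rw [h1] at h; cases h
      | some c₁ =>
        rw [h1] at h
        have h2 := ih _ _ h1
        obtain ⟨l, v, S⟩ := c₁
        cases l with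
        | none => cases h
        | some l =>
          have h3 : c' = stepAux (tm.m l) v S := (Option.some.inj h).symm
          subst h3
          have h4 := length_stepAux_le (tm.m l) v S tm.k₁
          have h5 : pushes (tm.m l) ≤ ∑ l, pushes (tm.m l) :=
            Finset.single_le_sum (f := fun l => pushes (tm.m l)) (fun _ _ => Nat.zero_le _)
              (Finset.mem_univ l)
          rw [Nat.mul_succ]
          dsimp only at h2
          omega
  have h1 := key n _ _ hn
  rw [stk_initList, stk_haltList, Function.update_self] at h1
  have h2 : ∀ k, (Function.update (fun k => ([] : List (tm.Γ k))) tm.k₀ s k).length ≤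
      s.length := fun k => by
    by_cases h : k = tm.k₀
    · subst h; simp
    · simp [h]
  have h3 := h2 tm.k₁
  have h4 : (∑ l, pushes (tm.m l)) * n ≤ (∑ l, pushes (tm.m l)) * t := Nat.mul_le_mul_left _ hnt
  omega

end StackProgram

/-! ### Loops over unary numbers -/

namespace StackProgram

section Unary

variable {ι : Type} {M : ι → Turing.FinTM2} {O : Type} [DecidableEq ι] [DecidableEq O]

theorem Fragment.Run.congr {F : Fragment (Alphabet M O) (States M)} {t : ℕ}
    {E E₁ E₂ : O → List Bool} (h : F.Run t E E₁) (hE : E₁ = E₂) : F.Run t E E₂ :=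
  hE ▸ h

/-- Repeat the fragment as often as there are symbols on the stack `o`, which gets emptied. -/
def Fragment.repeatFor (o : O) (F : Fragment (Alphabet M O) (States M)) :
    Fragment (Alphabet M O) (States M) :=
  .loop o (fun s => s.elim .skip fun _ => F) Option.isSome

theorem Fragment.run_repeatFor {o : O} {F : Fragment (Alphabet M O) (States M)} {t : ℕ}
    (n : ℕ) (S : ℕ → O → List Bool) (hS : ∀ i ≤ n, S i o = List.replicate (n - i) true)
    (hF : ∀ i < n, F.Run t (Function.update (S i) o (List.replicate (n - (i + 1)) true))
      (S (i + 1))) :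
    (Fragment.repeatFor o F).Run ((t + 1) * n + 2) (S 0) (S n) := by
  induction n generalizing S with
  | zero =>
    have h0 : S 0 o = [] := hS 0 le_rfl
    refine (Fragment.Run.loop_exit (t := 1) none (by rw [h0]; rfl) ?_ rfl).mono (by omega)
    rw [Function.update_eq_self_iff.2 (by rw [h0]; rfl)]
    exact Fragment.run_skip _
  | succ n ih =>
    have h0 : S 0 o = List.replicate (n + 1) true := hS 0 (Nat.zero_le _)
    have h1 := hF 0 (Nat.succ_pos _)
    have h2 := ih (fun i => S (i + 1))
      (fun i hi => by rw [hS _ (Nat.succ_le_succ hi), Nat.add_sub_add_right])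
      (fun i hi => by
        have h3 := hF (i + 1) (Nat.succ_lt_succ hi)
        rwa [Nat.add_sub_add_right] at h3)
    refine (Fragment.Run.loop_again (some true) (by rw [h0]; rfl) (t := t) ?_ rfl h2).mono
      (by rw [Nat.mul_succ]; omega)
    rw [h0]
    exact h1

/-- Empty a stack. -/
def Fragment.clear (o : O) : Fragment (Alphabet M O) (States M) :=
  .repeatFor o .skip

theorem Fragment.run_clear {o : O} {n : ℕ} {E : O → List Bool}
    (h : E o = List.replicate n true) :
    (Fragment.clear o : Fragment (Alphabet M O) (States M)).Run (2 * n + 2) E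
      (Function.update E o []) := by
  have h1 := Fragment.run_repeatFor (M := M) (o := o) (F := .skip) (t := 1) n
    (fun i => Function.update E o (List.replicate (n - i) true)) (fun i _ => by simp)
    (fun i _ => by
      simp only [Function.update_idem]
      exact Fragment.run_skip _)
  simp only [Nat.sub_zero, Nat.sub_self, List.replicate_zero] at h1
  rwa [Function.update_eq_self_iff.2 h.symm] at h1

/-- Put a copy of the unary number on the stack `r` on the stack `o`, using the stack `s`. -/
def Fragment.copy (r s o : O) : Fragment (Alphabet M O) (States M) :=
  .seq (.move r s) (.repeatFor s (.seq (.write r true) (.write o true)))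

theorem Fragment.run_copy {r s o : O} (hrs : s ≠ r) (hro : o ≠ r) (hso : o ≠ s) {n : ℕ}
    {E : O → List Bool} (hr : E r = List.replicate n true) (hs : E s = []) :
    (Fragment.copy r s o : Fragment (Alphabet M O) (States M)).Run (5 * n + 4) E
      (Function.update E o (List.replicate n true ++ E o)) := by
  have h1 := Fragment.run_repeatFor (M := M) (o := s)
    (F := .seq (.write r true) (.write o true)) (t := 2) n
    (fun i => Function.update (Function.update (Function.update E s (List.replicate (n - i) true))
      r (List.replicate i true)) o (List.replicate i true ++ E o))
    (fun i _ => by simp [hso.symm, hrs])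
    (fun i _ => by
      refine Fragment.Run.seq (t₁ := 1) (t₂ := 1) (Fragment.run_write _ _ _) ?_
      refine (Fragment.run_write _ _ _).congr ?_
      funext k
      simp only [Function.update_apply]
      split_ifs <;> simp_all [List.replicate_succ])
  refine (Fragment.Run.seq (Fragment.run_move hrs E) (?_ : Fragment.Run _ (3 * n + 2) _ _)).mono
    (by rw [hr, List.length_replicate]; omega)
  convert h1 using 1
  · funext k
    simp only [Function.update_apply]
    split_ifs <;> simp_all
  · funext k
    simp only [Function.update_apply]
    split_ifs <;> simp_all

/-- Duplicate the content of the stack `o` on the stacks `o₁` and `o₂`, reversing it. -/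
def Fragment.split (o o₁ o₂ : O) : Fragment (Alphabet M O) (States M) :=
  .loop o (fun s => s.elim .skip fun b => .seq (.write o₁ b) (.write o₂ b)) Option.isSome

theorem Fragment.run_split {o o₁ o₂ : O} (h₁ : o₁ ≠ o) (h₂ : o₂ ≠ o) (h₁₂ : o₁ ≠ o₂)
    (l : List Bool) {E : O → List Bool} (hl : E o = l) :
    (Fragment.split o o₁ o₂ : Fragment (Alphabet M O) (States M)).Run (3 * l.length + 2) E
      (Function.update (Function.update (Function.update E o []) o₁ (l.reverse ++ E o₁)) o₂
        (l.reverse ++ E o₂)) := by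
  induction l generalizing E with
  | nil =>
    refine (Fragment.Run.loop_exit (t := 1) none (by rw [hl]; rfl) ?_ rfl).mono (by simp)
    refine (Fragment.run_skip _).congr ?_
    funext k
    simp only [Function.update_apply]
    split_ifs <;> simp_all
  | cons b l ih =>
    have h3 := ih (E := Function.update (Function.update (Function.update E o l)
      o₁ (b :: E o₁)) o₂ (b :: E o₂)) (by simp [h₁.symm, h₂.symm])
    have h4 : (Fragment.seq (.write o₁ b) (.write o₂ b) :
        Fragment (Alphabet M O) (States M)).Run 2 (Function.update E o (E o).tail)
        (Function.update (Function.update (Function.update E o l) o₁ (b :: E o₁)) o₂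
          (b :: E o₂)) := by
      refine Fragment.Run.seq (t₁ := 1) (t₂ := 1) (Fragment.run_write _ _ _)
        ((Fragment.run_write _ _ _).congr ?_)
      funext k
      simp only [Function.update_apply]
      split_ifs <;> simp_all
    refine ((Fragment.Run.loop_again (some b) (by rw [hl]; rfl) h4 rfl h3).congr ?_).mono
      (by rw [List.length_cons]; omega)
    funext k
    simp only [Function.update_apply]
    split_ifs <;> simp_all

end Unary

/-! ### Registers, and programs that write numbers -/

/-- The registers of the program, which hold numbers in unary: the sizes of the ancilla and the
witness register of the given circuit and the number of low bits of the truncated counter, the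
position of a qubit, the variable and the number of remaining rounds of a loop, and a scratch
register. -/
inductive Reg
  | anc | wit | low | qubit | index | count | tmp
  deriving DecidableEq

instance : Fintype Reg :=
  ⟨{.anc, .wit, .low, .qubit, .index, .count, .tmp}, fun r => by cases r <;> decide⟩

/-- The other stacks of the program: the input, the description of the given circuit, the reverse
of what has been written of the new description, and the output. -/
inductive Aux
  | input | desc | rev | output
  deriving DecidableEq

instance : Fintype Aux :=
  ⟨{.input, .desc, .rev, .output}, fun o => by cases o <;> decide⟩

/-- The contents of the stacks of the program. -/
def state (N : Reg → ℕ) (D : Aux → List Bool) : Reg ⊕ Aux → List Bool :=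
  Sum.elim (fun r => List.replicate (N r) true) D

@[simp] theorem state_inl (N : Reg → ℕ) (D : Aux → List Bool) (r : Reg) :
    state N D (.inl r) = List.replicate (N r) true := rfl

@[simp] theorem state_inr (N : Reg → ℕ) (D : Aux → List Bool) (o : Aux) :
    state N D (.inr o) = D o := rfl

theorem update_state_inl (N : Reg → ℕ) (D : Aux → List Bool) (r : Reg) (n : ℕ) :
    Function.update (state N D) (.inl r) (List.replicate n true) =
      state (Function.update N r n) D := by
  funext k
  rcases k with r' | o
  · by_cases h : r' = r
    · subst h; simp
    · simp [h]
  · simp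

theorem update_state_inl_nil (N : Reg → ℕ) (D : Aux → List Bool) (r : Reg) :
    Function.update (state N D) (.inl r) [] = state (Function.update N r 0) D :=
  update_state_inl N D r 0

@[simp] theorem update_state_inr (N : Reg → ℕ) (D : Aux → List Bool) (o : Aux)
    (l : List Bool) :
    Function.update (state N D) (.inr o) l = state N (Function.update D o l) := by
  funext k
  rcases k with r' | o'
  · simp
  · by_cases h : o' = o
    · subst h; simp
    · simp [h]

/-- A list of numbers as a bit string, every number being written in unary. -/
def encode (l : List ℕ) : List Bool := l.flatMap fun k => List.replicate k true ++ [false]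

theorem encode_append (l l' : List ℕ) : encode (l ++ l') = encode l ++ encode l' :=
  List.flatMap_append

section Writes

variable {ι : Type} {M : ι → Turing.FinTM2} [DecidableEq ι]

variable (M) in
/-- Programs that call the machines `M`. -/
abbrev Program : Type 1 := Fragment (Alphabet M (Reg ⊕ Aux)) (States M)

/-- In a state that satisfies `P`, the program `F` writes `f N`, where `N` are the contents of the
registers, and has no other effect. It takes a number of steps that is bounded by a polynomial of
degree `d` in the size of the registers. -/
def Writes (P : (Reg → ℕ) → Prop) (d : ℕ) (F : Program M) (f : (Reg → ℕ) → List Bool) : Prop :=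
  ∃ C, ∀ (B : ℕ) (N : Reg → ℕ) (D : Aux → List Bool), (∀ r, N r ≤ B) → P N →
    F.Run (C * (B + 1) ^ d) (state N D)
      (state N (Function.update D .rev ((f N).reverse ++ D .rev)))

variable {P P' : (Reg → ℕ) → Prop} {d d' : ℕ} {F G : Program M} {f g : (Reg → ℕ) → List Bool}

theorem Writes.mono (h : Writes P d F f) (hP : ∀ N, P' N → P N) (hd : d ≤ d') :
    Writes P' d' F f := by
  obtain ⟨C, hC⟩ := h
  refine ⟨C, fun B N D hN hN' => (hC B N D hN (hP N hN')).mono ?_⟩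
  exact Nat.mul_le_mul_left _ (Nat.pow_le_pow_right (Nat.succ_pos _) hd)

theorem writes_skip : Writes P d (.skip : Program M) fun _ => [] := by
  refine ⟨1, fun B N D _ _ => ?_⟩
  have h := Fragment.run_skip (M := M) (state N D)
  simp only [List.reverse_nil, List.nil_append, Function.update_eq_self]
  exact h.mono (by rw [Nat.one_mul]; exact Nat.one_le_pow _ _ (Nat.succ_pos _))

theorem writes_write (b : Bool) :
    Writes P d (.write (.inr .rev) b : Program M) fun _ => [b] := by
  refine ⟨1, fun B N D _ _ => ?_⟩
  have h := Fragment.run_write (M := M) (.inr .rev) b (state N D)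
  rw [update_state_inr] at h
  exact h.mono (by rw [Nat.one_mul]; exact Nat.one_le_pow _ _ (Nat.succ_pos _))

theorem Writes.seq (hF : Writes P d F f) (hG : Writes P d G g) :
    Writes P d (F.seq G) fun N => f N ++ g N := by
  obtain ⟨C, hC⟩ := hF
  obtain ⟨C', hC'⟩ := hG
  refine ⟨C + C', fun B N D hN hP => ?_⟩
  have h := (hC B N D hN hP).seq (hC' B N _ hN hP)
  rw [Nat.add_mul]
  simpa using h

/-- The programs `F a`, `a ∈ l`, one after the other. -/
def seqList {α : Type*} (l : List α) (F : α → Program M) : Program M :=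
  l.foldr (fun a G => (F a).seq G) .skip

theorem writes_seqList {α : Type*} (l : List α) {F : α → Program M}
    {f : α → (Reg → ℕ) → List Bool} (h : ∀ a ∈ l, Writes P d (F a) (f a)) :
    Writes P d (seqList l F) fun N => l.flatMap fun a => f a N := by
  induction l with
  | nil => exact writes_skip
  | cons a l ih =>
    simp only [List.flatMap_cons]
    exact (h a (by simp)).seq (ih fun b hb => h b (by simp [hb]))

theorem writes_copy {r : Reg} (hr : r ≠ .tmp) :
    Writes (fun N => N .tmp = 0) 1 (.copy (.inl r) (.inl .tmp) (.inr .rev) : Program M)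
      fun N => List.replicate (N r) true := by
  refine ⟨5, fun B N D hN hP => ?_⟩
  have h := Fragment.run_copy (M := M) (r := .inl r) (s := .inl Reg.tmp) (o := .inr Aux.rev)
    (by simpa using hr.symm) (by simp) (by simp) (n := N r) (E := state N D) rfl (by simp [hP])
  rw [update_state_inr] at h
  rw [List.reverse_replicate]
  exact h.mono (by rw [pow_one]; have := hN r; omega)

/-- The sum of the contents of some registers and of a constant. -/
structure Expr where
  regs : List Reg
  const : ℕ

/-- The value of an expression. -/
def Expr.eval (N : Reg → ℕ) (e : Expr) : ℕ := (e.regs.map N).sum + e.const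

/-- Write the value of an expression. -/
def emit (e : Expr) : Program M :=
  .seq (.seq (seqList e.regs fun r => .copy (.inl r) (.inl .tmp) (.inr .rev))
    (seqList (List.range e.const) fun _ => .write (.inr .rev) true)) (.write (.inr .rev) false)

theorem writes_emit (e : Expr) (he : ∀ r ∈ e.regs, r ≠ .tmp) :
    Writes (fun N => N .tmp = 0) 1 (emit e : Program M) fun N => encode [e.eval N] := by
  have h := ((writes_seqList (M := M) e.regs fun r hr => writes_copy (he r hr)).seq
    (writes_seqList (List.range e.const) fun _ _ => writes_write true)).seq (writes_write false)
  have h1 : (fun N => encode [e.eval N]) = fun N => ((e.regs.flatMap fun r =>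
      List.replicate (N r) true) ++ (List.range e.const).flatMap fun _ => [true]) ++ [false] := by
    funext N
    have h2 : ∀ l : List Reg, (l.flatMap fun r => List.replicate (N r) true) =
        List.replicate (l.map N).sum true := fun l => by
      induction l with
      | nil => rfl
      | cons r l ih => rw [List.flatMap_cons, ih, List.replicate_append_replicate]; simp
    have h3 : ∀ k, ((List.range k).flatMap fun _ => [true]) = List.replicate k true := fun k => by
      induction k with
      | zero => rfl
      | succ k ih => rw [List.range_succ, List.flatMap_append, ih, List.replicate_succ']; rfl
    rw [h2, h3, List.replicate_append_replicate]
    simp [encode, Expr.eval]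
  rw [h1]
  exact h

/-- Write the values of a list of expressions. -/
def emitList (l : List Expr) : Program M := seqList l emit

theorem writes_emitList (l : List Expr) (hl : ∀ e ∈ l, ∀ r ∈ e.regs, r ≠ .tmp) :
    Writes (fun N => N .tmp = 0) 1 (emitList l : Program M)
      fun N => encode (l.map fun e => e.eval N) := by
  have h := writes_seqList (M := M) l fun e he => writes_emit e (hl e he)
  have h1 : (fun N => encode (l.map fun e => e.eval N)) =
      fun N => l.flatMap fun e => encode [e.eval N] := by
    funext N
    simp [encode, List.flatMap_map]
  rw [h1]
  exact h

/-- The registers that are used within loops are empty. -/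
def Idle (N : Reg → ℕ) : Prop := N .tmp = 0 ∧ N .index = 0 ∧ N .count = 0

/-- Repeat a program for all values `m - 1, …, 0` of the loop variable, `m` being the number of low
bits of the counter. -/
def forDown (F : Program M) : Program M :=
  .seq (.copy (.inl .low) (.inl .tmp) (.inl .index)) (.repeatFor (.inl .index) F)

theorem Writes.forDown (h : Writes (fun N => N .tmp = 0) d F f) :
    Writes Idle (d + 1) (forDown F) fun N =>
      (List.range (N .low)).reverse.flatMap fun j => f (Function.update N .index j) := by
  obtain ⟨C, hC⟩ := h
  refine ⟨C + 8, fun B N D hN ⟨h1, h2, h3⟩ => ?_⟩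
  have h4 := Fragment.run_copy (M := M) (r := .inl Reg.low) (s := .inl Reg.tmp)
    (o := .inl Reg.index) (by simp) (by simp) (by simp) (n := N .low) (E := state N D) rfl
    (by simp [h1])
  have hB : N .low ≤ B := hN _
  have h5 := Fragment.run_repeatFor (M := M) (o := .inl Reg.index) (F := F)
    (t := C * (B + 1) ^ d) (N .low)
    (fun i => state (Function.update N .index (N .low - i)) (Function.update D .rev
      ((((List.range (N .low)).reverse.take i).flatMap
        fun j => f (Function.update N .index j)).reverse ++ D .rev)))
    (fun i _ => by simp) (fun i hi => by
      have h6 := hC B (Function.update N .index (N .low - (i + 1))) (Function.update D .rev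
        ((((List.range (N .low)).reverse.take i).flatMap
          fun j => f (Function.update N .index j)).reverse ++ D .rev))
        (fun r => by
          by_cases hr : r = .index
          · subst hr; simp; omega
          · simp [hr, hN])
        (by simpa using h1)
      rw [update_state_inl, Function.update_idem]
      convert h6 using 2
      have h7 : (List.range (N .low)).reverse.take (i + 1) =
          (List.range (N .low)).reverse.take i ++ [N .low - (i + 1)] := by
        rw [List.take_succ_eq_append_getElem (by simpa using hi)]
        simp
        omega
      rw [h7]
      simp [List.flatMap_append])
  have h8 : (5 * N .low + 4) + ((C * (B + 1) ^ d + 1) * N .low + 2) ≤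
      (C + 8) * (B + 1) ^ (d + 1) := by
    have h9 : 1 ≤ (B + 1) ^ d := Nat.one_le_pow _ _ (Nat.succ_pos _)
    have h10 : (C * (B + 1) ^ d + 1) * N .low ≤ (C * (B + 1) ^ d + 1) * B :=
      Nat.mul_le_mul_left _ hB
    rw [pow_succ]
    nlinarith
  refine (Fragment.Run.seq h4 (?_ : Fragment.Run _ ((C * (B + 1) ^ d + 1) * N .low + 2) _ _)).mono
    h8
  convert h5 using 1
  · have h11 : List.replicate (N .low) true ++ state N D (.inl .index) =
        List.replicate (N .low) true := by simp [h2]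
    rw [h11, update_state_inl]
    simp
  · rw [Nat.sub_self, ← h2, Function.update_eq_self]
    rw [List.take_of_length_le (by simp)]

/-- Repeat a program for all values `0, …, m - 1` of the loop variable, `m` being the number of low
bits of the counter. -/
def forUp (F : Program M) : Program M :=
  .seq (.copy (.inl .low) (.inl .tmp) (.inl .count))
    (.seq (.repeatFor (.inl .count) (.seq F (.write (.inl .index) true))) (.clear (.inl .index)))

theorem Writes.forUp (h : Writes (fun N => N .tmp = 0) d F f)
    (hf : ∀ N k, f (Function.update N .count k) = f N) :
    Writes Idle (d + 1) (forUp F) fun N =>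
      (List.range (N .low)).flatMap fun j => f (Function.update N .index j) := by
  obtain ⟨C, hC⟩ := h
  refine ⟨C + 12, fun B N D hN ⟨h1, h2, h3⟩ => ?_⟩
  have h4 := Fragment.run_copy (M := M) (r := .inl Reg.low) (s := .inl Reg.tmp)
    (o := .inl Reg.count) (by simp) (by simp) (by simp) (n := N .low) (E := state N D) rfl
    (by simp [h1])
  have hB : N .low ≤ B := hN _
  have h5 := Fragment.run_repeatFor (M := M) (o := .inl Reg.count)
    (F := .seq F (.write (.inl .index) true)) (t := C * (B + 1) ^ d + 1) (N .low)
    (fun i => state (Function.update (Function.update N .index i) .count (N .low - i))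
      (Function.update D .rev (((List.range i).flatMap
        fun j => f (Function.update N .index j)).reverse ++ D .rev)))
    (fun i _ => by simp) (fun i hi => by
      have h6 := hC B (Function.update (Function.update N .index i) .count (N .low - (i + 1)))
        (Function.update D .rev (((List.range i).flatMap
          fun j => f (Function.update N .index j)).reverse ++ D .rev))
        (fun r => by
          by_cases hr : r = .count
          · subst hr; simp; omega
          · by_cases hr' : r = .index
            · subst hr'; simp; omega
            · simp [hr, hr', hN])
        (by simpa using h1)
      rw [update_state_inl, Function.update_idem]
      refine h6.seq ?_
      refine (Fragment.run_write _ _ _).congr ?_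
      rw [state_inl, ← List.replicate_succ, update_state_inl, hf]
      congr 1
      · rw [Function.update_comm (by decide : Reg.count ≠ .index)]
        simp
      · rw [Function.update_idem, List.range_succ, List.flatMap_append]
        simp)
  have h7 : (Fragment.clear (.inl .index) : Program M).Run (2 * N .low + 2)
      (state (Function.update (Function.update N .index (N .low)) .count (N .low - N .low))
      (Function.update D .rev (((List.range (N .low)).flatMap
        fun j => f (Function.update N .index j)).reverse ++ D .rev)))
      (state N (Function.update D .rev (((List.range (N .low)).flatMap
        fun j => f (Function.update N .index j)).reverse ++ D .rev))) := by
    refine (Fragment.run_clear (n := N .low) (by simp)).congr ?_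
    rw [update_state_inl_nil]
    congr 1
    funext r
    simp only [Function.update_apply, Nat.sub_self]
    split_ifs <;> simp_all
  have h8 : (5 * N .low + 4) + (((C * (B + 1) ^ d + 1 + 1) * N .low + 2) + (2 * N .low + 2)) ≤
      (C + 12) * (B + 1) ^ (d + 1) := by
    have h9 : 1 ≤ (B + 1) ^ d := Nat.one_le_pow _ _ (Nat.succ_pos _)
    have h10 : (C * (B + 1) ^ d + 1 + 1) * N .low ≤ (C * (B + 1) ^ d + 1 + 1) * B :=
      Nat.mul_le_mul_left _ hB
    rw [pow_succ]
    nlinarith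
  refine (Fragment.Run.seq h4 (Fragment.Run.seq ?_ h7)).mono h8
  convert h5 using 1
  have h11 : List.replicate (N .low) true ++ state N D (.inl .count) =
      List.replicate (N .low) true := by simp [h3]
  rw [h11, update_state_inl]
  congr 1
  · funext r
    simp only [Function.update_apply, Nat.sub_zero]
    split_ifs <;> simp_all
  · simp

end Writes

end StackProgram

/-! ### Writing the descriptions of the counter circuits -/

section Tokens

variable {𝒞 : GateSet}

/-- The operations implementing a reversible gate as a list of numbers. -/
noncomputable def RevGate.tokens (hC : 𝒞.HasReversibleGates) (g : RevGate) : List ℕ :=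
  (g.circuit hC).flatMap fun p => ((p.gate : ℕ) + 2) :: List.ofFn fun j => g.pos (p.qubits j)

theorem RevGate.flatMap_tokens_toOps (hC : 𝒞.HasReversibleGates) {n : ℕ} {g : RevGate}
    (hg : g.Valid n) : (g.toOps hC n).flatMap Op.tokens = g.tokens hC := by
  rw [RevGate.toOps, dif_pos hg, List.flatMap_map]
  rfl

theorem RevGate.flatMap_flatMap_tokens_toOps (hC : 𝒞.HasReversibleGates) {n : ℕ}
    {gs : List RevGate} (hgs : ∀ g ∈ gs, g.Valid n) :
    (gs.flatMap (RevGate.toOps hC n)).flatMap Op.tokens = gs.flatMap (RevGate.tokens hC) := by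
  rw [List.flatMap_assoc]
  exact List.flatMap_congr fun g hg => RevGate.flatMap_tokens_toOps hC (hgs g hg)

end Tokens

namespace StackProgram

theorem encode_flatMap {α : Type*} (l : List α) (f : α → List ℕ) :
    encode (l.flatMap f) = l.flatMap fun a => encode (f a) :=
  List.flatMap_assoc

section Gates

variable {ι : Type} {M : ι → Turing.FinTM2} [DecidableEq ι] {𝒞 : GateSet}

theorem Writes.congr {P : (Reg → ℕ) → Prop} {d : ℕ} {F : Program M}
    {f g : (Reg → ℕ) → List Bool} (h : Writes P d F f) (hfg : ∀ N, f N = g N) :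
    Writes P d F g :=
  (funext hfg : f = g) ▸ h

/-- A reversible gate on bits whose positions are given by expressions. -/
inductive RevExpr
  | not (t : Expr)
  | cnot (c t : Expr)
  | toffoli (c₁ c₂ t : Expr)

/-- The gate that an expression stands for. -/
def RevExpr.eval (N : Reg → ℕ) : RevExpr → RevGate
  | not t => .not (t.eval N)
  | cnot c t => .cnot (c.eval N) (t.eval N)
  | toffoli c₁ c₂ t => .toffoli (c₁.eval N) (c₂.eval N) (t.eval N)

theorem eval_not (N : Reg → ℕ) (t : Expr) : (RevExpr.not t).eval N = .not (t.eval N) := rfl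

theorem eval_cnot (N : Reg → ℕ) (c t : Expr) :
    (RevExpr.cnot c t).eval N = .cnot (c.eval N) (t.eval N) := rfl

theorem eval_toffoli (N : Reg → ℕ) (c₁ c₂ t : Expr) :
    (RevExpr.toffoli c₁ c₂ t).eval N = .toffoli (c₁.eval N) (c₂.eval N) (t.eval N) := rfl

/-- The scratch register does not occur in the expression. -/
def RevExpr.NoTmp : RevExpr → Prop
  | not t => Reg.tmp ∉ t.regs
  | cnot c t => Reg.tmp ∉ c.regs ∧ Reg.tmp ∉ t.regs
  | toffoli c₁ c₂ t => Reg.tmp ∉ c₁.regs ∧ Reg.tmp ∉ c₂.regs ∧ Reg.tmp ∉ t.regs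

/-- The description of a circuit placed on qubits whose positions are given by expressions. -/
def circuitExprs {k : ℕ} (l : List (PlacedGate 𝒞 k)) (pos : Fin k → Expr) : List Expr :=
  l.flatMap fun p => ⟨[], (p.gate : ℕ) + 2⟩ :: List.ofFn fun j => pos (p.qubits j)

theorem map_eval_circuitExprs {k : ℕ} (l : List (PlacedGate 𝒞 k)) (pos : Fin k → Expr)
    (N : Reg → ℕ) : (circuitExprs l pos).map (fun e => e.eval N) =
      l.flatMap fun p => ((p.gate : ℕ) + 2) :: List.ofFn fun j => (pos (p.qubits j)).eval N := by
  rw [circuitExprs, List.map_flatMap]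
  refine List.flatMap_congr fun p _ => ?_
  rw [List.map_cons, List.map_ofFn]
  simp [Expr.eval, Function.comp_def]

theorem writes_circuitExprs {k : ℕ} (l : List (PlacedGate 𝒞 k)) (pos : Fin k → Expr)
    (hpos : ∀ j, Reg.tmp ∉ (pos j).regs) :
    Writes (fun N => N .tmp = 0) 1 (emitList (circuitExprs l pos) : Program M) fun N =>
      encode (l.flatMap fun p =>
        ((p.gate : ℕ) + 2) :: List.ofFn fun j => (pos (p.qubits j)).eval N) := by
  refine (writes_emitList _ fun e he r hr => ?_).congr fun N => by rw [map_eval_circuitExprs]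
  rintro rfl
  obtain ⟨p, -, hp⟩ := List.mem_flatMap.1 he
  rcases List.mem_cons.1 hp with rfl | hp
  · simp at hr
  · obtain ⟨j, rfl⟩ := (List.mem_ofFn' _ _).1 hp
    exact hpos _ hr

/-- Write the description of the operations implementing a reversible gate. -/
noncomputable def emitGate (hC : 𝒞.HasReversibleGates) : RevExpr → Program M
  | .not t => emitList (circuitExprs (RevGate.notCircuit hC) ![t])
  | .cnot c t => emitList (circuitExprs (RevGate.cnotCircuit hC) ![c, t])
  | .toffoli c₁ c₂ t => emitList (circuitExprs (RevGate.toffoliCircuit hC) ![c₁, c₂, t])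

theorem writes_emitGate (hC : 𝒞.HasReversibleGates) (g : RevExpr) (hg : g.NoTmp) :
    Writes (fun N => N .tmp = 0) 1 (emitGate hC g : Program M)
      fun N => encode ((g.eval N).tokens hC) := by
  rcases g with t | ⟨c, t⟩ | ⟨c₁, c₂, t⟩
  · refine (writes_circuitExprs _ _ fun j => ?_).congr fun N => ?_
    · fin_cases j; exact hg
    · refine congrArg encode (List.flatMap_congr fun p _ => ?_)
      refine congrArg _ (congrArg List.ofFn (funext fun j => ?_))
      change _ = (![t.eval N] : Fin 1 → ℕ) (p.qubits j)
      generalize p.qubits j = i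
      fin_cases i; rfl
  · refine (writes_circuitExprs _ _ fun j => ?_).congr fun N => ?_
    · fin_cases j
      exacts [hg.1, hg.2]
    · refine congrArg encode (List.flatMap_congr fun p _ => ?_)
      refine congrArg _ (congrArg List.ofFn (funext fun j => ?_))
      change _ = (![c.eval N, t.eval N] : Fin 2 → ℕ) (p.qubits j)
      generalize p.qubits j = i
      fin_cases i <;> rfl
  · refine (writes_circuitExprs _ _ fun j => ?_).congr fun N => ?_
    · fin_cases j
      exacts [hg.1, hg.2.1, hg.2.2]
    · refine congrArg encode (List.flatMap_congr fun p _ => ?_)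
      refine congrArg _ (congrArg List.ofFn (funext fun j => ?_))
      change _ = (![c₁.eval N, c₂.eval N, t.eval N] : Fin 3 → ℕ) (p.qubits j)
      generalize p.qubits j = i
      fin_cases i <;> rfl

/-- The first work qubit. -/
def workZero : Expr := ⟨[.anc], 1⟩

/-- The last work qubit. -/
def workLast : Expr := ⟨[.anc, .low], 1⟩

/-- The work qubit with the number `index`. -/
def workIndex : Expr := ⟨[.anc, .index], 1⟩

/-- The work qubit with the number `index + 1`. -/
def workNext : Expr := ⟨[.anc, .index], 2⟩

/-- The most significant qubit of the counter. -/
def highBit : Expr := ⟨[.anc], 0⟩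

/-- The counter qubit with the number `index`. -/
def lowIndex : Expr := ⟨[.anc, .low, .wit, .index], 2⟩

/-- The qubit whose position is stored. -/
def target : Expr := ⟨[.qubit], 0⟩

/-- A step of the chain of carries. -/
def chain : RevExpr := .toffoli workIndex lowIndex workNext

/-- Write the description of the controlled increment. -/
noncomputable def emitIncr (hC : 𝒞.HasReversibleGates) : Program M :=
  .seq (emitGate hC (.cnot target workZero)) <|
  .seq (forUp (emitGate hC chain)) <|
  .seq (emitGate hC (.cnot workLast highBit)) <|
  .seq (forDown (.seq (emitGate hC chain) (emitGate hC (.cnot workIndex lowIndex)))) <|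
  emitGate hC (.cnot target workZero)

theorem eval_target (N : Reg → ℕ) : target.eval N = N .qubit := rfl

theorem eval_highBit (N : Reg → ℕ) : highBit.eval N = N .anc := rfl

theorem eval_workZero (N : Reg → ℕ) : workZero.eval N = TruncLayout.work (N .anc) 0 := rfl

theorem eval_workLast (N : Reg → ℕ) :
    workLast.eval N = TruncLayout.work (N .anc) (N .low) := by
  simp [workLast, Expr.eval, TruncLayout.work]
  omega

theorem eval_workIndex (N : Reg → ℕ) (j : ℕ) :
    workIndex.eval (Function.update N .index j) = TruncLayout.work (N .anc) j := by
  simp [workIndex, Expr.eval, TruncLayout.work]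
  omega

theorem eval_workNext (N : Reg → ℕ) (j : ℕ) :
    workNext.eval (Function.update N .index j) = TruncLayout.work (N .anc) (j + 1) := by
  simp [workNext, Expr.eval, TruncLayout.work]
  omega

theorem eval_lowIndex (N : Reg → ℕ) (j : ℕ) :
    lowIndex.eval (Function.update N .index j) =
      TruncLayout.low (N .anc) (N .wit) (N .low) j := by
  simp [lowIndex, Expr.eval, TruncLayout.low]
  omega

theorem eval_chain (N : Reg → ℕ) (j : ℕ) : chain.eval (Function.update N .index j) =
    TruncLayout.chainGate (N .anc) (N .wit) (N .low) j := by
  simp [chain, RevExpr.eval, eval_workIndex, eval_workNext, eval_lowIndex, TruncLayout.chainGate]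

theorem writes_emitIncr (hC : 𝒞.HasReversibleGates) :
    Writes Idle 2 (emitIncr hC : Program M) fun N =>
      encode ((TruncLayout.incrGates (N .anc) (N .wit) (N .low) (N .qubit)).flatMap
        (RevGate.tokens hC)) := by
  have h1 : ∀ g : RevExpr, g.NoTmp → Writes Idle 2 (emitGate hC g : Program M)
      fun N => encode ((g.eval N).tokens hC) := fun g hg =>
    (writes_emitGate hC g hg).mono (fun N hN => hN.1) (by norm_num)
  have hchain : chain.NoTmp := by
    refine ⟨?_, ?_, ?_⟩ <;> decide
  have h := (h1 (.cnot target workZero) (by constructor <;> decide)).seq <|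
    ((writes_emitGate hC chain hchain).forUp fun N k => rfl).seq <|
    (h1 (.cnot workLast highBit) (by constructor <;> decide)).seq <|
    ((writes_emitGate hC chain hchain).seq
      (writes_emitGate hC (.cnot workIndex lowIndex) (by constructor <;> decide))).forDown.seq <|
    h1 (.cnot target workZero) (by constructor <;> decide)
  refine h.congr fun N => ?_
  simp only [TruncLayout.incrGates, TruncLayout.chainUp, TruncLayout.addDown,
    List.flatMap_append, encode_append, List.flatMap_assoc, encode_flatMap, List.flatMap_cons,
    List.flatMap_nil, List.append_nil, eval_cnot, eval_chain, eval_target, eval_workZero,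
    eval_workLast, eval_workIndex, eval_lowIndex, eval_highBit, List.append_assoc]

/-- Write the description of the Pauli `X` conditioned on the counter being zero. -/
noncomputable def emitCheck (hC : 𝒞.HasReversibleGates) : Program M :=
  .seq (forUp (emitGate hC (.not lowIndex))) <|
  .seq (emitGate hC (.not highBit)) <|
  .seq (emitGate hC (.not workZero)) <|
  .seq (forUp (emitGate hC chain)) <|
  .seq (emitGate hC (.toffoli workLast highBit target)) <|
  .seq (forDown (emitGate hC chain)) <|
  .seq (emitGate hC (.not workZero)) <|
  .seq (emitGate hC (.not highBit)) <|
  forUp (emitGate hC (.not lowIndex))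

theorem writes_emitCheck (hC : 𝒞.HasReversibleGates) :
    Writes Idle 2 (emitCheck hC : Program M) fun N =>
      encode ((TruncLayout.checkGates (N .anc) (N .wit) (N .low) (N .qubit)).flatMap
        (RevGate.tokens hC)) := by
  have h1 : ∀ g : RevExpr, g.NoTmp → Writes Idle 2 (emitGate hC g : Program M)
      fun N => encode ((g.eval N).tokens hC) := fun g hg =>
    (writes_emitGate hC g hg).mono (fun N hN => hN.1) (by norm_num)
  have hchain : chain.NoTmp := by
    refine ⟨?_, ?_, ?_⟩ <;> decide
  have hflip : (RevExpr.not lowIndex).NoTmp := by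
    change _ ∉ _; decide
  have hhigh : (RevExpr.not highBit).NoTmp := by
    change _ ∉ _; decide
  have hzero : (RevExpr.not workZero).NoTmp := by
    change _ ∉ _; decide
  have h := ((writes_emitGate hC (.not lowIndex) hflip).forUp fun N k => rfl).seq <|
    (h1 _ hhigh).seq <| (h1 _ hzero).seq <|
    ((writes_emitGate hC chain hchain).forUp fun N k => rfl).seq <|
    (h1 (.toffoli workLast highBit target) (by refine ⟨?_, ?_, ?_⟩ <;> decide)).seq <|
    (writes_emitGate hC chain hchain).forDown.seq <|
    (h1 _ hzero).seq <| (h1 _ hhigh).seq <|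
    ((writes_emitGate hC (.not lowIndex) hflip).forUp fun N k => rfl)
  refine h.congr fun N => ?_
  simp only [TruncLayout.checkGates, TruncLayout.chainUp, TruncLayout.chainDown,
    TruncLayout.flipLow, List.flatMap_append, encode_append, List.flatMap_assoc, encode_flatMap,
    List.flatMap_cons, List.flatMap_nil, List.append_nil, eval_not, eval_toffoli, eval_chain,
    eval_target, eval_workZero, eval_workLast, eval_lowIndex, eval_highBit, List.append_assoc]

end Gates

end StackProgram

/-! ### Reading descriptions -/

namespace StackProgram

section Reading

variable {ι : Type} {M : ι → Turing.FinTM2} [DecidableEq ι] {𝒞 : GateSet}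

theorem encode_cons (k : ℕ) (l : List ℕ) :
    encode (k :: l) = List.replicate k true ++ false :: encode l := by
  simp [encode]

/-- Read a number from the description and add it to the register `r`. -/
def readNumber (r : Reg) : Program M :=
  .loop (.inr .desc) (fun s => if s = some true then .write (.inl r) true else .skip)
    fun s => s == some true

theorem run_readNumber (r : Reg) (k : ℕ) (N : Reg → ℕ) {D : Aux → List Bool} {l : List Bool}
    (hD : D .desc = List.replicate k true ++ false :: l) :
    (readNumber r : Program M).Run (2 * k + 2) (state N D)
      (state (Function.update N r (N r + k)) (Function.update D .desc l)) := by
  induction k generalizing N D with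
  | zero =>
    refine (Fragment.Run.loop_exit (t := 1) (some false) (by simp [hD]) ?_ rfl).mono le_rfl
    refine (Fragment.run_skip _).congr ?_
    simp [hD]
  | succ k ih =>
    have h1 := ih (Function.update N r (N r + 1)) (D := Function.update D .desc (D .desc).tail)
      (by simp [hD, List.replicate_succ])
    have h2 := (Fragment.run_write (M := M) (.inl r) true
      (state N (Function.update D .desc (D .desc).tail))).congr
        (E₂ := state (Function.update N r (N r + 1)) (Function.update D .desc (D .desc).tail)) (by
          rw [state_inl, ← List.replicate_succ, update_state_inl])
    refine ((Fragment.Run.loop_again (some true) (t := 1) (by simp [hD, List.replicate_succ])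
      (by simpa using h2) rfl h1).congr ?_).mono (by omega)
    rw [Function.update_idem, Function.update_idem, Function.update_self, Nat.add_right_comm,
      Nat.add_assoc]

/-- The part of `readQubit` that reads the position; at the beginning, `count` is the number of
ancillas. It is decreased once for each unit of the position, so at the end it is empty exactly if
the qubit is not an ancilla; the position is then raised by `m + 2`, because the high counter bit
and the `m + 1` work qubits are inserted behind the ancillas. -/
def readQubitLoop : Program M :=
  .loop (.inr .desc) (fun
      | some true => .seq (.write (.inl .qubit) true)
          (.loop (.inl .count) (fun _ => .skip) fun _ => false)
      | some false => .loop (.inl .count) (fun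
          | some _ => .clear (.inl .count)
          | none => .seq (.copy (.inl .low) (.inl .tmp) (.inl .qubit))
              (.seq (.write (.inl .qubit) true) (.write (.inl .qubit) true))) fun _ => false
      | none => .skip)
    fun s => s == some true

theorem run_readQubitLoop {B : ℕ} (k : ℕ) (N : Reg → ℕ) (htmp : N .tmp = 0) (hlow : N .low ≤ B)
    (hcount : N .count ≤ B) {D : Aux → List Bool} {l : List Bool}
    (hD : D .desc = List.replicate k true ++ false :: l) :
    (readQubitLoop : Program M).Run (4 * k + 5 * B + 10) (state N D)
      (state (Function.update (Function.update N .qubit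
        (N .qubit + k + if N .count ≤ k then N .low + 2 else 0)) .count 0)
          (Function.update D .desc l)) := by
  induction k generalizing N D with
  | zero =>
    have htail : (D .desc).tail = l := by simp [hD]
    refine (Fragment.Run.loop_exit (t := 5 * B + 9) (some false) (by simp [hD]) ?_ rfl).mono
      (by omega)
    rw [state_inr, update_state_inr, htail]
    set D' := Function.update D .desc l
    rcases hc : N .count with _ | c
    · have h1 := Fragment.run_copy (M := M) (r := .inl Reg.low) (s := .inl Reg.tmp)
        (o := .inl Reg.qubit) (by simp) (by simp) (by simp) (n := N .low) (E := state N D') rfl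
        (by simp [htmp])
      have h2 := h1.congr (E₂ := state (Function.update N .qubit (N .low + N .qubit)) D') (by
        rw [state_inl, List.replicate_append_replicate, update_state_inl])
      have h3 := ((Fragment.run_write (M := M) (.inl Reg.qubit) true _).seq
        (Fragment.run_write (M := M) (.inl Reg.qubit) true
          (Function.update (state (Function.update N .qubit (N .low + N .qubit)) D')
            (.inl Reg.qubit) (true :: state (Function.update N .qubit (N .low + N .qubit)) D'
              (.inl .qubit))))).congr
        (E₂ := state (Function.update N .qubit (N .qubit + 0 + (N .low + 2))) D') (by
          rw [Function.update_idem, Function.update_self, state_inl, ← List.replicate_succ,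
            ← List.replicate_succ, update_state_inl, Function.update_idem, Function.update_self]
          congr 2
          omega)
      refine (Fragment.Run.loop_exit (t := 5 * N .low + 4 + (1 + 1)) none (by simp [hc]) ?_
        rfl).mono (by omega)
      have h4 : Function.update (state N D') (.inl .count) (state N D' (.inl .count)).tail =
          state N D' := Function.update_eq_self_iff.2 (by simp [hc])
      rw [h4]
      refine (h2.seq h3).congr ?_
      rw [if_pos le_rfl]
      congr 1
      exact (Function.update_eq_self_iff.2 (by simp [hc])).symm
    · refine (Fragment.Run.loop_exit (t := 2 * c + 2) (some true)
        (by simp [hc, List.replicate_succ]) ?_ rfl).mono (by omega)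
      have h4 : Function.update (state N D') (.inl .count) (state N D' (.inl .count)).tail =
          state (Function.update N .count c) D' := by
        rw [← update_state_inl]
        simp [hc]
      rw [h4]
      refine (Fragment.run_clear (n := c) (by simp)).congr ?_
      rw [update_state_inl_nil, Function.update_idem, if_neg (by omega)]
      simp
  | succ k ih =>
    have htail : (D .desc).tail = List.replicate k true ++ false :: l := by
      simp [hD, List.replicate_succ]
    set D' := Function.update D .desc (List.replicate k true ++ false :: l) with hD'
    set N' := Function.update (Function.update N .qubit (N .qubit + 1)) .count (N .count - 1)
      with hN'
    have h1 := ih N' (by simp [hN', htmp]) (by simpa [hN'] using hlow) (by simp [hN']; omega)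
      (D := D') (by simp [hD'])
    have h2 := (Fragment.run_write (M := M) (.inl Reg.qubit) true (state N D')).congr
        (E₂ := state (Function.update N .qubit (N .qubit + 1)) D') (by
          rw [state_inl, ← List.replicate_succ, update_state_inl])
    have h3 : (Fragment.loop (.inl .count) (fun _ => .skip) fun _ => false : Program M).Run 2
        (state (Function.update N .qubit (N .qubit + 1)) D') (state N' D') := by
      refine Fragment.Run.loop_exit (t := 1) _ rfl ?_ rfl
      refine (Fragment.run_skip _).congr ?_
      rw [hN', state_inl, List.tail_replicate, update_state_inl]
      simp
    refine ((Fragment.Run.loop_again (some true) (t := 1 + 2)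
      (by simp [hD, List.replicate_succ]) ?_ rfl h1).congr ?_).mono (by omega)
    · rw [state_inr, update_state_inr, htail]
      exact h2.seq h3
    · have h5 : (N .count ≤ k + 1) = (N' .count ≤ k) := by
        rw [hN', Function.update_self, Nat.sub_le_iff_le_add]
      simp only [h5]
      have h6 : N' .low = N .low := by simp [hN']
      have h7 : N' .qubit = N .qubit + 1 := by simp [hN']
      rw [h6, h7, hD', Function.update_idem]
      congr 1
      rw [hN', Function.update_comm (by decide : Reg.count ≠ .qubit), Function.update_idem,
        Function.update_idem]
      congr 2
      omega

/-- Read the position of a qubit of the given circuit and store the position of the same qubit of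
the truncated circuit. -/
def readQubit : Program M :=
  .seq (.copy (.inl .anc) (.inl .tmp) (.inl .count)) readQubitLoop

/-- The contents of the registers while the description is converted. -/
def regs (a w m : ℕ) : Reg → ℕ
  | .anc => a
  | .wit => w
  | .low => m
  | _ => 0

theorem run_readQubit (a w m k : ℕ) {D : Aux → List Bool} {l : List Bool}
    (hD : D .desc = List.replicate k true ++ false :: l) :
    (readQubit : Program M).Run (4 * k + 10 * (a + m) + 14) (state (regs a w m) D)
      (state (Function.update (regs a w m) .qubit (TruncLayout.shiftQubit a m k))
        (Function.update D .desc l)) := by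
  have h1 := (Fragment.run_copy (M := M) (r := .inl Reg.anc) (s := .inl Reg.tmp)
    (o := .inl Reg.count) (by simp) (by simp) (by simp) (n := a) (E := state (regs a w m) D) rfl
    rfl).congr (E₂ := state (Function.update (regs a w m) .count a) D) (by
      rw [← update_state_inl]
      simp [regs])
  have h2 := run_readQubitLoop (M := M) (B := a + m) k (Function.update (regs a w m) .count a)
    rfl (by simp [regs]) (by simp) hD
  refine ((h1.seq h2).congr ?_).mono (by omega)
  congr 1
  funext r
  cases r <;> simp [regs, TruncLayout.shiftQubit]
  split_ifs <;> omega

/-- The program removes `u` from the beginning of the description and writes `v`. -/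
def Converts (a w m : ℕ) (F : Program M) (t : ℕ) (u v : List Bool) : Prop :=
  ∀ (D : Aux → List Bool) (l : List Bool), D .desc = u ++ l →
    F.Run t (state (regs a w m) D) (state (regs a w m)
      (Function.update (Function.update D .desc l) .rev (v.reverse ++ D .rev)))

variable {a w m : ℕ}

theorem Converts.mono {F : Program M} {t t' : ℕ} {u v : List Bool}
    (h : Converts a w m F t u v) (ht : t ≤ t') : Converts a w m F t' u v :=
  fun D l hD => (h D l hD).mono ht

theorem Converts.seq {F G : Program M} {t t' : ℕ} {u u' v v' : List Bool}
    (hF : Converts a w m F t u v) (hG : Converts a w m G t' u' v') :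
    Converts a w m (F.seq G) (t + t') (u ++ u') (v ++ v') := by
  intro D l hD
  have h1 := hF D (u' ++ l) (by rw [hD, List.append_assoc])
  refine (h1.seq (hG _ l (by simp))).congr ?_
  congr 1
  funext o
  cases o <;> simp

theorem converts_skip : Converts a w m (.skip : Program M) 1 [] [] := by
  intro D l hD
  refine (Fragment.run_skip _).congr ?_
  congr 1
  funext o
  cases o <;> simp [hD]

theorem Converts.seqList {α : Type*} {l : List α} {F : α → Program M} {t : ℕ}
    {u v : α → List Bool} (h : ∀ x ∈ l, Converts a w m (F x) t (u x) (v x)) :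
    Converts a w m (seqList l F) (t * l.length + 1) (l.flatMap u) (l.flatMap v) := by
  induction l with
  | nil => exact converts_skip
  | cons x l ih =>
    refine ((h x (by simp)).seq (ih fun y hy => h y (by simp [hy]))).mono ?_
    rw [List.length_cons, Nat.mul_succ]
    omega

/-- A program that only writes converts the empty description. -/
theorem Writes.converts {P : (Reg → ℕ) → Prop} {d : ℕ} {F : Program M}
    {f : (Reg → ℕ) → List Bool} (h : Writes P d F f) (hP : ∀ a w m, P (regs a w m)) :
    ∃ C, ∀ a w m, Converts a w m F (C * (a + w + m + 3) ^ d) [] (f (regs a w m)) := by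
  obtain ⟨C, hC⟩ := h
  refine ⟨C, fun a w m D l hD => ?_⟩
  have h1 := hC (a + w + m + 2) (regs a w m) D (fun r => by cases r <;> simp [regs] <;> omega)
    (hP _ _ _)
  have h2 : Function.update D .desc l = D := Function.update_eq_self_iff.2 (by simpa using hD.symm)
  rw [h2]
  exact h1

/-- Read a qubit and run a program that uses its position. -/
def onQubit (F : Program M) : Program M :=
  .seq readQubit (.seq F (.clear (.inl .qubit)))

theorem Writes.converts_onQubit {F : Program M} {f : (Reg → ℕ) → List Bool}
    (h : Writes Idle 2 F f) :
    ∃ C, ∀ a w m k, k < a + w → Converts a w m (onQubit F) (C * (a + w + m + 3) ^ 2) (encode [k])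
      (f (Function.update (regs a w m) .qubit (TruncLayout.shiftQubit a m k))) := by
  obtain ⟨C, hC⟩ := h
  refine ⟨C + 30, fun a w m k hk D l hD => ?_⟩
  have hq : TruncLayout.shiftQubit a m k ≤ a + w + m + 2 := by
    simp only [TruncLayout.shiftQubit]
    split_ifs <;> omega
  have h1 := run_readQubit (M := M) a w m k (D := D) (l := l) (by simpa [encode] using hD)
  have h2 := hC (a + w + m + 2)
    (Function.update (regs a w m) .qubit (TruncLayout.shiftQubit a m k))
    (Function.update D .desc l) (fun r => by cases r <;> simp [regs, hq] <;> omega)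
    ⟨rfl, rfl, rfl⟩
  have h3 := (Fragment.run_clear (M := M) (o := .inl Reg.qubit)
    (n := TruncLayout.shiftQubit a m k)
    (E := state (Function.update (regs a w m) .qubit (TruncLayout.shiftQubit a m k))
      (Function.update (Function.update D .desc l) .rev ((f (Function.update (regs a w m) .qubit
        (TruncLayout.shiftQubit a m k))).reverse ++ D .rev))) (by simp))
  refine ((h1.seq (h2.seq h3)).congr ?_).mono ?_
  · have h4 : Function.update (regs a w m) .qubit 0 = regs a w m :=
      Function.update_eq_self_iff.2 rfl
    rw [update_state_inl_nil, Function.update_idem, h4]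
  · have h4 : (a + w + m + 3) * 3 ≤ (a + w + m + 3) ^ 2 := by
      rw [sq]
      exact Nat.mul_le_mul_left _ (by omega)
    have h5 : a + w + m + 2 + 1 = a + w + m + 3 := rfl
    rw [h5, Nat.add_mul]
    omega

/-- Continue according to the number read from the description. -/
def dispatch : List (Program M) → Program M
  | [] => .skip
  | F :: Fs => .loop (.inr .desc) (fun
      | some true => dispatch Fs
      | some false => F
      | none => .skip) fun _ => false

theorem converts_dispatch {Fs : List (Program M)} {j : ℕ} {F : Program M} (hF : Fs[j]? = some F)
    {t : ℕ} {u v : List Bool} (h : Converts a w m F t u v) :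
    Converts a w m (dispatch Fs) (t + (j + 1)) (List.replicate j true ++ false :: u) v := by
  induction Fs generalizing j with
  | nil => simp at hF
  | cons G Fs ih =>
    intro D l hD
    cases j with
    | zero =>
      obtain rfl : G = F := by simpa using hF
      refine Fragment.Run.loop_exit (t := t) (some false) (by simp [hD]) ?_ rfl
      have h1 := h (Function.update D .desc (u ++ l)) l (by simp)
      have h2 : (D .desc).tail = u ++ l := by simp [hD]
      rw [state_inr, update_state_inr, h2]
      simpa using h1
    | succ j =>
      refine Fragment.Run.loop_exit (t := t + (j + 1)) (some true)
        (by simp [hD, List.replicate_succ]) ?_ rfl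
      have h1 := ih (j := j) (by simpa using hF)
        (Function.update D .desc ((List.replicate j true ++ false :: u) ++ l)) l (by simp)
      have h2 : (D .desc).tail = (List.replicate j true ++ false :: u) ++ l := by
        simp [hD, List.replicate_succ]
      rw [state_inr, update_state_inr, h2]
      rw [Function.update_idem] at h1
      exact h1

end Reading

end StackProgram

/-! ### Converting descriptions -/

namespace StackProgram

section Converting

variable {ι : Type} {M : ι → Turing.FinTM2} [DecidableEq ι] {𝒞 : GateSet} {a w m : ℕ}

theorem length_encode (l : List ℕ) : (encode l).length = l.sum + l.length := by
  induction l with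
  | nil => rfl
  | cons k l ih =>
    rw [encode_cons, List.length_append, List.length_cons, ih, List.sum_cons, List.length_cons,
      List.length_replicate]
    omega

theorem encode_ofFn {k : ℕ} (q : Fin k → ℕ) :
    encode (List.ofFn q) = (List.finRange k).flatMap fun j => encode [q j] := by
  rw [List.ofFn_eq_map, encode, List.flatMap_map]
  simp [encode]

theorem writes_emitTarget : Writes Idle 2 (emit target : Program M)
    fun N => encode [N .qubit] :=
  (writes_emit target (by decide)).mono (fun _ hN => hN.1) (by norm_num)

/-- Convert the description of a gate of the gate set. -/
def convertGate (g : Fin 𝒞.num) : Program M :=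
  .seq (emit ⟨[], (g : ℕ) + 2⟩) (seqList (List.finRange (𝒞.arity g)) fun _ => onQubit (emit target))

theorem converts_convertGate (g : Fin 𝒞.num) : ∃ C, ∀ (a w m : ℕ) (q : Fin (𝒞.arity g) → ℕ),
    (∀ j, q j < a + w) → Converts a w m (convertGate g : Program M) (C * (a + w + m + 3) ^ 2)
      (encode (List.ofFn q))
      (encode (((g : ℕ) + 2) :: List.ofFn fun j => TruncLayout.shiftQubit a m (q j))) := by
  obtain ⟨C, hC⟩ := (writes_emitTarget (M := M)).converts_onQubit
  obtain ⟨C', hC'⟩ := ((writes_emit (M := M) ⟨[], (g : ℕ) + 2⟩ (by simp)).mono (d' := 2)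
    (fun _ h => h) (by norm_num)).converts (fun _ _ _ => rfl)
  refine ⟨C' + (C * 𝒞.arity g + 1), fun a w m q hq => ?_⟩
  have h1 := Converts.seqList (l := List.finRange (𝒞.arity g)) fun j _ => hC a w m (q j) (hq j)
  have h2 : Converts a w m (convertGate g : Program M) _ _ _ := (hC' a w m).seq h1
  have h3 : encode (((g : ℕ) + 2) :: List.ofFn fun j => TruncLayout.shiftQubit a m (q j)) =
      encode [(g : ℕ) + 2] ++ encode (List.ofFn fun j => TruncLayout.shiftQubit a m (q j)) :=
    encode_append [(g : ℕ) + 2] _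
  rw [h3, encode_ofFn, encode_ofFn]
  have h4 : 1 ≤ (a + w + m + 3) ^ 2 := Nat.one_le_pow _ _ (by omega)
  refine Converts.mono (t := C' * (a + w + m + 3) ^ 2 +
    (C * (a + w + m + 3) ^ 2 * (List.finRange (𝒞.arity g)).length + 1)) ?_ ?_
  · simpa [Expr.eval] using h2
  · rw [List.length_finRange]
    nlinarith

/-- Convert the description of an operation, after its first bit: in unary, the kind `0` of an
increment is `false`, the kind `1` of a conditional `X` is `true, false`, and the kind `g + 2` of
a gate is `true, true` followed by `g`. -/
noncomputable def convertOp (hC : 𝒞.HasReversibleGates) : Option Bool → Program M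
  | some true => .loop (.inr .desc) (fun
      | some true => dispatch (List.ofFn fun g : Fin 𝒞.num => convertGate g)
      | some false => onQubit (emitCheck hC)
      | none => .skip) fun _ => false
  | some false => onQubit (emitIncr hC)
  | none => .skip

theorem converts_convertOp (hC : 𝒞.HasReversibleGates) : ∃ C, ∀ (a w m h t : ℕ), h = 1 →
    t = m + 1 → ∀ op : Op 𝒞 (a + w), ∃ b u, encode op.tokens = b :: u ∧
      Converts a w m (convertOp hC (some b) : Program M) (C * (a + w + m + 3) ^ 2) u
        (encode ((TruncLayout.truncOp hC a w m h t op).flatMap Op.tokens)) := by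
  obtain ⟨C₁, hC₁⟩ := (writes_emitIncr (M := M) hC).converts_onQubit
  obtain ⟨C₂, hC₂⟩ := (writes_emitCheck (M := M) hC).converts_onQubit
  choose C₃ hC₃ using converts_convertGate (M := M) (𝒞 := 𝒞)
  refine ⟨C₁ + (C₂ + 1) + (∑ g, C₃ g + (𝒞.num + 2)), fun a w m h t hh ht op => ?_⟩
  have h1 : 1 ≤ (a + w + m + 3) ^ 2 := Nat.one_le_pow _ _ (by omega)
  have hloop : ∀ (b : Bool) (F : Program M) (T : ℕ) (u v : List Bool),
      F = (bif b then dispatch (List.ofFn fun g : Fin 𝒞.num => convertGate g)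
        else onQubit (emitCheck hC)) →
      Converts a w m F T u v →
      Converts a w m (convertOp hC (some true) : Program M) (T + 1) (b :: u) v := by
    intro b F T u v hF h D l hD
    rw [convertOp]
    refine Fragment.Run.loop_exit (t := T) (some b) (by simp [hD]) ?_ rfl
    have h2 := h (Function.update D .desc (u ++ l)) l (by simp)
    have h3 : (D .desc).tail = u ++ l := by simp [hD]
    rw [state_inr, update_state_inr, h3]
    rw [hF] at h2
    cases b <;> simpa using h2
  cases op with
  | incr i =>
    refine ⟨false, encode [(i : ℕ)], by simp [Op.tokens, encode], ?_⟩
    have h2 := hC₁ a w m i i.2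
    have h3 : (TruncLayout.truncOp hC a w m h t (.incr i)).flatMap Op.tokens =
        (TruncLayout.incrGates a w m (TruncLayout.shiftQubit a m i)).flatMap
          (RevGate.tokens hC) := by
      rw [TruncLayout.truncOp]
      refine RevGate.flatMap_flatMap_tokens_toOps hC
        (TruncLayout.valid_incrGates _ _ _ (by omega) ?_ (TruncLayout.shiftQubit_or _))
      have := TruncLayout.shiftQubit_lt (m := m) i.2
      simp only [TruncLayout.low] at this
      omega
    rw [h3]
    exact h2.mono (Nat.mul_le_mul_right _ (by omega))
  | checkZero i =>
    refine ⟨true, false :: encode [(i : ℕ)], by simp [Op.tokens, encode], ?_⟩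
    have h2 := hloop false _ _ _ _ rfl (hC₂ a w m i i.2)
    have h3 : (TruncLayout.truncOp hC a w m h t (.checkZero i)).flatMap Op.tokens =
        (TruncLayout.checkGates a w m (TruncLayout.shiftQubit a m i)).flatMap
          (RevGate.tokens hC) := by
      rw [TruncLayout.truncOp]
      refine RevGate.flatMap_flatMap_tokens_toOps hC
        (TruncLayout.valid_checkGates _ _ _ (by omega) ?_ (TruncLayout.shiftQubit_or _))
      have := TruncLayout.shiftQubit_lt (m := m) i.2
      simp only [TruncLayout.low] at this
      omega
    rw [h3]
    refine h2.mono (le_trans (b := (C₂ + 1) * (a + w + m + 3) ^ 2) ?_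
      (Nat.mul_le_mul_right _ (by omega)))
    rw [Nat.add_mul]
    omega
  | gate p =>
    refine ⟨true, true :: (List.replicate p.gate true ++
      false :: encode (List.ofFn fun j => (p.qubits j : ℕ))), ?_, ?_⟩
    · simp [Op.tokens, encode_cons, List.replicate_succ]
    · have h2 := hC₃ p.gate a w m (fun j => p.qubits j) fun j => (p.qubits j).2
      have h3 := hloop true _ _ _ _ rfl (converts_dispatch (j := p.gate)
        (Fs := List.ofFn fun g : Fin 𝒞.num => convertGate g) (by simp) h2)
      have h4 : (TruncLayout.truncOp hC a w m h t (.gate p)).flatMap Op.tokens =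
          ((p.gate : ℕ) + 2) ::
            List.ofFn fun j => TruncLayout.shiftQubit a m (p.qubits j : ℕ) := by
        simp only [TruncLayout.truncOp, List.flatMap_cons, List.flatMap_nil, List.append_nil]
        refine congrArg _ (congrArg List.ofFn (funext fun j => ?_))
        exact TruncLayout.val_layoutQubit hh ht _
      rw [h4]
      refine h3.mono ?_
      have h5 : C₃ p.gate ≤ ∑ g, C₃ g :=
        Finset.single_le_sum (f := C₃) (fun _ _ => Nat.zero_le _) (Finset.mem_univ _)
      have h6 := p.gate.2
      nlinarith

/-- Convert the descriptions of all operations; the result appears in `rev`, in reverse. -/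
noncomputable def convertOps (hC : 𝒞.HasReversibleGates) : Program M :=
  .loop (.inr .desc) (convertOp hC) Option.isSome

theorem exists_run_convertOps (hC : 𝒞.HasReversibleGates) : ∃ C, ∀ (a w m h t : ℕ), h = 1 →
    t = m + 1 → ∀ (ops : List (Op 𝒞 (a + w))) (D : Aux → List Bool),
      D .desc = encode (ops.flatMap Op.tokens) →
      (convertOps hC : Program M).Run ((C * (a + w + m + 3) ^ 2 + 1) * ops.length + 2)
        (state (regs a w m) D) (state (regs a w m) (Function.update (Function.update D .desc [])
          .rev ((encode ((ops.flatMap (TruncLayout.truncOp hC a w m h t)).flatMap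
            Op.tokens)).reverse ++ D .rev))) := by
  obtain ⟨C, hC'⟩ := converts_convertOp (M := M) hC
  refine ⟨C, fun a w m h t hh ht ops => ?_⟩
  induction ops with
  | nil =>
    intro D hD
    have hD : D .desc = [] := hD
    refine (Fragment.Run.loop_exit (t := 1) none (by simp [hD]) ?_ rfl).mono (by simp)
    refine (Fragment.run_skip _).congr ?_
    rw [state_inr, update_state_inr]
    congr 1
    funext o
    cases o <;> simp [hD, encode]
  | cons op ops ih =>
    intro D hD
    obtain ⟨b, u, hu, hconv⟩ := hC' a w m h t hh ht op
    rw [List.flatMap_cons, encode_append, hu] at hD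
    have h1 := hconv (Function.update D .desc (u ++ encode (ops.flatMap Op.tokens)))
      (encode (ops.flatMap Op.tokens)) (by simp)
    have h2 := ih (Function.update (Function.update D .desc (encode (ops.flatMap Op.tokens))) .rev
      ((encode ((TruncLayout.truncOp hC a w m h t op).flatMap Op.tokens)).reverse ++ D .rev))
      (by simp)
    have h3 : (D .desc).tail = u ++ encode (ops.flatMap Op.tokens) := by simp [hD]
    refine ((Fragment.Run.loop_again (some b) (t := C * (a + w + m + 3) ^ 2) (by simp [hD]) ?_ rfl
      h2).congr ?_).mono ?_
    · rw [state_inr, update_state_inr, h3]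
      simpa using h1
    · congr 1
      funext o
      cases o <;> simp [encode_append]
    · rw [List.length_cons, Nat.mul_succ]
      omega

end Converting

end StackProgram

/-! ### The program that computes the truncated circuits -/

namespace StackProgram

/-- A fragment cannot write more symbols than it takes steps, up to a factor. -/
theorem Fragment.exists_length_le {ι : Type} {M : ι → Turing.FinTM2} {O : Type} [DecidableEq ι]
    [DecidableEq O] (F : Fragment (Alphabet M O) (States M)) : ∃ C : ℕ, ∀ (t : ℕ)
      (E E' : O → List Bool) (o : O), F.Run t E E' → (E' o).length ≤ (E o).length + C * t := by
  refine ⟨∑ l, pushes (F.code l), fun t E E' o ⟨n, hn, h⟩ => ?_⟩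
  have key : ∀ n c c', F.Steps n c c' → (c'.stk (.inl o)).length ≤
      (c.stk (.inl o)).length + (∑ l, pushes (F.code l)) * n := by
    intro n c c' h
    induction h with
    | refl c => simp
    | @step n l v S c h ih =>
      have h1 := length_stepAux_le (F.code l) v S (.inl o)
      have h2 : pushes (F.code l) ≤ ∑ l, pushes (F.code l) :=
        Finset.single_le_sum (f := fun l => pushes (F.code l)) (fun _ _ => Nat.zero_le _)
          (Finset.mem_univ l)
      rw [Nat.mul_succ]
      dsimp only
      omega
  have h1 := key _ _ _ h
  have h2 : (∑ l, pushes (F.code l)) * n ≤ (∑ l, pushes (F.code l)) * t := Nat.mul_le_mul_left _ hn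
  dsimp only [contents_inl] at h1
  omega

section Whole

variable {M : Bool → Turing.FinTM2} {𝒞 : GateSet}

/-- Convert the description of a circuit. -/
noncomputable def convert (hC : 𝒞.HasReversibleGates) : Program M :=
  .seq (readNumber .anc) <| .seq (readNumber .wit) <|
  .seq (emitList [⟨[.anc, .low], 2⟩, ⟨[.wit, .low], 0⟩]) <|
  .seq (onQubit (emit target)) (convertOps hC)

/-- The contents of the other stacks, the input and the output being empty. -/
def aux (d r o : List Bool) : Aux → List Bool
  | .input => []
  | .desc => d
  | .rev => r
  | .output => o

theorem length_describe (V : VerifierCircuit 𝒞) :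
    V.anc + V.wit + V.ops.length ≤ V.describe.length := by
  have h1 : V.describe = encode ([V.anc, V.wit, (V.out : ℕ)] ++ V.ops.flatMap Op.tokens) := rfl
  have h2 : ∀ l : List (Op 𝒞 (V.anc + V.wit)), l.length ≤ (l.flatMap Op.tokens).length := by
    intro l
    induction l with
    | nil => simp
    | cons op l ih =>
      have h3 : 1 ≤ op.tokens.length := by cases op <;> simp [Op.tokens]
      rw [List.flatMap_cons, List.length_append, List.length_cons]
      omega
  have h3 := h2 V.ops
  rw [h1, length_encode, List.sum_append, List.length_append]
  simp only [List.sum_cons, List.length_cons]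
  omega

theorem describe_truncCircuit (hC : 𝒞.HasReversibleGates) (V : VerifierCircuit 𝒞) {m : ℕ}
    (hm : 8 * V.numIncr < 2 ^ m) : (V.truncCircuit hC m).describe =
      encode [V.anc + m + 2, V.wit + m] ++ (encode [TruncLayout.shiftQubit V.anc m V.out] ++
        encode ((V.ops.flatMap (TruncLayout.truncOp hC V.anc V.wit m (truncBits m V.numIncr - m)
          (m + 1))).flatMap Op.tokens)) := by
  have h1 : truncBits m V.numIncr - m = 1 := by rw [truncBits_eq hm]; omega
  have h2 : ((V.truncCircuit hC m).out : ℕ) = TruncLayout.shiftQubit V.anc m V.out :=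
    TruncLayout.val_layoutQubit h1 rfl _
  have h3 : (V.truncCircuit hC m).anc = V.anc + m + 2 := by
    change V.anc + (truncBits m V.numIncr - m) + (m + 1) = _
    omega
  have h4 : (V.truncCircuit hC m).describe = encode ([(V.truncCircuit hC m).anc, V.wit + m,
      ((V.truncCircuit hC m).out : ℕ)] ++ (V.ops.flatMap (TruncLayout.truncOp hC V.anc V.wit m
        (truncBits m V.numIncr - m) (m + 1))).flatMap Op.tokens) := rfl
  rw [h4, h2, h3, ← encode_append, ← encode_append]
  rfl

theorem exists_run_convert (hC : 𝒞.HasReversibleGates) : ∃ C, ∀ (V : VerifierCircuit 𝒞) (m : ℕ),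
    8 * V.numIncr < 2 ^ m → (convert hC : Program M).Run (C * (V.describe.length + m + 3) ^ 3)
      (state (regs 0 0 m) (aux V.describe [] []))
      (state (regs V.anc V.wit m) (aux [] (V.truncCircuit hC m).describe.reverse [])) := by
  obtain ⟨C₁, hC₁⟩ := ((writes_emitList (M := M)
    [⟨[.anc, .low], 2⟩, ⟨[.wit, .low], 0⟩] (by decide)).mono (d' := 2) (fun _ h => h)
    (by norm_num)).converts (fun _ _ _ => rfl)
  obtain ⟨C₂, hC₂⟩ := (writes_emitTarget (M := M)).converts_onQubit
  obtain ⟨C₃, hC₃⟩ := exists_run_convertOps (M := M) hC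
  refine ⟨C₁ + C₂ + C₃ + 10, fun V m hm => ?_⟩
  set l₁ := encode (V.ops.flatMap Op.tokens) with hl₁
  have hd : V.describe = List.replicate V.anc true ++ false :: (List.replicate V.wit true ++
      false :: (encode [(V.out : ℕ)] ++ l₁)) := by
    rw [hl₁, ← encode_append, ← encode_cons, ← encode_cons]
    rfl
  have hb : truncBits m V.numIncr - m = 1 := by rw [truncBits_eq hm]; omega
  have h1 := (run_readNumber (M := M) .anc V.anc (regs 0 0 m) (D := aux V.describe [] []) hd).congr
    (E₂ := state (regs V.anc 0 m) (aux (List.replicate V.wit true ++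
      false :: (encode [(V.out : ℕ)] ++ l₁)) [] [])) (by
      congr 1
      · funext r; cases r <;> simp [regs]
      · funext o; cases o <;> rfl)
  have h2 := (run_readNumber (M := M) .wit V.wit (regs V.anc 0 m)
    (D := aux (List.replicate V.wit true ++ false :: (encode [(V.out : ℕ)] ++ l₁)) [] [])
    rfl).congr (E₂ := state (regs V.anc V.wit m) (aux (encode [(V.out : ℕ)] ++ l₁) [] [])) (by
      congr 1
      · funext r; cases r <;> simp [regs]
      · funext o; cases o <;> rfl)
  have h3 := hC₁ V.anc V.wit m (aux (encode [(V.out : ℕ)] ++ l₁) [] [])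
    (encode [(V.out : ℕ)] ++ l₁) rfl
  have h4 := hC₂ V.anc V.wit m V.out V.out.2 (aux (encode [(V.out : ℕ)] ++ l₁)
    (encode [V.anc + m + 2, V.wit + m]).reverse []) l₁ rfl
  have h5 := hC₃ V.anc V.wit m _ (m + 1) hb rfl V.ops (aux l₁
    ((encode [TruncLayout.shiftQubit V.anc m V.out]).reverse ++
      (encode [V.anc + m + 2, V.wit + m]).reverse) []) rfl
  have hlen := length_describe V
  set n := V.describe.length
  refine (h1.seq (h2.seq ((h3.congr ?_).seq ((h4.congr ?_).seq (h5.congr ?_))))).mono ?_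
  · congr 1
    funext o; cases o <;> simp [aux, regs, Expr.eval]
  · congr 1
    funext o; cases o <;> simp [aux]
  · rw [describe_truncCircuit hC V hm]
    congr 1
    funext o; cases o <;> simp [aux]
  · set s := V.anc + V.wit + m + 3 with hs
    have h6 : s ≤ n + m + 3 := by omega
    have h7 : s ^ 2 ≤ (n + m + 3) ^ 2 := Nat.pow_le_pow_left h6 2
    have h8 : (n + m + 3) ^ 2 ≤ (n + m + 3) ^ 3 := Nat.pow_le_pow_right (by omega) (by norm_num)
    have h9 : n + m + 3 ≤ (n + m + 3) ^ 3 := Nat.le_self_pow (by norm_num) _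
    have h10 : s ^ 2 * V.ops.length ≤ (n + m + 3) ^ 3 := by
      rw [pow_succ (n + m + 3) 2]
      exact Nat.mul_le_mul h7 (by omega)
    have h11 : (C₃ * s ^ 2 + 1) * V.ops.length = C₃ * (s ^ 2 * V.ops.length) + V.ops.length := by
      ring
    have h12 := Nat.mul_le_mul_left C₁ (h7.trans h8)
    have h13 := Nat.mul_le_mul_left C₂ (h7.trans h8)
    have h14 := Nat.mul_le_mul_left C₃ h10
    rw [h11, Nat.add_mul, Nat.add_mul, Nat.add_mul]
    omega

/-- The program that computes the description of the truncated circuit: the machine `M false`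
computes the description of the given circuit, and the machine `M true` the number of low bits of
the truncated counter. -/
noncomputable def truncationProgram (hC : 𝒞.HasReversibleGates)
    (enc : ∀ i, Bool → (M i).Γ (M i).k₀) (dec : ∀ i, (M i).Γ (M i).k₁ → Bool) : Program M :=
  .seq (.split (.inr .input) (.inr .rev) (.inr .output)) <|
  .seq (.evaluate false (.inr .rev) (.inr .rev) (enc false) (dec false)) <|
  .seq (.move (.inr .rev) (.inr .desc)) <|
  .seq (.evaluate true (.inr .output) (.inl .low) (enc true) (dec true)) <|
  .seq (convert hC) <|
  .seq (.move (.inr .rev) (.inr .output)) <|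
  .seq (.clear (.inl .anc)) <| .seq (.clear (.inl .wit)) (.clear (.inl .low))

theorem exists_run_truncationProgram (hC : 𝒞.HasReversibleGates)
    (enc : ∀ i, Bool → (M i).Γ (M i).k₀) (dec : ∀ i, (M i).Γ (M i).k₁ → Bool) :
    ∃ C, ∀ (x : List Bool) (V : VerifierCircuit 𝒞) (m t t' : ℕ)
      (rV : List ((M false).Γ (M false).k₁)) (rm : List ((M true).Γ (M true).k₁)),
      8 * V.numIncr < 2 ^ m → rV.map (dec false) = V.describe →
      rm.map (dec true) = List.replicate m true →
      Nonempty (Turing.TM2OutputsInTime (M false) (x.map (enc false)) (some rV) t) →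
      Nonempty (Turing.TM2OutputsInTime (M true) (x.map (enc true)) (some rm) t') →
      (truncationProgram hC enc dec).Run
        (C * (x.length + t + t' + V.describe.length + m + 3) ^ 3)
        (Function.update (fun _ => []) (.inr .input) x)
        (Function.update (fun _ => []) (.inr .output) (V.truncCircuit hC m).describe) := by
  obtain ⟨C, hC'⟩ := exists_run_convert (M := M) hC
  obtain ⟨C', hlen⟩ := Fragment.exists_length_le (convert hC : Program M)
  refine ⟨C + 2 * C' * C + 40, fun x V m t t' rV rm hm hrV hrm ⟨hV⟩ ⟨hm'⟩ => ?_⟩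
  have h0 : Function.update (fun _ => []) (.inr .input) x =
      state (regs 0 0 0) (Function.update (aux [] [] []) .input x) := by
    rw [← update_state_inr]
    congr 1
    funext k
    rcases k with r | o
    · cases r <;> rfl
    · cases o <;> rfl
  have h1 := (Fragment.run_split (M := M) (o := .inr Aux.input) (o₁ := .inr Aux.rev)
    (o₂ := .inr Aux.output) (by simp) (by simp) (by simp) x
    (E := state (regs 0 0 0) (Function.update (aux [] [] []) .input x)) rfl).congr
    (E₂ := state (regs 0 0 0) (aux [] x.reverse x.reverse)) (by
      simp only [update_state_inr]
      congr 1
      funext o; cases o <;> simp [aux])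
  have h2 := (Fragment.run_evaluate (M := M) false (.inr Aux.rev) (.inr Aux.rev) hrV hV
    (E := state (regs 0 0 0) (aux [] x.reverse x.reverse)) rfl).congr
    (E₂ := state (regs 0 0 0) (aux [] V.describe.reverse x.reverse)) (by
      simp only [update_state_inr]
      congr 1
      funext o; cases o <;> simp [aux])
  have h3 := (Fragment.run_move (M := M) (o := .inr Aux.rev) (o' := .inr Aux.desc) (by simp)
    (state (regs 0 0 0) (aux [] V.describe.reverse x.reverse))).congr
    (E₂ := state (regs 0 0 0) (aux V.describe [] x.reverse)) (by
      simp only [update_state_inr]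
      congr 1
      funext o; cases o <;> simp [aux])
  have h4 := (Fragment.run_evaluate (M := M) true (.inr Aux.output) (.inl Reg.low) hrm hm'
    (E := state (regs 0 0 0) (aux V.describe [] x.reverse)) rfl).congr
    (E₂ := state (regs 0 0 m) (aux V.describe [] [])) (by
      simp only [update_state_inr, state_inl, List.reverse_replicate,
        List.replicate_append_replicate, update_state_inl]
      congr 1
      · funext r; cases r <;> simp [regs]
      · funext o; cases o <;> simp [aux])
  have h5 := hC' V m hm
  set d := (V.truncCircuit hC m).describe
  have h6 := (Fragment.run_move (M := M) (o := .inr Aux.rev) (o' := .inr Aux.output) (by simp)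
    (state (regs V.anc V.wit m) (aux [] d.reverse []))).congr
    (E₂ := state (regs V.anc V.wit m) (aux [] [] d)) (by
      simp only [update_state_inr]
      congr 1
      funext o; cases o <;> simp [aux])
  have h7 := (Fragment.run_clear (M := M) (o := .inl Reg.anc) (n := V.anc)
    (E := state (regs V.anc V.wit m) (aux [] [] d)) rfl).congr
    (E₂ := state (regs 0 V.wit m) (aux [] [] d)) (by
      rw [update_state_inl_nil]
      congr 1
      funext r; cases r <;> simp [regs])
  have h8 := (Fragment.run_clear (M := M) (o := .inl Reg.wit) (n := V.wit)
    (E := state (regs 0 V.wit m) (aux [] [] d)) rfl).congr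
    (E₂ := state (regs 0 0 m) (aux [] [] d)) (by
      rw [update_state_inl_nil]
      congr 1
      funext r; cases r <;> simp [regs])
  have h9 := (Fragment.run_clear (M := M) (o := .inl Reg.low) (n := m)
    (E := state (regs 0 0 m) (aux [] [] d)) rfl).congr
    (E₂ := Function.update (fun _ => []) (.inr .output) d) (by
      rw [update_state_inl_nil]
      funext k
      rcases k with r | o
      · cases r <;> simp [regs]
      · cases o <;> simp [aux])
  -- the length of the new description, which `move` has to reverse, is bounded by the time that
  -- it took to write it
  have h10 := hlen _ _ _ (.inr .rev) h5
  have h11 := length_describe V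
  rw [h0]
  refine (h1.seq (h2.seq (h3.seq (h4.seq (h5.seq (h6.seq (h7.seq (h8.seq h9)))))))).mono ?_
  simp only [state_inr, aux, List.length_reverse, List.length_nil, Nat.zero_add,
    List.length_replicate] at h10 ⊢
  set n := V.describe.length
  have h12 : (n + m + 3) ^ 3 ≤ (x.length + t + t' + n + m + 3) ^ 3 :=
    Nat.pow_le_pow_left (by omega) 3
  have h13 : x.length + t + t' + n + m + 3 ≤ (x.length + t + t' + n + m + 3) ^ 3 :=
    Nat.le_self_pow (by norm_num) _
  have h14 := Nat.mul_le_mul_left C h12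
  have h15 := Nat.mul_le_mul_left C' h14
  have h16 : 2 * C' * C * (x.length + t + t' + n + m + 3) ^ 3 =
      2 * (C' * (C * (x.length + t + t' + n + m + 3) ^ 3)) := by ring
  rw [Nat.add_mul, Nat.add_mul, h16]
  omega

/-- The truncated circuits are uniformly generated. -/
theorem polyTimeUniform_truncCircuit (hC : 𝒞.HasReversibleGates)
    {V : List Bool → VerifierCircuit 𝒞} {m : List Bool → ℕ} (hV : PolyTimeUniform V)
    (hm : Nonempty (Turing.TM2ComputableInPolyTime id Computability.unaryEncodeNat m))
    (h : ∀ x, 8 * (V x).numIncr < 2 ^ m x) :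
    PolyTimeUniform fun x => (V x).truncCircuit hC (m x) := by
  obtain ⟨hV⟩ := hV
  obtain ⟨hm⟩ := hm
  let M : Bool → Turing.FinTM2 := Bool.rec hV.tm hm.tm
  let enc : ∀ i, Bool → (M i).Γ (M i).k₀ :=
    Bool.rec hV.inputAlphabet.invFun hm.inputAlphabet.invFun
  let dec : ∀ i, (M i).Γ (M i).k₁ → Bool :=
    Bool.rec hV.outputAlphabet hm.outputAlphabet
  obtain ⟨C, hrun⟩ := exists_run_truncationProgram hC enc dec
  obtain ⟨C₁, hC₁⟩ := exists_length_output_le hV.tm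
  obtain ⟨C₂, hC₂⟩ := exists_length_output_le hm.tm
  have hunary : ∀ n, Computability.unaryEncodeNat n = List.replicate n true := fun n => by
    induction n with
    | zero => rfl
    | succ n ih => rw [Computability.unaryEncodeNat, ih, List.replicate_succ]
  let S : Polynomial ℕ := 3 * .X + ((C₁ + 1 : ℕ) : Polynomial ℕ) * hV.time +
    ((C₂ + 1 : ℕ) : Polynomial ℕ) * hm.time + 3
  have key : ∀ x : List Bool, Nonempty (Turing.TM2OutputsInTime
      ((truncationProgram hC enc dec).toFinTM2 (.inr .input) (.inr .output)) x
      (some ((V x).truncCircuit hC (m x)).describe)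
      (((C : Polynomial ℕ) * S ^ 3 + 1).eval x.length)) := by
    intro x
    have h1 := hV.outputsFun x
    have h2 := hm.outputsFun x
    have h3 := hC₁ _ _ _ h1
    have h4 := hC₂ _ _ _ h2
    have h5 := hrun x (V x) (m x) _ _ _ _ (h x) (by simp [dec, M]) (by simp [dec, M, hunary])
      ⟨h1⟩ ⟨h2⟩
    simp only [id, List.length_map, hunary, List.length_replicate] at h3 h4
    have h6 : (C : ℕ) * (x.length + hV.time.eval x.length + hm.time.eval x.length +
        (V x).describe.length + m x + 3) ^ 3 ≤ ((C : Polynomial ℕ) * S ^ 3).eval x.length := by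
      simp only [Polynomial.eval_mul, Polynomial.eval_natCast, Polynomial.eval_pow]
      refine Nat.mul_le_mul_left _ (Nat.pow_le_pow_left ?_ 3)
      simp [S]
      rw [Nat.add_mul, Nat.add_mul]
      omega
    have h7 := (h5.mono h6).outputsInTime
    rwa [Polynomial.eval_add, Polynomial.eval_one]
  exact ⟨{
    tm := (truncationProgram hC enc dec).toFinTM2 (.inr .input) (.inr .output)
    inputAlphabet := Equiv.refl Bool
    outputAlphabet := Equiv.refl Bool
    time := (C : Polynomial ℕ) * S ^ 3 + 1
    outputsFun := fun x => by
      have h1 := (key x).some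
      have h2 : ∀ l : List Bool, l.map (Equiv.refl Bool).invFun = l := fun l => List.map_id l
      exact cast (congrArg₂ (fun l l' : List Bool => Turing.TM2OutputsInTime
        ((truncationProgram hC enc dec).toFinTM2 (.inr .input) (.inr .output)) l (some l')
        (((C : Polynomial ℕ) * S ^ 3 + 1).eval x.length)) (h2 _) (h2 _)).symm h1 }⟩

end Whole

end StackProgram

theorem mainTheorem5 :
    ∃ K : ℝ, ∀ (𝒞 : GateSet), 𝒞.HasReversibleGates →
      ∀ (L : PromiseProblem) (V : List Bool → VerifierCircuit 𝒞) (c s : List Bool → ℝ)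
        (m : List Bool → ℕ),
        IsQMAInfVerifier V L c s →
        Nonempty (Turing.TM2ComputableInPolyTime id Computability.unaryEncodeNat m) →
        (∀ x, 0 < m x) →
        (∀ x, 8 * (V x).numIncr < 2 ^ m x) →
        ∃ V' : List Bool → VerifierCircuit 𝒞,
          (∀ x, (V x).IsTruncationCircuit (m x) (V' x)) ∧
          IsQMAVerifier V' L
            (fun x => c x - K * √(((V x).numIncr : ℝ) / 2 ^ m x)) s := by
  refine ⟨4, fun 𝒞 hC L V c s m ⟨hV, hyes, hno⟩ hm hm0 hℓ => ?_⟩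
  have htrunc : ∀ x, (V x).IsTruncationCircuit (m x) ((V x).truncCircuit hC (m x)) := fun x =>
    (V x).isTruncationCircuit_truncCircuit hC (hℓ x)
  refine ⟨fun x => (V x).truncCircuit hC (m x), htrunc,
    StackProgram.polyTimeUniform_truncCircuit hC hV hm hℓ,
    fun x => (V x).counterFree_truncCircuit hC, fun x hx => ?_, fun x hx v hv =>
      (htrunc x).acceptProb_le (hno x hx) hv⟩
  obtain ⟨w, hw, hcw⟩ := hyes x hx
  obtain ⟨v, hv, hvw⟩ := (htrunc x).exists_le_acceptProb (hm0 x) (hℓ x) hw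
  exact ⟨v, hv, le_trans (by linarith) hvw⟩
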